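/- **Setting.** Let $M\subset\mathbb C^4$ be a real analytic real hypersurface, with CR bundle $\mathcal H=T^{1,0}\mathbb C^4\cap\mathbb CTM$, and let $p\in M$. An *adapted frame* near $p$ consists of a real vector field $g$ on $M$ transversal to $\mathcal H\oplus\overline{\mathcal H}$ and of sections $f_1,f_2,e$ forming a frame of $\mathcal H$ such that $\frac1{2i}[f_a,\overline{f_b}]\equiv H_{ab}\,g$ and $[e,\overline{f_b}]\equiv[e,\overline e]\equiv0 \pmod{\mathcal H\oplus\overline{\mathcal H}}$ with $H=(H_{ab})$ invertible; so the Levi form has constant rank $2$ and $e$ spans its kernel $\mathcal K$. Define matrices $\Xi,\Omega$ by $$[e,\overline{f_k}]\equiv\sum_l\Xi_{lk}f_l \ \ (\mathrm{mod}\ \mathcal K\oplus\overline{\mathcal H}),\qquad [e,f_k]\equiv\sum_l\Omega_{lk}f_l\ \ (\mathrm{mod}\ \mathcal K\oplus\overline{\mathcal K}),$$ and put $S^{0,2}=\Xi H^{-1}$, $S^{0,-2}=H\overline\Xi$. $M$ is *$2$-nondegenerate* at $p$ if an adapted frame exists near $p$ and $\Xi(p)\ne0$. Given $\mathbf H$,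 $S$ put $T=\mathbf H\overline S\mathbf H^T$ and $\mathfrak g_{0,0}'=\{B\in\mathfrak{gl}(2,\mathbb C): BS+SB^T\in\mathbb CS,\ B^TT+TB\in\mathbb CT\}$. For a space $N$ of symmetric matrices, $M$ *has modified symbol* $(\mathbf H,S,\Omega_0)$ at $p$ with respect to the normalization condition $N$ if there is an adapted frame near $p$ with $H(p)=\mathbf H$, $S^{0,2}(p)=S$, $e(S^{0,-2})(p)\in\mathbb C\,S^{0,-2}(p)$, $e(S^{0,2})(p)\in N+\mathbb CS$, and $\Omega(p)-\Omega_0\in\mathfrak g'_{0,0}$. The *isotropy* of $M$ at $p$ consists of the germs at $p$ of holomorphic vector fields that vanish at $p$ and whose real part is tangent to $M$. Its *weighted degree zero* part is the isotropy modulo the fields of positive weight, i.e. those whose linear part at $p$ maps $T_p\mathbb C^4$ into $\mathcal H_p$, $\mathcal H_p$ into $\mathcal K_p$, and $\mathcal K_p$ to $0$ (the weights of $w,z,\zeta$ below being $2,1,0$). **Table.** Consider the following triples $(\mathbf H,S,\Omega)$ and spaces $N$, with $\epsilon=\pm1$, $\lambda>1$, $0<\theta<\pi$, $\tau\ge0$;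 put $J=\begin{pmatrix}0&1\\1&0\end{pmatrix}$, $D_\epsilon=\begin{pmatrix}1&0\\0&\epsilon\end{pmatrix}$, and let $E_{jk}$ be the matrix units. 1. $D_\epsilon$, $\begin{pmatrix}1&0\\0&\lambda\end{pmatrix}$, $\begin{pmatrix}0&-\tau\lambda\\\tau&0\end{pmatrix}$, $N=\langle E_{22}\rangle$; 2. $J$, $\begin{pmatrix}1&0\\0&e^{i\theta}\end{pmatrix}$, $\begin{pmatrix}0&-\tau e^{i\theta}\\\tau&0\end{pmatrix}$, $N=\langle E_{22}\rangle$; 3. $D_\epsilon$, $J$, $0$, $N=\langle E_{11},E_{22}\rangle$; 4. $D_\epsilon$, $\begin{pmatrix}1&0\\0&0\end{pmatrix}$, $\begin{pmatrix}0&0\\\tau&0\end{pmatrix}$, $N=\langle E_{22}\rangle$; 5. $J$, $J$, $0$, $N=\langle E_{11},E_{22}\rangle$; 6. $J$, $\begin{pmatrix}1&1\\1&0\end{pmatrix}$, $\begin{pmatrix}2\tau&\tau\\0&0\end{pmatrix}$, $N=\langle E_{22}\rangle$; 7. $J$, $\begin{pmatrix}1&0\\0&0\end{pmatrix}$, $0$,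 $N=\langle E_{12}+E_{21},E_{22}\rangle$. **Models.** For such a triple let $\mathbf S(\zeta)$ be the symmetric matrix with $$(\mathbf S(\zeta),0)=\ln\bigl(\exp(S\zeta,\Omega\zeta)\,\exp(0,-\Omega\zeta)\bigr),\qquad (S,L):=\begin{pmatrix}L&S\\0&-L^T\end{pmatrix},$$ and let $M_0$ be the germ at $0$ of the hypersurface in $\mathbb C^4$, with coordinates $(w,z,\zeta)$, $z=(z_1,z_2)^T$, given by $$\Re(w)=z^TH(\zeta,\overline\zeta)\overline z+\Re\bigl(\overline z^TS(\zeta,\overline\zeta)\overline z\bigr),$$ $$H(\zeta,\overline\zeta)=\tfrac12\bigl(\mathbf H(\mathrm{Id}-\overline{\mathbf S}\mathbf H^T\mathbf S\mathbf H)^{-1}+(\mathrm{Id}-\mathbf H\overline{\mathbf S}\mathbf H^T\mathbf S)^{-1}\mathbf H\bigr),\quad S(\zeta,\overline\zeta)=\mathbf H^T(\mathrm{Id}-\mathbf S\mathbf H\overline{\mathbf S}\mathbf H^T)^{-1}\mathbf S\mathbf H,\quad \mathbf S=\mathbf S(\zeta).$$ **Statement.** For each triple $(\mathbf H,S,\Omega)$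 of the table, the model $M_0$ is $2$-nondegenerate and has modified symbol $(\mathbf H,S,\Omega)$ at $0$ with respect to $N$. Moreover, for every real analytic hypersurface $M\subset\mathbb C^4$ with Levi form of constant rank $2$ that is $2$-nondegenerate at a point $p$ and has this modified symbol at $p$ with respect to $N$, the real dimension of the weighted degree zero isotropy of $M$ at $p$ is at most that of $M_0$ at $0$. -/

import Mathlib

open scoped ContDiff Topology Matrix

noncomputable section

namespace CR4

/-- The space `ℂ⁴` with coordinates `(w, z, ζ)`, `z = (z₁, z₂)`. -/
abbrev C4 : Type := ℂ × (Fin 2 → ℂ) × ℂ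

/-- Complex `2 × 2` matrices. -/
abbrev M2 : Type := Matrix (Fin 2) (Fin 2) ℂ

/-- Entrywise complex conjugation. -/
def conjM (A : M2) : M2 := A.map (starRingEnd ℂ)

/-! ### Complex vector fields

A vector of `ℂ ⊗ T ℂ⁴` is a pair `(a, b)` of vectors of `ℂ⁴`, standing for
`∑ aⱼ ∂/∂zⱼ + ∑ conj(bⱼ) ∂/∂z̄ⱼ`.  Complex conjugation is the swap of the two entries,
`(a, 0)` is of type `(1,0)`, `(0, b)` is the conjugate of `(b, 0)`, a real vector `v` is `(v, v)`,
and a complex number `c` multiplies `(a, b)` to `(c a, conj(c) b)`. -/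

/-- The derivative of `F` at `x` in the complex direction `(a, b)`, i.e.
`∑ aⱼ ∂F/∂zⱼ + ∑ conj(bⱼ) ∂F/∂z̄ⱼ`. -/
def along {W : Type*} [NormedAddCommGroup W] [NormedSpace ℂ W]
    (Z : C4 × C4) (F : C4 → W) (x : C4) : W :=
  (1 / 2 : ℂ) • (fderiv ℝ F x Z.1 - Complex.I • fderiv ℝ F x (Complex.I • Z.1)) +
  (1 / 2 : ℂ) • (fderiv ℝ F x Z.2 + Complex.I • fderiv ℝ F x (Complex.I • Z.2))

/-- The Lie bracket of two complex vector fields. -/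
def bracket (Z Z' : C4 → C4 × C4) (x : C4) : C4 × C4 :=
  (along (Z x) (fun y => (Z' y).1) x - along (Z' x) (fun y => (Z y).1) x,
   along (Z x).swap (fun y => (Z' y).2) x - along (Z' x).swap (fun y => (Z y).2) x)

/-- The vector field of type `(1,0)` with coefficients `Y`. -/
def hol (Y : C4 → C4) : C4 → C4 × C4 := fun x => (Y x, 0)

/-- The complex conjugate of `hol Y`. -/
def antihol (Y : C4 → C4) : C4 → C4 × C4 := fun x => (0, Y x)

/-! ### The CR structure of the hypersurface `{ρ = 0}` -/

/-- The fibre at `x` of the CR bundle `ℋ` of the hypersurface `{ρ = ρ x}`: the complex vectors `a`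
such that `a` and `i a` are tangent to it. -/
def holTangent (ρ : C4 → ℝ) (x : C4) : Submodule ℂ C4 where
  carrier := {a | fderiv ℝ ρ x a = 0 ∧ fderiv ℝ ρ x (Complex.I • a) = 0}
  add_mem' := by
    rintro a b ⟨ha, ha'⟩ ⟨hb, hb'⟩
    exact ⟨by rw [map_add, ha, hb, add_zero], by rw [smul_add, map_add, ha', hb', add_zero]⟩
  zero_mem' := by simp
  smul_mem' := by
    rintro c a ⟨ha, ha'⟩
    have h : c • a = c.re • a + c.im • (Complex.I • a) := by
      conv_lhs => rw [← Complex.re_add_im c]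
      rw [add_smul, mul_smul, Complex.coe_smul, Complex.coe_smul]
    have h' : Complex.I • c • a = c.re • (Complex.I • a) - c.im • a := by
      rw [h, smul_add, smul_comm Complex.I c.re, smul_comm Complex.I c.im, smul_smul Complex.I,
        Complex.I_mul_I, neg_one_smul, smul_neg, sub_eq_add_neg]
    exact ⟨by rw [h, map_add, map_smul, map_smul, ha, ha']; simp,
      by
        have k : fderiv ℝ ρ x (c.re • (Complex.I • a)) = c.re • fderiv ℝ ρ x (Complex.I • a) :=
          ContinuousLinearMap.map_smul _ _ _
        rw [h', map_sub, k, ha', map_smul, ha]; simp⟩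

/-- Germs at `p` of smooth sections of `ℋ` (extended off the hypersurface). -/
def IsSection (ρ : C4 → ℝ) (p : C4) (Y : C4 → C4) : Prop :=
  ContDiffAt ℝ ∞ Y p ∧ ∀ᶠ x in 𝓝 p, ρ x = 0 → Y x ∈ holTangent ρ x

/-- `Z ∈ ℋ ⊕ conj ℋ` at `x`. -/
def InHH (ρ : C4 → ℝ) (x : C4) (Z : C4 × C4) : Prop :=
  Z.1 ∈ holTangent ρ x ∧ Z.2 ∈ holTangent ρ x

/-- The Levi kernel `𝒦` at `p`: the values at `p` of sections `A` of `ℋ` such that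
`[A, conj B]` lies in `ℋ ⊕ conj ℋ` at `p` for all sections `B` of `ℋ`. -/
def leviKernel (ρ : C4 → ℝ) (p : C4) : Submodule ℂ C4 where
  carrier := {a | ∃ A : C4 → C4, IsSection ρ p A ∧ A p = a ∧
    ∀ B : C4 → C4, IsSection ρ p B → InHH ρ p (bracket (hol A) (antihol B) p)}
  add_mem' := by
    rintro a b ⟨A, hA, rfl, hA'⟩ ⟨B, hB, rfl, hB'⟩
    refine ⟨fun x => A x + B x, ⟨hA.1.add hB.1, ?_⟩, rfl, fun C hC => ?_⟩
    · filter_upwards [hA.2, hB.2] with x h1 h2 h3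
      exact add_mem (h1 h3) (h2 h3)
    · have h1 := hA' C hC
      have h2 := hB' C hC
      have e : bracket (hol fun x => A x + B x) (antihol C) p =
          bracket (hol A) (antihol C) p + bracket (hol B) (antihol C) p := by
        have dA : DifferentiableAt ℝ A p := hA.1.differentiableAt (by simp)
        have dB : DifferentiableAt ℝ B p := hB.1.differentiableAt (by simp)
        ext1
        · simp [bracket, hol, antihol, along, fderiv_fun_add dA dB]
          module
        · simp [bracket, hol, antihol, along]
          module
      rw [e]
      exact ⟨add_mem h1.1 h2.1, add_mem h1.2 h2.2⟩
  zero_mem' := by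
    refine ⟨fun _ => 0, ⟨contDiffAt_const, ?_⟩, rfl, fun C _ => ?_⟩
    · filter_upwards with x _ using zero_mem _
    · simp [InHH, bracket, hol, antihol, along]
  smul_mem' := by
    rintro c a ⟨A, hA, rfl, hA'⟩
    refine ⟨fun x => c • A x, ⟨hA.1.const_smul c, ?_⟩, rfl, fun C hC => ?_⟩
    · filter_upwards [hA.2] with x h1 h3
      exact Submodule.smul_mem _ _ (h1 h3)
    · have h1 := hA' C hC
      have e : bracket (hol fun x => c • A x) (antihol C) p =
          (c • (bracket (hol A) (antihol C) p).1,
            (starRingEnd ℂ c) • (bracket (hol A) (antihol C) p).2) := by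
        have dA : DifferentiableAt ℝ A p := hA.1.differentiableAt (by simp)
        have key : ∀ v : C4, fderiv ℝ C p (c • v) =
            c.re • fderiv ℝ C p v + c.im • fderiv ℝ C p (Complex.I • v) := by
          intro v
          rw [← map_smul, ← map_smul, ← map_add]
          congr 1
          conv_lhs => rw [← Complex.re_add_im c]
          rw [add_smul, mul_smul, Complex.coe_smul, Complex.coe_smul]
        ext1
        · simp [bracket, hol, antihol, along, fderiv_fun_const_smul dA c]
          module
        · have k1 := key (A p)
          have k2 := key (Complex.I • A p)
          rw [smul_smul Complex.I Complex.I, Complex.I_mul_I, neg_one_smul, map_neg] at k2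
          have hc : (starRingEnd ℂ) c = (c.re : ℂ) - c.im * Complex.I := by
            apply Complex.ext <;> simp
          simp only [bracket, hol, antihol, along, Prod.swap, fderiv_fun_const, Pi.zero_apply,
            zero_apply, map_zero, smul_zero, sub_zero, add_zero, zero_add]
          rw [smul_comm Complex.I c, k1, k2, hc]
          simp only [← Complex.coe_smul]
          match_scalars
          · linear_combination (0 : ℂ) * Complex.I_mul_I
          · linear_combination (c.im / 2 : ℂ) * Complex.I_mul_I
      rw [e]
      exact ⟨Submodule.smul_mem _ _ h1.1, Submodule.smul_mem _ _ h1.2⟩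

/-! ### Adapted frames and modified symbols -/

/-- An adapted frame `(g, f₁, f₂, e)` of the hypersurface `{ρ = 0}` near `p`: `g` is a real
transversal vector field, `f₁, f₂, e` span `ℋ`, and the Levi form
`(1/2i) [·, conj ·] mod ℋ ⊕ conj ℋ` has in it the matrix `diag(levi, 0)` with `levi` invertible,
so that the Levi form has constant rank two and `e` spans the Levi kernel `𝒦`.
The matrices `xi` and `om` are given by
`[e, conj fₖ] ≡ ∑ xiₗₖ fₗ mod 𝒦 ⊕ conj ℋ` and `[e, fₖ] ≡ ∑ omₗₖ fₗ mod 𝒦 ⊕ conj 𝒦`.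
All fields and functions are extended smoothly off the hypersurface; the relations
are required on the hypersurface only. -/
structure AdaptedFrame (ρ : C4 → ℝ) (p : C4) where
  g : C4 → C4
  f : Fin 2 → C4 → C4
  e : C4 → C4
  levi : C4 → M2
  xi : C4 → M2
  om : C4 → M2
  smooth_g : ContDiffAt ℝ ∞ g p
  smooth_f : ∀ k, ContDiffAt ℝ ∞ (f k) p
  smooth_e : ContDiffAt ℝ ∞ e p
  smooth_levi : ∀ i j, ContDiffAt ℝ ∞ (fun x => levi x i j) p
  smooth_xi : ∀ i j, ContDiffAt ℝ ∞ (fun x => xi x i j) p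
  smooth_om : ∀ i j, ContDiffAt ℝ ∞ (fun x => om x i j) p
  tangent_g : ∀ᶠ x in 𝓝 p, ρ x = 0 → fderiv ℝ ρ x (g x) = 0
  tangent_f : ∀ k, ∀ᶠ x in 𝓝 p, ρ x = 0 → f k x ∈ holTangent ρ x
  tangent_e : ∀ᶠ x in 𝓝 p, ρ x = 0 → e x ∈ holTangent ρ x
  isFrame : ∀ᶠ x in 𝓝 p, ρ x = 0 →
    g x ∉ holTangent ρ x ∧ LinearIndependent ℂ ![f 0 x, f 1 x, e x]
  levi_ff : ∀ᶠ x in 𝓝 p, ρ x = 0 → ∀ a b,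
    (bracket (hol (f a)) (antihol (f b)) x).1 - (2 * Complex.I * levi x a b) • g x
        ∈ holTangent ρ x ∧
    (bracket (hol (f a)) (antihol (f b)) x).2
        - (starRingEnd ℂ) (2 * Complex.I * levi x a b) • g x ∈ holTangent ρ x
  levi_ef : ∀ᶠ x in 𝓝 p, ρ x = 0 → ∀ b, InHH ρ x (bracket (hol e) (antihol (f b)) x)
  levi_ee : ∀ᶠ x in 𝓝 p, ρ x = 0 → InHH ρ x (bracket (hol e) (antihol e) x)
  levi_nondeg : ∀ᶠ x in 𝓝 p, ρ x = 0 → IsUnit (levi x).det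
  xi_spec : ∀ᶠ x in 𝓝 p, ρ x = 0 → ∀ k,
    (bracket (hol e) (antihol (f k)) x).1 - ∑ l, xi x l k • f l x ∈ Submodule.span ℂ {e x} ∧
    (bracket (hol e) (antihol (f k)) x).2 ∈ holTangent ρ x
  om_spec : ∀ᶠ x in 𝓝 p, ρ x = 0 → ∀ k,
    (bracket (hol e) (hol (f k)) x).1 - ∑ l, om x l k • f l x ∈ Submodule.span ℂ {e x} ∧
    (bracket (hol e) (hol (f k)) x).2 ∈ Submodule.span ℂ {e x}

namespace AdaptedFrame

variable {ρ : C4 → ℝ} {p : C4}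

/-- The symmetric matrix `S^{0,2}` representing `ι(e)`. -/
def s02 (φ : AdaptedFrame ρ p) (x : C4) : M2 := φ.xi x * (φ.levi x)⁻¹

/-- The symmetric matrix `S^{0,-2}` representing `ι(conj e)`. -/
def s0m2 (φ : AdaptedFrame ρ p) (x : C4) : M2 := φ.levi x * conjM (φ.xi x)

/-- The derivative of a matrix-valued function along `e` at `p`. -/
def derivE (φ : AdaptedFrame ρ p) (F : C4 → M2) : M2 :=
  Matrix.of fun i j => along (φ.e p, 0) (fun x => F x i j) p

end AdaptedFrame

/-- `{ρ = 0}` is, near `p`, a real analytic hypersurface through `p` whose Levi form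
has constant rank two and which is `2`-nondegenerate at `p`. -/
def IsTwoNondegenerate (ρ : C4 → ℝ) (p : C4) : Prop :=
  AnalyticAt ℝ ρ p ∧ ρ p = 0 ∧ fderiv ℝ ρ p ≠ 0 ∧ ∃ φ : AdaptedFrame ρ p, φ.xi p ≠ 0

/-- The algebra `𝔤'₀₀` of the bigraded symbol represented by `H` and `S`: the matrices
whose action preserves the lines of `S^{0,2} = S` and of `S^{0,-2} = H conj(S) Hᵀ`. -/
def g00 (H S : M2) : Submodule ℂ M2 where
  carrier := {B | B * S + S * Bᵀ ∈ Submodule.span ℂ {S} ∧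
    Bᵀ * (H * conjM S * Hᵀ) + (H * conjM S * Hᵀ) * B ∈ Submodule.span ℂ {H * conjM S * Hᵀ}}
  add_mem' := by
    rintro A B ⟨hA, hA'⟩ ⟨hB, hB'⟩
    refine ⟨?_, ?_⟩
    · have := add_mem hA hB
      rwa [show A * S + S * Aᵀ + (B * S + S * Bᵀ) = (A + B) * S + S * (A + B)ᵀ by
        rw [Matrix.transpose_add, add_mul, mul_add]; abel] at this
    · have := add_mem hA' hB'
      rwa [add_add_add_comm, ← add_mul, ← mul_add, ← Matrix.transpose_add] at this
  zero_mem' := by simp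
  smul_mem' := by
    rintro c A ⟨hA, hA'⟩
    refine ⟨?_, ?_⟩
    · have := Submodule.smul_mem _ c hA
      rwa [smul_add, ← smul_mul_assoc, ← mul_smul_comm, ← Matrix.transpose_smul] at this
    · have := Submodule.smul_mem _ c hA'
      rwa [smul_add, ← smul_mul_assoc, ← mul_smul_comm, ← Matrix.transpose_smul] at this

/-- `{ρ = 0}` has at `p` the modified symbol represented by `(H, S, Ω)`, with respect to
the normalization condition given by the space `N`: there is an adapted frame with `levi = H` and
`S^{0,2} = S` at `p`, whose obstructions satisfy `O_{0,-2} = 0` (modulo the line of `S^{0,-2}`)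
and `O_{0,2} ∈ N` (modulo the line of `S^{0,2}`) at `p`, and for which `om` is at `p` equal to `Ω`
modulo `𝔤'₀₀`. -/
def HasModifiedSymbol (ρ : C4 → ℝ) (p : C4) (H S Ω : M2) (N : Submodule ℂ M2) : Prop :=
  ∃ φ : AdaptedFrame ρ p, φ.levi p = H ∧ φ.s02 p = S ∧
    φ.derivE φ.s0m2 ∈ Submodule.span ℂ {φ.s0m2 p} ∧
    φ.derivE φ.s02 ∈ N ⊔ Submodule.span ℂ {φ.s02 p} ∧
    φ.om p - Ω ∈ g00 H S

/-! ### Isotropy -/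

/-- `X` is an infinitesimal symmetry of the germ at `p` of `{ρ = 0}`: a holomorphic vector field
whose real part is tangent to the hypersurface. -/
def IsInfSymmetry (ρ : C4 → ℝ) (p : C4) (X : C4 → C4) : Prop :=
  AnalyticAt ℂ X p ∧ ∀ᶠ x in 𝓝 p, ρ x = 0 → fderiv ℝ ρ x (X x) = 0

/-- The linear isotropy algebra: the linear parts at `p` of the infinitesimal symmetries that
vanish at `p`. -/
def linearIsotropy (ρ : C4 → ℝ) (p : C4) : Submodule ℝ (C4 →L[ℂ] C4) where
  carrier := {L | ∃ X, IsInfSymmetry ρ p X ∧ X p = 0 ∧ fderiv ℂ X p = L}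
  add_mem' := by
    rintro _ _ ⟨X, hX, hX0, rfl⟩ ⟨Y, hY, hY0, rfl⟩
    refine ⟨fun x => X x + Y x, ⟨hX.1.add hY.1, ?_⟩, by simp [hX0, hY0], ?_⟩
    · filter_upwards [hX.2, hY.2] with x h1 h2 h3
      rw [map_add, h1 h3, h2 h3, add_zero]
    · exact fderiv_fun_add hX.1.differentiableAt hY.1.differentiableAt
  zero_mem' := ⟨fun _ => 0, ⟨analyticAt_const, by simp⟩, rfl, by simp⟩
  smul_mem' := by
    rintro c _ ⟨X, hX, hX0, rfl⟩
    refine ⟨fun x => (c : ℂ) • X x, ⟨analyticAt_const.fun_smul hX.1, ?_⟩, by simp [hX0], ?_⟩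
    · filter_upwards [hX.2] with x h1 h3
      rw [Complex.coe_smul, map_smul, h1 h3, smul_zero]
    · rw [fderiv_fun_const_smul hX.1.differentiableAt, Complex.coe_smul]

/-- The endomorphisms of positive weight for the filtration `0 ⊆ 𝒦 ⊆ ℋ ⊆ ℂ⁴` at `p`, whose
successive quotients have the weights `0` (the variable `ζ`), `-1` (the variables `z`) and
`-2` (the variable `w`). -/
def positiveWeight (ρ : C4 → ℝ) (p : C4) : Submodule ℝ (C4 →L[ℂ] C4) where
  carrier := {L | (∀ v, L v ∈ holTangent ρ p) ∧ (∀ v ∈ holTangent ρ p, L v ∈ leviKernel ρ p) ∧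
    ∀ v ∈ leviKernel ρ p, L v = 0}
  add_mem' := by
    rintro A B ⟨h1, h2, h3⟩ ⟨k1, k2, k3⟩
    exact ⟨fun v => add_mem (h1 v) (k1 v), fun v hv => add_mem (h2 v hv) (k2 v hv),
      fun v hv => by rw [add_apply, h3 v hv, k3 v hv, add_zero]⟩
  zero_mem' := by simp
  smul_mem' := by
    rintro c A ⟨h1, h2, h3⟩
    refine ⟨fun v => ?_, fun v hv => ?_, fun v hv => ?_⟩
    · rw [← Complex.coe_smul]; exact Submodule.smul_mem _ (c : ℂ) (h1 v)
    · rw [← Complex.coe_smul]; exact Submodule.smul_mem _ (c : ℂ) (h2 v hv)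
    · rw [smul_apply, h3 v hv, smul_zero]

/-- The dimension of the weighted degree zero isotropy of `{ρ = 0}` at `p`: the real dimension of
the isotropy algebra modulo its part of positive weight. -/
def degreeZeroIsotropyDim (ρ : C4 → ℝ) (p : C4) : ℕ :=
  Module.finrank ℝ ((linearIsotropy ρ p).map (positiveWeight ρ p).mkQ)

/-! ### The distinguished models -/

/-- The element `(S, L)` of `𝔠𝔰𝔭_{0,2} ⊕ 𝔠𝔰𝔭_{0,0}` as a symplectic matrix; in particular
`[(0, L), (S, 0)] = (L S + S Lᵀ, 0)`. -/
def csp (S L : M2) : Matrix (Fin 2 ⊕ Fin 2) (Fin 2 ⊕ Fin 2) ℂ :=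
  Matrix.fromBlocks L S 0 (-Lᵀ)

/-- The power series of the logarithm of a matrix. -/
def matLog (A : Matrix (Fin 2 ⊕ Fin 2) (Fin 2 ⊕ Fin 2) ℂ) :
    Matrix (Fin 2 ⊕ Fin 2) (Fin 2 ⊕ Fin 2) ℂ :=
  ∑' n : ℕ, ((-1) ^ n / (n + 1) : ℂ) • (A - 1) ^ (n + 1)

/-- The matrix `𝐒(ζ)` with `(𝐒(ζ), 0) = ln (exp (S ζ, Ω ζ) exp (0, -Ω ζ))`. -/
def bigS (S Ω : M2) (ζ : ℂ) : M2 :=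
  (matLog (NormedSpace.exp (csp (ζ • S) (ζ • Ω)) *
    NormedSpace.exp (csp 0 (-(ζ • Ω))))).toBlocks₁₂

/-- The coefficient matrix of `z conj(z)` determined by `H` and `T = 𝐒(ζ)`. -/
def coeffH (H T : M2) : M2 :=
  (1 / 2 : ℂ) • (H * (1 - conjM T * Hᵀ * T * H)⁻¹ + (1 - H * conjM T * Hᵀ * T)⁻¹ * H)

/-- The coefficient matrix of `conj(z) conj(z)` determined by `H` and `T = 𝐒(ζ)`. -/
def coeffS (H T : M2) : M2 :=
  Hᵀ * (1 - T * H * conjM T * Hᵀ)⁻¹ * T * H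

/-- The defining function of the distinguished model with data `H`, `S`, `Ω`. -/
def model (H S Ω : M2) : C4 → ℝ := fun x =>
  (x.2.1 ⬝ᵥ (coeffH H (bigS S Ω x.2.2) *ᵥ star x.2.1)).re +
    (star x.2.1 ⬝ᵥ (coeffS H (bigS S Ω x.2.2) *ᵥ star x.2.1)).re - x.1.re

/-- The table of modified symbols `(H, S, Ω)`, with the spaces `N` of the
normalization conditions. -/
inductive IsTableSymbol : M2 → M2 → M2 → Submodule ℂ M2 → Prop
  | row1 (ε : ℂ) (hε : ε = 1 ∨ ε = -1) (l τ : ℝ) (hl : 1 < l) (hτ : 0 ≤ τ) :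
      IsTableSymbol !![1, 0; 0, ε] !![1, 0; 0, (l : ℂ)] !![0, -(τ * l : ℂ); (τ : ℂ), 0]
        (Submodule.span ℂ {!![0, 0; 0, 1]})
  | row2 (θ τ : ℝ) (hθ : 0 < θ) (hθ' : θ < Real.pi) (hτ : 0 ≤ τ) :
      IsTableSymbol !![0, 1; 1, 0] !![1, 0; 0, Complex.exp (Complex.I * θ)]
        !![0, -(τ * Complex.exp (Complex.I * θ)); (τ : ℂ), 0]
        (Submodule.span ℂ {!![0, 0; 0, 1]})
  | row3 (ε : ℂ) (hε : ε = 1 ∨ ε = -1) :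
      IsTableSymbol !![1, 0; 0, ε] !![0, 1; 1, 0] 0
        (Submodule.span ℂ {!![1, 0; 0, 0], !![0, 0; 0, 1]})
  | row4 (ε : ℂ) (hε : ε = 1 ∨ ε = -1) (τ : ℝ) (hτ : 0 ≤ τ) :
      IsTableSymbol !![1, 0; 0, ε] !![1, 0; 0, 0] !![0, 0; (τ : ℂ), 0]
        (Submodule.span ℂ {!![0, 0; 0, 1]})
  | row5 :
      IsTableSymbol !![0, 1; 1, 0] !![0, 1; 1, 0] 0
        (Submodule.span ℂ {!![1, 0; 0, 0], !![0, 0; 0, 1]})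
  | row6 (τ : ℝ) (hτ : 0 ≤ τ) :
      IsTableSymbol !![0, 1; 1, 0] !![1, 1; 1, 0] !![(2 * τ : ℂ), (τ : ℂ); 0, 0]
        (Submodule.span ℂ {!![0, 0; 0, 1]})
  | row7 :
      IsTableSymbol !![0, 1; 1, 0] !![1, 0; 0, 0] 0
        (Submodule.span ℂ {!![0, 1; 1, 0], !![0, 0; 0, 1]})

end CR4

end

/-!
An infinitesimal symmetry that vanishes at `p` acts there on an adapted frame by
`g ↦ a g`, `f ↦ B f`, `e ↦ c e`, up to terms of positive weight, and its weight zero part is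
determined by `B`. Invariance of the Levi form and of `S^{0,2}` gives `Bᵀ H + H B̄ = a H` and
`B S + S Bᵀ = (a + c) S`. The matrix `Ω` and the `e`-derivative of `S^{0,2}` are invariant only up
to the choice of the frame, and the normalization condition `N` is just strong enough to remove
this ambiguity and to give `[B, Ω] = c Ω`. The real Lie algebra of all such `B` therefore bounds
the weighted degree zero isotropy. On the model the curve `𝐒(ζ)` is equivariant, so that every such
`B` is realised by the linear symmetry `a w ∂_w + B z ∂_z + c ζ ∂_ζ`, and the bound is attained.
-/

noncomputable section

namespace CR4

/-! ### Derivatives in complex directions -/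

lemma complex_smul_eq {V : Type*} [AddCommGroup V] [Module ℂ V] (c : ℂ) (v : V) :
    c • v = c.re • v + c.im • (Complex.I • v) := by
  conv_lhs => rw [← Complex.re_add_im c]
  rw [add_smul, mul_smul, Complex.coe_smul, Complex.coe_smul]

section Along

variable {W : Type*} [NormedAddCommGroup W] [NormedSpace ℂ W]

lemma along_const (Z : C4 × C4) (w : W) (x : C4) : along Z (fun _ => w) x = 0 := by
  simp [along]

lemma along_add_left (Z Z' : C4 × C4) (F : C4 → W) (x : C4) :
    along (Z + Z') F x = along Z F x + along Z' F x := by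
  simp only [along, Prod.fst_add, Prod.snd_add, smul_add, map_add]
  module

lemma along_smul_left (c : ℂ) (a b : C4) (F : C4 → W) (x : C4) :
    along (c • a, (starRingEnd ℂ) c • b) F x = c • along (a, b) F x := by
  have real_linear (c : ℂ) (v : C4) : fderiv ℝ F x (c • v) =
      (c.re : ℂ) • fderiv ℝ F x v + (c.im : ℂ) • fderiv ℝ F x (Complex.I • v) := by
    rw [complex_smul_eq, map_add, map_smul, map_smul, Complex.coe_smul, Complex.coe_smul]
  have I_smul_I_smul (v : C4) : Complex.I • Complex.I • v = -v := by
    rw [smul_smul, Complex.I_mul_I, neg_one_smul]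
  simp only [along]
  rw [smul_comm Complex.I c a, smul_comm Complex.I _ b]
  rw [real_linear c a, real_linear c (Complex.I • a), real_linear (starRingEnd ℂ c) b,
    real_linear (starRingEnd ℂ c) (Complex.I • b)]
  simp only [I_smul_I_smul, map_neg, Complex.conj_re, Complex.conj_im, Complex.ofReal_neg]
  conv_rhs => rw [← Complex.re_add_im c]
  match_scalars
  · ring
  · linear_combination (c.im / 2 : ℂ) * Complex.I_mul_I
  · ring
  · linear_combination (-c.im / 2 : ℂ) * Complex.I_mul_I

lemma along_hol_smul (c : ℂ) (a : C4) (F : C4 → W) (x : C4) :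
    along (c • a, 0) F x = c • along (a, 0) F x := by
  simpa using along_smul_left c a 0 F x

lemma along_antihol_smul (c : ℂ) (b : C4) (F : C4 → W) (x : C4) :
    along (0, c • b) F x = (starRingEnd ℂ) c • along (0, b) F x := by
  simpa using along_smul_left ((starRingEnd ℂ) c) 0 b F x

lemma along_hol_add (a a' : C4) (F : C4 → W) (x : C4) :
    along (a + a', 0) F x = along (a, 0) F x + along (a', 0) F x := by
  simpa using along_add_left (a, 0) (a', 0) F x

lemma along_antihol_add (b b' : C4) (F : C4 → W) (x : C4) :
    along (0, b + b') F x = along (0, b) F x + along (0, b') F x := by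
  simpa using along_add_left (0, b) (0, b') F x

lemma along_real (v : C4) (F : C4 → W) (x : C4) : along (v, v) F x = fderiv ℝ F x v := by
  simp only [along]
  module

lemma along_add {F G : C4 → W} {x : C4} (hF : DifferentiableAt ℝ F x)
    (hG : DifferentiableAt ℝ G x) (Z : C4 × C4) :
    along Z (fun y => F y + G y) x = along Z F x + along Z G x := by
  simp only [along, fderiv_fun_add hF hG, add_apply, smul_add]
  module

lemma along_neg (F : C4 → W) (x : C4) (Z : C4 × C4) :
    along Z (fun y => -F y) x = -along Z F x := by
  simp only [along, fderiv_fun_neg, neg_apply, smul_neg]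
  module

lemma along_sub {F G : C4 → W} {x : C4} (hF : DifferentiableAt ℝ F x)
    (hG : DifferentiableAt ℝ G x) (Z : C4 × C4) :
    along Z (fun y => F y - G y) x = along Z F x - along Z G x := by
  simpa only [sub_eq_add_neg, along_neg] using along_add hF hG.fun_neg Z

lemma along_sum {ι : Type*} (s : Finset ι) {F : ι → C4 → W} {x : C4}
    (hF : ∀ i ∈ s, DifferentiableAt ℝ (F i) x) (Z : C4 × C4) :
    along Z (fun y => ∑ i ∈ s, F i y) x = ∑ i ∈ s, along Z (F i) x := by
  simp only [along, fderiv_fun_sum hF, sum_apply, Finset.smul_sum, ← Finset.sum_sub_distrib,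
    ← Finset.sum_add_distrib]

lemma along_smul {φ : C4 → ℂ} {F : C4 → W} {x : C4} (hφ : DifferentiableAt ℝ φ x)
    (hF : DifferentiableAt ℝ F x) (Z : C4 × C4) :
    along Z (fun y => φ y • F y) x = φ x • along Z F x + along Z φ x • F x := by
  simp only [along, fderiv_fun_smul hφ hF, add_apply, smul_apply,
    ContinuousLinearMap.smulRight_apply, smul_eq_mul]
  module

lemma along_mul {φ ψ : C4 → ℂ} {x : C4} (hφ : DifferentiableAt ℝ φ x)
    (hψ : DifferentiableAt ℝ ψ x) (Z : C4 × C4) :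
    along Z (fun y => φ y * ψ y) x = along Z φ x * ψ x + φ x * along Z ψ x := by
  simpa only [smul_eq_mul, mul_comm (along Z φ x), add_comm] using along_smul hφ hψ Z

lemma along_eq_of_hasFDerivAt {F : C4 → W} {F' : C4 →L[ℝ] W} {x : C4}
    (h : HasFDerivAt F F' x) (α β : C4 → W) (hF : ∀ v, F' v = α v + β v)
    (hα : ∀ v, α (Complex.I • v) = Complex.I • α v)
    (hβ : ∀ v, β (Complex.I • v) = -Complex.I • β v) (Z : C4 × C4) :
    along Z F x = α Z.1 + β Z.2 := by
  have I_smul_I_smul (w : W) : Complex.I • Complex.I • w = -w := by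
    rw [smul_smul, Complex.I_mul_I, neg_one_smul]
  simp only [along, h.fderiv, hF, hα, hβ, smul_add, neg_smul, smul_neg, I_smul_I_smul]
  module

lemma along_congr {F G : C4 → W} {x : C4} (h : F =ᶠ[𝓝 x] G) (Z : C4 × C4) :
    along Z F x = along Z G x := by
  simp only [along, h.fderiv_eq]

lemma contDiffAt_along {F : C4 → W} {a b : C4 → C4} {p : C4} (hF : ContDiffAt ℝ ∞ F p)
    (ha : ContDiffAt ℝ ∞ a p) (hb : ContDiffAt ℝ ∞ b p) :
    ContDiffAt ℝ ∞ (fun x => along (a x, b x) F x) p := by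
  have contDiffAt_fderiv {v : C4 → C4} (hv : ContDiffAt ℝ ∞ v p) :
      ContDiffAt ℝ ∞ (fun x => fderiv ℝ F x (v x)) p :=
    (hF.fderiv_right (by simp)).clm_apply hv
  exact (((contDiffAt_fderiv ha).sub
      ((contDiffAt_fderiv (ha.const_smul Complex.I)).const_smul Complex.I)).const_smul _).add
    (((contDiffAt_fderiv hb).add
      ((contDiffAt_fderiv (hb.const_smul Complex.I)).const_smul Complex.I)).const_smul _)

end Along

section Bracket

variable (A B : C4 → C4) (x : C4)

lemma bracket_hol_antihol_fst : (bracket (hol A) (antihol B) x).1 = -along (0, B x) A x := by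
  simp [bracket, hol, antihol, along_const]

lemma bracket_hol_antihol_snd : (bracket (hol A) (antihol B) x).2 = along (0, A x) B x := by
  simp [bracket, hol, antihol, along_const]

lemma bracket_hol_hol_fst :
    (bracket (hol A) (hol B) x).1 = along (A x, 0) B x - along (B x, 0) A x := by
  simp [bracket, hol]

lemma bracket_hol_hol_snd : (bracket (hol A) (hol B) x).2 = 0 := by
  simp [bracket, hol, along_const]

end Bracket

/-! ### Functions on a hypersurface -/

section Hypersurface

variable {E W : Type*} [NormedAddCommGroup E] [NormedSpace ℝ E] [NormedAddCommGroup W]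
  [NormedSpace ℝ W]

lemma fderiv_apply_eq_zero_of_eventually_eq_zero [CompleteSpace E] {ρ : E → ℝ} {F : E → W}
    {x v : E} (hρ : ContDiffAt ℝ 1 ρ x) (hρ' : fderiv ℝ ρ x ≠ 0) (hx : ρ x = 0)
    (hF : ContDiffAt ℝ 1 F x) (h : ∀ᶠ y in 𝓝 x, ρ y = 0 → F y = 0)
    (hv : fderiv ℝ ρ x v = 0) : fderiv ℝ F x v = 0 := by
  refine SeparatingDual.eq_zero_of_forall_dual_eq_zero (R := ℝ) fun l => ?_
  -- `l ∘ F` is constant on `{ρ = 0}`, so its derivative is a Lagrange multiple of that of `ρ`.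
  have extremum : IsLocalExtrOn (fun y => l (F y)) {y | ρ y = ρ x} x := by
    left
    filter_upwards [mem_nhdsWithin_of_mem_nhds h, self_mem_nhdsWithin] with y hy hyx
    rw [h.self_of_nhds hx, hy (hyx.trans hx)]
  obtain ⟨s, t, hst, multiplier⟩ := extremum.exists_multipliers_of_hasStrictFDerivAt_1d
    (hρ.hasStrictFDerivAt one_ne_zero)
    (l.hasStrictFDerivAt.comp x (hF.hasStrictFDerivAt one_ne_zero))
  have ht : t ≠ 0 := by
    rintro rfl
    rw [zero_smul, add_zero] at multiplier
    exact hst (Prod.ext ((smul_eq_zero.1 multiplier).resolve_right hρ') rfl)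
  have : t * l (fderiv ℝ F x v) = 0 := by simpa [hv] using DFunLike.congr_fun multiplier v
  exact (mul_eq_zero.1 this).resolve_left ht

lemma eventually_contDiffAt {F : E → W} {p : E} (hF : ContDiffAt ℝ ∞ F p) (n : ℕ) :
    ∀ᶠ x in 𝓝 p, ContDiffAt ℝ n F x :=
  (hF.of_le (by exact_mod_cast le_top)).eventually (by simp)

lemma eventually_differentiableAt {F : E → W} {p : E} (hF : ContDiffAt ℝ ∞ F p) :
    ∀ᶠ x in 𝓝 p, DifferentiableAt ℝ F x :=
  (eventually_contDiffAt hF 1).mono fun _ h => h.differentiableAt (by simp)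

/-- The germ at `p` of `{ρ = 0}` is a smooth hypersurface through `p` with defining function
`ρ`. -/
structure IsHypersurface (ρ : C4 → ℝ) (p : C4) : Prop where
  smooth : ContDiffAt ℝ ∞ ρ p
  zero : ρ p = 0
  fderiv_ne : fderiv ℝ ρ p ≠ 0

namespace IsHypersurface

variable {ρ : C4 → ℝ} {p : C4}

lemma eventually_contDiffAt_two_and_fderiv_ne (h : IsHypersurface ρ p) :
    ∀ᶠ x in 𝓝 p, ContDiffAt ℝ 2 ρ x ∧ fderiv ℝ ρ x ≠ 0 :=
  (eventually_contDiffAt h.smooth 2).and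
    ((h.smooth.fderiv_right (m := ∞) (by simp)).continuousAt.eventually_ne h.fderiv_ne)

lemma fderiv_eq_zero (h : IsHypersurface ρ p) {F : C4 → W} (hF : ContDiffAt ℝ ∞ F p)
    (h0 : ∀ᶠ x in 𝓝 p, ρ x = 0 → F x = 0) :
    ∀ᶠ x in 𝓝 p, ρ x = 0 → ∀ v, fderiv ℝ ρ x v = 0 → fderiv ℝ F x v = 0 := by
  filter_upwards [h.eventually_contDiffAt_two_and_fderiv_ne, eventually_contDiffAt hF 1,
    h0.eventually_nhds] with x hρ hFx hFnear hx v hv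
  exact fderiv_apply_eq_zero_of_eventually_eq_zero (hρ.1.of_le one_le_two) hρ.2 hx hFx hFnear hv

lemma fderiv_eq (h : IsHypersurface ρ p) {F G : C4 → W} (hF : ContDiffAt ℝ ∞ F p)
    (hG : ContDiffAt ℝ ∞ G p) (hFG : ∀ᶠ x in 𝓝 p, ρ x = 0 → F x = G x) :
    ∀ᶠ x in 𝓝 p, ρ x = 0 → ∀ v, fderiv ℝ ρ x v = 0 → fderiv ℝ F x v = fderiv ℝ G x v := by
  filter_upwards [h.fderiv_eq_zero (hF.sub hG) (hFG.mono fun x e hx => sub_eq_zero.2 (e hx)),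
    eventually_differentiableAt hF, eventually_differentiableAt hG] with x hsub dF dG hx v hv
  rw [← sub_eq_zero, ← sub_apply, ← fderiv_fun_sub dF dG]
  exact hsub hx v hv

lemma along_eq {V : Type*} [NormedAddCommGroup V] [NormedSpace ℂ V] (h : IsHypersurface ρ p)
    {F G : C4 → V} (hF : ContDiffAt ℝ ∞ F p) (hG : ContDiffAt ℝ ∞ G p)
    (hFG : ∀ᶠ x in 𝓝 p, ρ x = 0 → F x = G x) :
    ∀ᶠ x in 𝓝 p, ρ x = 0 → ∀ a ∈ holTangent ρ x, ∀ b ∈ holTangent ρ x,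
      along (a, b) F x = along (a, b) G x := by
  filter_upwards [h.fderiv_eq hF hG hFG] with x hx hρx a ha b hb
  simp only [along, hx hρx _ ha.1, hx hρx _ ha.2, hx hρx _ hb.1, hx hρx _ hb.2]

end IsHypersurface

end Hypersurface

/-! ### The Lie derivative along a holomorphic vector field -/

/-- The Lie derivative of the vector field `A` along the holomorphic vector field `X`. -/
def lieX (X A : C4 → C4) (x : C4) : C4 := fderiv ℝ A x (X x) - fderiv ℂ X x (A x)

section LieDerivative

variable {X A B : C4 → C4} {x : C4}

lemma lieX_of_eq_zero (hX : X x = 0) (A : C4 → C4) : lieX X A x = -fderiv ℂ X x (A x) := by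
  simp [lieX, hX]

lemma lieX_smul {φ : C4 → ℂ} (hφ : DifferentiableAt ℝ φ x) (hA : DifferentiableAt ℝ A x) :
    lieX X (fun y => φ y • A y) x = φ x • lieX X A x + (fderiv ℝ φ x (X x)) • A x := by
  have product_rule : fderiv ℝ (fun y => φ y • A y) x (X x) =
      φ x • fderiv ℝ A x (X x) + (fderiv ℝ φ x (X x)) • A x := by
    simpa only [along_real] using along_smul hφ hA (X x, X x)
  rw [lieX, product_rule, map_smul, lieX, smul_sub]
  abel

lemma lieX_add (hA : DifferentiableAt ℝ A x) (hB : DifferentiableAt ℝ B x) :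
    lieX X (fun y => A y + B y) x = lieX X A x + lieX X B x := by
  rw [lieX, fderiv_fun_add hA hB, add_apply, map_add, lieX, lieX]
  abel

lemma lieX_sub (hA : DifferentiableAt ℝ A x) (hB : DifferentiableAt ℝ B x) :
    lieX X (fun y => A y - B y) x = lieX X A x - lieX X B x := by
  rw [lieX, fderiv_fun_sub hA hB, sub_apply, map_sub, lieX, lieX]
  abel

lemma lieX_sum {ι : Type*} (s : Finset ι) {A : ι → C4 → C4}
    (hA : ∀ i ∈ s, DifferentiableAt ℝ (A i) x) :
    lieX X (fun y => ∑ i ∈ s, A i y) x = ∑ i ∈ s, lieX X (A i) x := by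
  rw [lieX, fderiv_fun_sum hA, sum_apply, map_sum, ← Finset.sum_sub_distrib]
  rfl

lemma lieX_const_smul (c : ℂ) (hA : DifferentiableAt ℝ A x) :
    lieX X (fun y => c • A y) x = c • lieX X A x := by
  simpa using lieX_smul (X := X) (differentiableAt_const c) hA

end LieDerivative

section SecondOrder

variable {E W : Type*} [NormedAddCommGroup E] [NormedSpace ℝ E] [NormedAddCommGroup W]
  [NormedSpace ℝ W] {A : E → W} {w : E → E} {x : E}

lemma hasFDerivAt_fderiv_apply (hA : ContDiffAt ℝ 2 A x) (hw : DifferentiableAt ℝ w x) :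
    HasFDerivAt (fun y => fderiv ℝ A y (w y))
      (fderiv ℝ A x ∘L fderiv ℝ w x + (fderiv ℝ (fderiv ℝ A) x).flip (w x)) x :=
  ((hA.fderiv_right (m := 1) (by norm_num)).differentiableAt
    (by simp)).hasFDerivAt.clm_apply hw.hasFDerivAt

lemma fderiv_fderiv_apply (hA : ContDiffAt ℝ 2 A x) (hw : DifferentiableAt ℝ w x) (v : E) :
    fderiv ℝ (fun y => fderiv ℝ A y (w y)) x v =
      fderiv ℝ (fderiv ℝ A) x v (w x) + fderiv ℝ A x (fderiv ℝ w x v) := by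
  rw [(hasFDerivAt_fderiv_apply hA hw).fderiv]
  simp [add_comm]

lemma fderiv_fderiv_comm (hA : ContDiffAt ℝ 2 A x) (v w : E) :
    fderiv ℝ (fderiv ℝ A) x v w = fderiv ℝ (fderiv ℝ A) x w v :=
  (hA.isSymmSndFDerivAt (by simp)).eq v w

end SecondOrder

section ComplexDirections

variable {W : Type*} [NormedAddCommGroup W] [NormedSpace ℂ W]

/-- The value at the complex vector `Z` of the complex-linear extension of a real-linear map `L`;
thus `along Z F x` is `complexExt (fderiv ℝ F x) Z`. -/
def complexExt (L : C4 →L[ℝ] W) (Z : C4 × C4) : W :=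
  (1 / 2 : ℂ) • (L Z.1 - Complex.I • L (Complex.I • Z.1)) +
  (1 / 2 : ℂ) • (L Z.2 + Complex.I • L (Complex.I • Z.2))

lemma hasFDerivAt_along {Z : C4 → C4 × C4} {A : C4 → W} {x : C4} (hA : ContDiffAt ℝ 2 A x)
    (hZ : DifferentiableAt ℝ Z x) :
    ∃ L : C4 →L[ℝ] W, HasFDerivAt (fun y => along (Z y) A y) L x ∧ ∀ v,
      L v = complexExt (fderiv ℝ (fderiv ℝ A) x v) (Z x) + along (fderiv ℝ Z x v) A x := by
  have d1 := hasFDerivAt_fderiv_apply hA hZ.fst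
  have d2 := hasFDerivAt_fderiv_apply hA hZ.snd
  have dI1 := hasFDerivAt_fderiv_apply hA (hZ.fst.const_smul Complex.I)
  have dI2 := hasFDerivAt_fderiv_apply hA (hZ.snd.const_smul Complex.I)
  refine ⟨_, ((d1.sub (dI1.const_smul Complex.I)).const_smul (1 / 2 : ℂ)).add
    ((d2.add (dI2.const_smul Complex.I)).const_smul (1 / 2 : ℂ)), fun v => ?_⟩
  simp only [add_apply, smul_apply, sub_apply, ContinuousLinearMap.comp_apply,
    ContinuousLinearMap.flip_apply, fderiv_const_smul hZ.fst, fderiv_const_smul hZ.snd,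
    fderiv.fst hZ, fderiv.snd hZ, along, complexExt, ContinuousLinearMap.coe_fst',
    ContinuousLinearMap.coe_snd', Pi.smul_apply]
  module

end ComplexDirections

section Holomorphic

variable {X A B : C4 → C4} {x : C4}

lemma hasFDerivAt_hol_fderiv_apply (hX : AnalyticAt ℂ X x) (hA : DifferentiableAt ℝ A x) :
    HasFDerivAt (fun y => fderiv ℂ X y (A y))
      (((fderiv ℂ X x).restrictScalars ℝ).comp (fderiv ℝ A x) +
        (((fderiv ℂ (fderiv ℂ X) x).flip (A x)).restrictScalars ℝ)) x := by
  have real_fderiv : HasFDerivAt (fun y => (fderiv ℂ X y).restrictScalars ℝ)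
      ((ContinuousLinearMap.restrictScalarsL ℂ C4 C4 ℝ ℝ).comp
        ((fderiv ℂ (fderiv ℂ X) x).restrictScalars ℝ)) x :=
    (ContinuousLinearMap.restrictScalarsL ℂ C4 C4 ℝ ℝ).hasFDerivAt.comp x
      (hX.fderiv.differentiableAt.hasFDerivAt.restrictScalars ℝ)
  exact real_fderiv.clm_apply hA.hasFDerivAt

lemma fderiv_real_eq (hX : AnalyticAt ℂ X x) (v : C4) : fderiv ℝ X x v = fderiv ℂ X x v := by
  rw [hX.differentiableAt.fderiv_restrictScalars ℝ, ContinuousLinearMap.coe_restrictScalars']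

lemma fderiv_lieX (hX : AnalyticAt ℂ X x) (hA : ContDiffAt ℝ 2 A x) (v : C4) :
    fderiv ℝ (lieX X A) x v =
      fderiv ℝ (fderiv ℝ A) x v (X x) + fderiv ℝ A x (fderiv ℂ X x v)
        - (fderiv ℂ (fderiv ℂ X) x v (A x) + fderiv ℂ X x (fderiv ℝ A x v)) := by
  have dX : DifferentiableAt ℝ X x := hX.differentiableAt.restrictScalars ℝ
  have dA : DifferentiableAt ℝ A x := hA.differentiableAt (by simp)
  have dlieX : fderiv ℝ (lieX X A) x = _ :=
    ((hasFDerivAt_fderiv_apply hA dX).sub (hasFDerivAt_hol_fderiv_apply hX dA)).fderiv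
  rw [dlieX]
  simp [fderiv_real_eq hX, add_comm]

lemma along_lieX (hX : AnalyticAt ℂ X x) (hA : ContDiffAt ℝ 2 A x) (Z : C4 × C4) :
    along Z (lieX X A) x =
      complexExt (fderiv ℝ (fderiv ℝ A) x (X x)) Z + along (Z.map (fderiv ℂ X x) (fderiv ℂ X x)) A x
        - fderiv ℂ (fderiv ℂ X) x Z.1 (A x) - fderiv ℂ X x (along Z A x) := by
  have I_smul_I_smul (w : C4) : Complex.I • Complex.I • w = -w := by
    rw [smul_smul, Complex.I_mul_I, neg_one_smul]
  simp only [along, complexExt, fderiv_lieX hX hA, fderiv_fderiv_comm hA (X x), map_smul, map_add,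
    map_sub, smul_apply, smul_add, smul_sub, I_smul_I_smul, Prod.map_fst, Prod.map_snd]
  module

lemma lieX_along (hX : AnalyticAt ℂ X x) (hA : ContDiffAt ℝ 2 A x) {Z : C4 → C4 × C4}
    (hZ : DifferentiableAt ℝ Z x) :
    lieX X (fun y => along (Z y) A y) x =
      along (Z x) (lieX X A) x
        + along (lieX X (fun y => (Z y).1) x, lieX X (fun y => (Z y).2) x) A x
        + fderiv ℂ (fderiv ℂ X) x (Z x).1 (A x) := by
  obtain ⟨L, hL, L_apply⟩ := hasFDerivAt_along hA hZ
  have derivative_of_direction : fderiv ℝ Z x (X x) =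
      (lieX X (fun y => (Z y).1) x, lieX X (fun y => (Z y).2) x)
        + (Z x).map (fderiv ℂ X x) (fderiv ℂ X x) := by
    ext1 <;> simp [lieX, fderiv.fst hZ, fderiv.snd hZ]
  rw [lieX, hL.fderiv, L_apply, along_lieX hX hA, derivative_of_direction, along_add_left]
  abel

lemma lieX_along_antihol (hX : AnalyticAt ℂ X x) (hA : ContDiffAt ℝ 2 A x)
    (hB : DifferentiableAt ℝ B x) :
    lieX X (fun y => along (0, B y) A y) x =
      along (0, B x) (lieX X A) x + along (0, lieX X B x) A x := by
  have lieX_zero : lieX X (fun _ => 0) x = 0 := by simp [lieX]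
  rw [lieX_along hX hA ((differentiableAt_const _).prodMk hB), lieX_zero, map_zero, zero_apply,
    add_zero]

lemma lieX_along_hol (hX : AnalyticAt ℂ X x) (hA : ContDiffAt ℝ 2 A x)
    (hB : DifferentiableAt ℝ B x) :
    lieX X (fun y => along (B y, 0) A y) x =
      along (B x, 0) (lieX X A) x + along (lieX X B x, 0) A x
        + fderiv ℂ (fderiv ℂ X) x (B x) (A x) := by
  have lieX_zero : lieX X (fun _ => 0) x = 0 := by simp [lieX]
  rw [lieX_along hX hA (hB.prodMk (differentiableAt_const _)), lieX_zero]

lemma lieX_bracket_hol (hX : AnalyticAt ℂ X x) (hA : ContDiffAt ℝ 2 A x)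
    (hB : ContDiffAt ℝ 2 B x) :
    lieX X (fun y => along (A y, 0) B y - along (B y, 0) A y) x =
      (along (lieX X A x, 0) B x - along (B x, 0) (lieX X A) x) +
      (along (A x, 0) (lieX X B) x - along (lieX X B x, 0) A x) := by
  have dA : DifferentiableAt ℝ A x := hA.differentiableAt (by simp)
  have dB : DifferentiableAt ℝ B x := hB.differentiableAt (by simp)
  obtain ⟨_, dAB, -⟩ := hasFDerivAt_along hB (dA.prodMk (differentiableAt_const (0 : C4)))
  obtain ⟨_, dBA, -⟩ := hasFDerivAt_along hA (dB.prodMk (differentiableAt_const (0 : C4)))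
  have second_derivative_symm :
      fderiv ℂ (fderiv ℂ X) x (A x) (B x) = fderiv ℂ (fderiv ℂ X) x (B x) (A x) :=
    ((hX.contDiffAt (n := ω)).isSymmSndFDerivAt (by simp)).eq _ _
  rw [lieX_sub dAB.differentiableAt dBA.differentiableAt, lieX_along_hol hX hB dA,
    lieX_along_hol hX hA dB, second_derivative_symm]
  abel

end Holomorphic

lemma contDiffAt_real {X : C4 → C4} {p : C4} (hX : AnalyticAt ℂ X p) : ContDiffAt ℝ ∞ X p :=
  (hX.contDiffAt (n := ∞)).restrict_scalars ℝ

lemma contDiffAt_lieX {X A : C4 → C4} {p : C4} (hX : AnalyticAt ℂ X p)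
    (hA : ContDiffAt ℝ ∞ A p) : ContDiffAt ℝ ∞ (lieX X A) p := by
  have smooth_left : ContDiffAt ℝ ∞ (fun x => fderiv ℝ A x (X x)) p :=
    (hA.fderiv_right (by simp)).clm_apply (contDiffAt_real hX)
  have smooth_right : ContDiffAt ℝ ∞ (fun x => fderiv ℝ X x (A x)) p :=
    ((contDiffAt_real hX).fderiv_right (by simp)).clm_apply hA
  refine (smooth_left.sub smooth_right).congr_of_eventuallyEq ?_
  filter_upwards [hX.eventually_analyticAt] with x hx
  rw [lieX, fderiv_real_eq hx]

/-! ### Infinitesimal symmetries -/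

namespace IsInfSymmetry

variable {ρ : C4 → ℝ} {p : C4} {X V V' : C4 → C4}

lemma lieX_tangent (h : IsHypersurface ρ p) (hX : IsInfSymmetry ρ p X) (hV : ContDiffAt ℝ ∞ V p)
    (hT : ∀ᶠ x in 𝓝 p, ρ x = 0 → fderiv ℝ ρ x (V x) = 0) :
    ∀ᶠ x in 𝓝 p, ρ x = 0 → fderiv ℝ ρ x (lieX X V x) = 0 := by
  have hρ' : ContDiffAt ℝ ∞ (fderiv ℝ ρ) p := h.smooth.fderiv_right (by simp)
  filter_upwards [h.fderiv_eq_zero (hρ'.clm_apply hV) hT,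
    h.fderiv_eq_zero (hρ'.clm_apply (contDiffAt_real hX.1)) hX.2, hX.2, hT,
    h.eventually_contDiffAt_two_and_fderiv_ne, hX.1.eventually_analyticAt,
    eventually_differentiableAt hV] with x derivV derivX tangentX tangentV hρ aX dV hx
  have along_X := derivV hx _ (tangentX hx)
  have along_V := derivX hx _ (tangentV hx)
  rw [fderiv_fderiv_apply hρ.1 dV] at along_X
  rw [fderiv_fderiv_apply hρ.1 (aX.differentiableAt.restrictScalars ℝ), fderiv_real_eq aX,
    fderiv_fderiv_comm hρ.1] at along_V
  rw [lieX, map_sub]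
  linarith

lemma lieX_section (h : IsHypersurface ρ p) (hX : IsInfSymmetry ρ p X) (hV : IsSection ρ p V) :
    IsSection ρ p (lieX X V) := by
  refine ⟨contDiffAt_lieX hX.1 hV.1, ?_⟩
  filter_upwards [hX.lieX_tangent h hV.1 (hV.2.mono fun x hx h0 => (hx h0).1),
    hX.lieX_tangent h (hV.1.const_smul Complex.I) (hV.2.mono fun x hx h0 => (hx h0).2),
    eventually_differentiableAt hV.1] with x tangent tangent_I dV hx
  refine ⟨tangent hx, ?_⟩
  rw [← lieX_const_smul Complex.I dV]
  exact tangent_I hx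

lemma lieX_congr (h : IsHypersurface ρ p) (hX : IsInfSymmetry ρ p X) (hV : ContDiffAt ℝ ∞ V p)
    (hV' : ContDiffAt ℝ ∞ V' p) (hVV' : ∀ᶠ x in 𝓝 p, ρ x = 0 → V x = V' x) :
    ∀ᶠ x in 𝓝 p, ρ x = 0 → lieX X V x = lieX X V' x := by
  filter_upwards [h.fderiv_eq hV hV' hVV', hX.2, hVV'] with x fderiv_eq tangent eq hx
  rw [lieX, lieX, fderiv_eq hx _ (tangent hx), eq hx]

end IsInfSymmetry

/-! ### The coframe dual to an adapted frame -/

namespace AdaptedFrame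

variable {ρ : C4 → ℝ} {p : C4}

/-- The linear map that sends the coordinates `(s, t, r)` to `s g + ∑ tₗ fₗ + r e`. -/
def frameMap (φ : AdaptedFrame ρ p) (x : C4) : C4 →L[ℂ] C4 :=
  (ContinuousLinearMap.fst ℂ ℂ ((Fin 2 → ℂ) × ℂ)).smulRight (φ.g x) +
  (∑ l, ((ContinuousLinearMap.proj (R := ℂ) (φ := fun _ : Fin 2 => ℂ) l).comp
    ((ContinuousLinearMap.fst ℂ (Fin 2 → ℂ) ℂ).comp
      (ContinuousLinearMap.snd ℂ ℂ ((Fin 2 → ℂ) × ℂ)))).smulRight (φ.f l x)) +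
  ((ContinuousLinearMap.snd ℂ (Fin 2 → ℂ) ℂ).comp
      (ContinuousLinearMap.snd ℂ ℂ ((Fin 2 → ℂ) × ℂ))).smulRight (φ.e x)

/-- The inverse of `frameMap`. -/
def coframe (φ : AdaptedFrame ρ p) (x : C4) : C4 →L[ℂ] C4 := Ring.inverse (φ.frameMap x)

lemma frameMap_apply (φ : AdaptedFrame ρ p) (x v : C4) :
    φ.frameMap x v = v.1 • φ.g x + ∑ l, v.2.1 l • φ.f l x + v.2.2 • φ.e x := by
  simp [frameMap]

lemma contDiffAt_frameMap (φ : AdaptedFrame ρ p) : ContDiffAt ℝ ∞ φ.frameMap p := by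
  have contDiffAt_smulRight (l : C4 →L[ℂ] ℂ) {V : C4 → C4} (hV : ContDiffAt ℝ ∞ V p) :
      ContDiffAt ℝ ∞ (fun x => l.smulRight (V x)) p :=
    ((ContinuousLinearMap.smulRightL ℂ C4 C4 l).restrictScalars ℝ).contDiff.contDiffAt.comp p hV
  exact ((contDiffAt_smulRight _ φ.smooth_g).add
    (ContDiffAt.sum fun l _ => contDiffAt_smulRight _ (φ.smooth_f l))).add
    (contDiffAt_smulRight _ φ.smooth_e)

lemma frameMap_injective (φ : AdaptedFrame ρ p) {x : C4} (hf : ∀ k, φ.f k x ∈ holTangent ρ x)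
    (he : φ.e x ∈ holTangent ρ x) (hg : φ.g x ∉ holTangent ρ x)
    (hli : LinearIndependent ℂ ![φ.f 0 x, φ.f 1 x, φ.e x]) :
    Function.Injective (φ.frameMap x) := by
  rw [injective_iff_map_eq_zero]
  intro v hv
  rw [frameMap_apply] at hv
  have g_coefficient : v.1 = 0 := by
    by_contra h1
    refine hg ((Submodule.smul_mem_iff _ h1).1 ?_)
    rw [eq_neg_of_add_eq_zero_left ((add_assoc _ _ _).symm.trans hv)]
    exact neg_mem (add_mem (Submodule.sum_mem _ fun l _ => Submodule.smul_mem _ _ (hf l))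
      (Submodule.smul_mem _ _ he))
  rw [g_coefficient, zero_smul, zero_add, Fin.sum_univ_two] at hv
  have coefficients := Fintype.linearIndependent_iff.1 hli ![v.2.1 0, v.2.1 1, v.2.2]
    (by simpa [Fin.sum_univ_three] using hv)
  refine Prod.ext g_coefficient (Prod.ext (funext fun i => ?_) (coefficients 2))
  fin_cases i
  exacts [coefficients 0, coefficients 1]

lemma isUnit_frameMap (φ : AdaptedFrame ρ p) (h : IsHypersurface ρ p) :
    IsUnit (φ.frameMap p) := by
  obtain ⟨hg, hli⟩ := φ.isFrame.self_of_nhds h.zero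
  have injective : Function.Injective (φ.frameMap p) :=
    φ.frameMap_injective (fun k => (φ.tangent_f k).self_of_nhds h.zero)
      (φ.tangent_e.self_of_nhds h.zero) hg hli
  exact ContinuousLinearMap.isUnit_iff_bijective.2
    ⟨injective, LinearMap.surjective_of_injective (f := (φ.frameMap p).toLinearMap) injective⟩

lemma contDiffAt_coframe (φ : AdaptedFrame ρ p) (h : IsHypersurface ρ p) :
    ContDiffAt ℝ ∞ φ.coframe p := by
  obtain ⟨u, hu⟩ := φ.isUnit_frameMap h
  have smooth_inverse : ContDiffAt ℂ ∞ Ring.inverse (φ.frameMap p) :=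
    hu ▸ contDiffAt_ringInverse ℂ u
  exact (smooth_inverse.restrict_scalars ℝ).comp p φ.contDiffAt_frameMap

lemma eventually_isUnit_frameMap (φ : AdaptedFrame ρ p) (h : IsHypersurface ρ p) :
    ∀ᶠ x in 𝓝 p, IsUnit (φ.frameMap x) :=
  φ.contDiffAt_frameMap.continuousAt.eventually (Units.isOpen.mem_nhds (φ.isUnit_frameMap h))

section Coframe

variable {φ : AdaptedFrame ρ p} {x : C4}

lemma frameMap_coframe (hx : IsUnit (φ.frameMap x)) (v : C4) :
    φ.frameMap x (φ.coframe x v) = v :=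
  DFunLike.congr_fun (Ring.mul_inverse_cancel _ hx) v

lemma coframe_frameMap (hx : IsUnit (φ.frameMap x)) (v : C4) :
    φ.coframe x (φ.frameMap x v) = v :=
  DFunLike.congr_fun (Ring.inverse_mul_cancel _ hx) v

lemma coframe_expand (hx : IsUnit (φ.frameMap x)) (v : C4) :
    v = (φ.coframe x v).1 • φ.g x + ∑ l, (φ.coframe x v).2.1 l • φ.f l x
      + (φ.coframe x v).2.2 • φ.e x := by
  rw [← frameMap_apply, frameMap_coframe hx]

lemma coframe_g (hx : IsUnit (φ.frameMap x)) :
    φ.coframe x (φ.g x) = (1, 0, 0) := by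
  rw [← coframe_frameMap hx (1, 0, 0), frameMap_apply]; simp

lemma coframe_f (hx : IsUnit (φ.frameMap x)) (k : Fin 2) :
    φ.coframe x (φ.f k x) = (0, Pi.single k 1, 0) := by
  rw [← coframe_frameMap hx (0, Pi.single k 1, 0), frameMap_apply]
  simp [Pi.single_apply]

lemma coframe_e (hx : IsUnit (φ.frameMap x)) :
    φ.coframe x (φ.e x) = (0, 0, 1) := by
  rw [← coframe_frameMap hx (0, 0, 1), frameMap_apply]; simp

end Coframe

/-- The relations satisfied by an adapted frame at a point `x` of the hypersurface, with the
brackets replaced by their expressions in terms of `along`, and `frameMap` invertible. -/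
structure AdaptedAt (φ : AdaptedFrame ρ p) (x : C4) : Prop where
  unit : IsUnit (φ.frameMap x)
  tangent_f : ∀ k, φ.f k x ∈ holTangent ρ x
  tangent_e : φ.e x ∈ holTangent ρ x
  transversal : φ.g x ∉ holTangent ρ x
  tangent_g : fderiv ℝ ρ x (φ.g x) = 0
  levi_ff : ∀ a b, along (0, φ.f b x) (φ.f a) x + (2 * Complex.I * φ.levi x a b) • φ.g x
    ∈ holTangent ρ x
  levi_ef : ∀ b, along (0, φ.f b x) φ.e x ∈ holTangent ρ x
  levi_fe : ∀ b, along (0, φ.e x) (φ.f b) x ∈ holTangent ρ x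
  levi_ee : along (0, φ.e x) φ.e x ∈ holTangent ρ x
  levi_nondeg : IsUnit (φ.levi x).det
  xi_spec : ∀ k, along (0, φ.f k x) φ.e x + ∑ l, φ.xi x l k • φ.f l x ∈ Submodule.span ℂ {φ.e x}
  om_spec : ∀ k, along (φ.e x, 0) (φ.f k) x - along (φ.f k x, 0) φ.e x
    - ∑ l, φ.om x l k • φ.f l x ∈ Submodule.span ℂ {φ.e x}

lemma eventually_adaptedAt (φ : AdaptedFrame ρ p) (h : IsHypersurface ρ p) :
    ∀ᶠ x in 𝓝 p, ρ x = 0 → φ.AdaptedAt x := by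
  filter_upwards [φ.eventually_isUnit_frameMap h, Filter.eventually_all.2 φ.tangent_f, φ.tangent_e,
    φ.isFrame, φ.tangent_g, φ.levi_ff, φ.levi_ef, φ.levi_ee, φ.levi_nondeg, φ.xi_spec, φ.om_spec]
    with x unit tangent_f tangent_e frame tangent_g levi_ff levi_ef levi_ee nondeg xi om hx
  simp only [InHH, bracket_hol_antihol_fst, bracket_hol_antihol_snd, bracket_hol_hol_fst]
    at levi_ff levi_ef levi_ee xi om
  exact
    { unit := unit
      tangent_f := fun k => tangent_f k hx
      tangent_e := tangent_e hx
      transversal := (frame hx).1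
      tangent_g := tangent_g hx
      levi_ff := fun a b => by simpa [add_comm] using neg_mem (levi_ff hx a b).1
      levi_ef := fun b => by simpa using neg_mem (levi_ef hx b).1
      levi_fe := fun b => (levi_ef hx b).2
      levi_ee := (levi_ee hx).2
      levi_nondeg := nondeg hx
      xi_spec := fun k => by simpa [add_comm] using neg_mem (xi hx k).1
      om_spec := fun k => (om hx k).1 }

lemma isSection_f (φ : AdaptedFrame ρ p) (k : Fin 2) : IsSection ρ p (φ.f k) :=
  ⟨φ.smooth_f k, φ.tangent_f k⟩

lemma isSection_e (φ : AdaptedFrame ρ p) : IsSection ρ p φ.e := ⟨φ.smooth_e, φ.tangent_e⟩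

lemma along_antihol_combination (φ : AdaptedFrame ρ p) (x : C4) (t : Fin 2 → ℂ) (r : ℂ)
    (F : C4 → C4) :
    along (0, ∑ l, t l • φ.f l x + r • φ.e x) F x =
      ∑ l, (starRingEnd ℂ) (t l) • along (0, φ.f l x) F x
        + (starRingEnd ℂ) r • along (0, φ.e x) F x := by
  simp only [Fin.sum_univ_two, along_antihol_add, along_antihol_smul]

lemma along_hol_combination (φ : AdaptedFrame ρ p) (x : C4) (t : Fin 2 → ℂ) (r : ℂ)
    (F : C4 → C4) :
    along (∑ l, t l • φ.f l x + r • φ.e x, 0) F x =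
      ∑ l, t l • along (φ.f l x, 0) F x + r • along (φ.e x, 0) F x := by
  simp only [Fin.sum_univ_two, along_hol_add, along_hol_smul]

namespace AdaptedAt

variable {φ : AdaptedFrame ρ p} {x : C4}

lemma combination_mem (hx : φ.AdaptedAt x) (t : Fin 2 → ℂ) (r : ℂ) :
    ∑ l, t l • φ.f l x + r • φ.e x ∈ holTangent ρ x :=
  add_mem (Submodule.sum_mem _ fun l _ => Submodule.smul_mem _ _ (hx.tangent_f l))
    (Submodule.smul_mem _ _ hx.tangent_e)

lemma mem_holTangent_iff (hx : φ.AdaptedAt x) (v : C4) :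
    v ∈ holTangent ρ x ↔ (φ.coframe x v).1 = 0 := by
  have expansion := coframe_expand hx.unit v
  rw [add_assoc] at expansion
  constructor
  · intro hv
    by_contra h1
    refine hx.transversal ((Submodule.smul_mem_iff _ h1).1 ?_)
    rw [eq_sub_of_add_eq expansion.symm]
    exact sub_mem hv (hx.combination_mem _ _)
  · intro h1
    rw [expansion, h1, zero_smul, zero_add]
    exact hx.combination_mem _ _

lemma expand (hx : φ.AdaptedAt x) {v : C4}
    (hv : v ∈ holTangent ρ x) :
    v = ∑ l, (φ.coframe x v).2.1 l • φ.f l x + (φ.coframe x v).2.2 • φ.e x := by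
  have e := coframe_expand hx.unit v
  rwa [(hx.mem_holTangent_iff v).1 hv, zero_smul, zero_add] at e

lemma mem_span_e_iff (hx : φ.AdaptedAt x) (v : C4) :
    v ∈ Submodule.span ℂ {φ.e x} ↔ (φ.coframe x v).1 = 0 ∧ (φ.coframe x v).2.1 = 0 := by
  rw [Submodule.mem_span_singleton]
  constructor
  · rintro ⟨r, rfl⟩
    simp [coframe_e hx.unit]
  · rintro ⟨h1, h2⟩
    refine ⟨(φ.coframe x v).2.2, ?_⟩
    conv_rhs => rw [coframe_expand hx.unit v, h1, h2]
    simp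

lemma coframe_levi (hx : φ.AdaptedAt x) (a b : Fin 2) :
    (φ.coframe x (along (0, φ.f b x) (φ.f a) x)).1 = -(2 * Complex.I * φ.levi x a b) := by
  have := (hx.mem_holTangent_iff _).1 (hx.levi_ff a b)
  rw [map_add, map_smul, coframe_g hx.unit] at this
  simp only [Prod.fst_add, Prod.smul_fst, smul_eq_mul, mul_one] at this
  exact eq_neg_of_add_eq_zero_left this

lemma coframe_xi (hx : φ.AdaptedAt x) (l k : Fin 2) :
    (φ.coframe x (along (0, φ.f k x) φ.e x)).2.1 l = - φ.xi x l k := by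
  have := congrFun ((hx.mem_span_e_iff _).1 (hx.xi_spec k)).2 l
  simp only [map_add, map_sum, map_smul, coframe_f hx.unit, Prod.snd_add, Prod.fst_add,
    Pi.add_apply, Prod.snd_sum, Prod.fst_sum, Finset.sum_apply, Prod.smul_snd, Prod.smul_fst,
    Pi.smul_apply, Pi.single_apply, smul_eq_mul, mul_ite, mul_one, mul_zero, Finset.sum_ite_eq,
    Finset.mem_univ, if_true, Pi.zero_apply] at this
  exact eq_neg_of_add_eq_zero_left this

lemma coframe_om (hx : φ.AdaptedAt x) (l k : Fin 2) :
    (φ.coframe x (along (φ.e x, 0) (φ.f k) x - along (φ.f k x, 0) φ.e x)).2.1 l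
      = φ.om x l k := by
  have := congrFun ((hx.mem_span_e_iff _).1 (hx.om_spec k)).2 l
  rw [map_sub (φ.coframe x)] at this
  simp only [map_sum, map_smul, coframe_f hx.unit, Prod.snd_sub, Prod.fst_sub,
    Pi.sub_apply, Prod.snd_sum, Prod.fst_sum, Finset.sum_apply, Prod.smul_snd, Prod.smul_fst,
    Pi.smul_apply, Pi.single_apply, smul_eq_mul, mul_ite, mul_one, mul_zero, Finset.sum_ite_eq,
    Finset.mem_univ, if_true, Pi.zero_apply] at this
  exact sub_eq_zero.1 this

lemma along_antihol_e_mem (hx : φ.AdaptedAt x) {b : C4}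
    (hb : b ∈ holTangent ρ x) : along (0, b) φ.e x ∈ holTangent ρ x := by
  rw [hx.expand hb, along_antihol_combination]
  exact add_mem (Submodule.sum_mem _ fun l _ => Submodule.smul_mem _ _ (hx.levi_ef l))
    (Submodule.smul_mem _ _ hx.levi_ee)

lemma eq_zero_of_levi (hx : φ.AdaptedAt x) {t : Fin 2 → ℂ}
    (ht : ∀ b, ∑ l, t l * (2 * Complex.I * φ.levi x l b) = 0) : t = 0 := by
  refine Matrix.eq_zero_of_vecMul_eq_zero hx.levi_nondeg.ne_zero (funext fun b => ?_)
  have scaled : 2 * Complex.I * (t ᵥ* φ.levi x) b = 0 := by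
    rw [← ht b, Matrix.vecMul, dotProduct, Finset.mul_sum]
    exact Finset.sum_congr rfl fun l _ => by ring
  exact (mul_eq_zero.1 scaled).resolve_left (by simp)

end AdaptedAt

/-! ### Coefficients of sections -/

lemma contDiffAt_coframe_apply (φ : AdaptedFrame ρ p) (h : IsHypersurface ρ p) {V : C4 → C4}
    (hV : ContDiffAt ℝ ∞ V p) : ContDiffAt ℝ ∞ (fun x => φ.coframe x (V x)) p := by
  have smooth_coframe : ContDiffAt ℝ ∞ (fun x => (φ.coframe x).restrictScalars ℝ) p :=
    (ContinuousLinearMap.restrictScalarsL ℂ C4 C4 ℝ ℝ).contDiff.contDiffAt.comp p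
      (φ.contDiffAt_coframe h)
  exact smooth_coframe.clm_apply hV

lemma contDiffAt_coframe_f (φ : AdaptedFrame ρ p) (h : IsHypersurface ρ p) {V : C4 → C4}
    (hV : ContDiffAt ℝ ∞ V p) (l : Fin 2) :
    ContDiffAt ℝ ∞ (fun x => (φ.coframe x (V x)).2.1 l) p :=
  contDiffAt_pi.1 ((φ.contDiffAt_coframe_apply h hV).snd.fst) l

lemma contDiffAt_coframe_e (φ : AdaptedFrame ρ p) (h : IsHypersurface ρ p) {V : C4 → C4}
    (hV : ContDiffAt ℝ ∞ V p) :
    ContDiffAt ℝ ∞ (fun x => (φ.coframe x (V x)).2.2) p :=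
  (φ.contDiffAt_coframe_apply h hV).snd.snd

lemma contDiffAt_coframe_g (φ : AdaptedFrame ρ p) (h : IsHypersurface ρ p) {V : C4 → C4}
    (hV : ContDiffAt ℝ ∞ V p) :
    ContDiffAt ℝ ∞ (fun x => (φ.coframe x (V x)).1) p :=
  (φ.contDiffAt_coframe_apply h hV).fst

lemma along_combination_fun (φ : AdaptedFrame ρ p) {t : Fin 2 → C4 → ℂ} {r : C4 → ℂ} {x : C4}
    (ht : ∀ l, DifferentiableAt ℝ (t l) x) (hr : DifferentiableAt ℝ r x)
    (hf : ∀ l, DifferentiableAt ℝ (φ.f l) x) (he : DifferentiableAt ℝ φ.e x) (Z : C4 × C4) :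
    along Z (fun y => ∑ l, t l y • φ.f l y + r y • φ.e y) x =
      ∑ l, (t l x • along Z (φ.f l) x + along Z (t l) x • φ.f l x)
        + (r x • along Z φ.e x + along Z r x • φ.e x) := by
  have d : ∀ l, DifferentiableAt ℝ (fun y => t l y • φ.f l y) x := fun l => (ht l).smul (hf l)
  have d' : DifferentiableAt ℝ (fun y => r y • φ.e y) x := hr.smul he
  rw [along_add (DifferentiableAt.fun_sum fun l _ => d l) d', along_smul hr he,
    along_sum _ fun l _ => d l]
  simp only [fun l => along_smul (ht l) (hf l)]

lemma along_section (φ : AdaptedFrame ρ p) (h : IsHypersurface ρ p) {V : C4 → C4}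
    (hV : IsSection ρ p V) :
    ∀ᶠ x in 𝓝 p, ρ x = 0 → ∀ a ∈ holTangent ρ x, ∀ b ∈ holTangent ρ x,
      along (a, b) V x =
        ∑ l, ((φ.coframe x (V x)).2.1 l • along (a, b) (φ.f l) x
          + along (a, b) (fun y => (φ.coframe y (V y)).2.1 l) x • φ.f l x)
        + ((φ.coframe x (V x)).2.2 • along (a, b) φ.e x
          + along (a, b) (fun y => (φ.coframe y (V y)).2.2) x • φ.e x) := by
  have ct := φ.contDiffAt_coframe_f h hV.1
  have cr := φ.contDiffAt_coframe_e h hV.1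
  have expansion : ∀ᶠ x in 𝓝 p, ρ x = 0 →
      V x = ∑ l, (φ.coframe x (V x)).2.1 l • φ.f l x + (φ.coframe x (V x)).2.2 • φ.e x := by
    filter_upwards [φ.eventually_adaptedAt h, hV.2] with x adapted hVx hx
    exact (adapted hx).expand (hVx hx)
  filter_upwards [h.along_eq hV.1
      ((ContDiffAt.sum fun l _ => (ct l).smul (φ.smooth_f l)).add (cr.smul φ.smooth_e)) expansion,
    Filter.eventually_all.2 fun l => eventually_differentiableAt (ct l),
    eventually_differentiableAt cr,
    Filter.eventually_all.2 fun l => eventually_differentiableAt (φ.smooth_f l),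
    eventually_differentiableAt φ.smooth_e] with x along_eq dt dr df de hx a ha b hb
  rw [along_eq hx a ha b hb]
  exact φ.along_combination_fun dt dr df de _

lemma coframe_along_section (φ : AdaptedFrame ρ p) (h : IsHypersurface ρ p) {V : C4 → C4}
    (hV : IsSection ρ p V) :
    ∀ᶠ x in 𝓝 p, ρ x = 0 → ∀ b : Fin 2, (φ.coframe x (along (0, φ.f b x) V x)).1 =
      -∑ l, (φ.coframe x (V x)).2.1 l * (2 * Complex.I * φ.levi x l b) := by
  filter_upwards [φ.along_section h hV, φ.eventually_adaptedAt h] with x along_V adapted hρ b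
  have hx := adapted hρ
  rw [along_V hρ 0 (zero_mem _) _ (hx.tangent_f b)]
  simp only [map_add, map_sum, map_smul, Prod.fst_add, Prod.fst_sum, Prod.smul_fst,
    hx.coframe_levi, (hx.mem_holTangent_iff _).1 (hx.levi_ef b),
    (hx.mem_holTangent_iff _).1 (hx.tangent_f _), (hx.mem_holTangent_iff _).1 hx.tangent_e,
    smul_eq_mul, mul_zero, add_zero, mul_neg, Finset.sum_neg_distrib]

lemma leviKernel_eq (φ : AdaptedFrame ρ p) (h : IsHypersurface ρ p) :
    leviKernel ρ p = Submodule.span ℂ {φ.e p} := by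
  have hp := (φ.eventually_adaptedAt h).self_of_nhds h.zero
  apply le_antisymm
  · rintro _ ⟨A, hA, rfl, hA'⟩
    rw [hp.mem_span_e_iff]
    refine ⟨(hp.mem_holTangent_iff _).1 (hA.2.self_of_nhds h.zero), hp.eq_zero_of_levi fun b => ?_⟩
    have bracket_mem := (hA' _ (φ.isSection_f b)).1
    rwa [bracket_hol_antihol_fst, neg_mem_iff, hp.mem_holTangent_iff,
      (φ.coframe_along_section h hA).self_of_nhds h.zero b, neg_eq_zero] at bracket_mem
  · rw [Submodule.span_singleton_le_iff_mem]
    refine ⟨φ.e, φ.isSection_e, rfl, fun B hB => ⟨?_, ?_⟩⟩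
    · rw [bracket_hol_antihol_fst]
      exact neg_mem (hp.along_antihol_e_mem (hB.2.self_of_nhds h.zero))
    · rw [bracket_hol_antihol_snd, (φ.along_section h hB).self_of_nhds h.zero 0 (zero_mem _) _
        hp.tangent_e]
      exact add_mem (Submodule.sum_mem _ fun l _ => add_mem (Submodule.smul_mem _ _ (hp.levi_fe l))
        (Submodule.smul_mem _ _ (hp.tangent_f l))) (add_mem (Submodule.smul_mem _ _ hp.levi_ee)
        (Submodule.smul_mem _ _ hp.tangent_e))

end AdaptedFrame

/-! ### Involutivity of the Levi kernel -/

section SecondOrder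

variable {W : Type*} [NormedAddCommGroup W] [NormedSpace ℂ W] {F : C4 → W} {x : C4}

lemma along_antihol_along_antihol {A : C4 → C4} (hF : ContDiffAt ℝ 2 F x)
    (hA : DifferentiableAt ℝ A x) (b : C4) :
    along (0, b) (fun y => along (0, A y) F y) x =
      along (0, along (b, 0) A x) F x + (1 / 4 : ℂ) •
        ((fderiv ℝ (fderiv ℝ F) x b (A x)
          - fderiv ℝ (fderiv ℝ F) x (Complex.I • b) (Complex.I • A x)) +
        Complex.I • (fderiv ℝ (fderiv ℝ F) x (Complex.I • b) (A x)
          + fderiv ℝ (fderiv ℝ F) x b (Complex.I • A x))) := by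
  have hZ : DifferentiableAt ℝ (fun y => ((0 : C4), A y)) x :=
    (differentiableAt_const _).prodMk hA
  have fderiv_Z (v : C4) : fderiv ℝ (fun y => ((0 : C4), A y)) x v = (0, fderiv ℝ A x v) := by
    rw [((hasFDerivAt_const (0 : C4) x).prodMk hA.hasFDerivAt).fderiv]
    simp
  have along_A : along (b, 0) A x =
      (1 / 2 : ℂ) • fderiv ℝ A x b + (-(Complex.I / 2)) • fderiv ℝ A x (Complex.I • b) := by
    simp only [along, map_zero, smul_zero, add_zero]
    module
  obtain ⟨L, hL, L_apply⟩ := hasFDerivAt_along hF hZ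
  have along_L : along (0, b) (fun y => along (0, A y) F y) x =
      (1 / 2 : ℂ) • (L b + Complex.I • L (Complex.I • b)) := by
    simp only [along, ← hL.fderiv, map_zero, smul_zero, sub_zero, zero_add]
  rw [along_A, along_antihol_add, along_antihol_smul, along_antihol_smul, along_L, L_apply,
    L_apply]
  simp only [complexExt, fderiv_Z, map_zero, smul_zero, sub_zero, zero_add, smul_add,
    map_neg, map_div₀, Complex.conj_I, map_ofNat, map_one]
  match_scalars <;> ring_nf
  rw [Complex.I_sq]
  norm_num

lemma along_antihol_comm {A B : C4 → C4} (hF : ContDiffAt ℝ 2 F x)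
    (hA : DifferentiableAt ℝ A x) (hB : DifferentiableAt ℝ B x) :
    along (0, B x) (fun y => along (0, A y) F y) x
        - along (0, A x) (fun y => along (0, B y) F y) x =
      along (0, along (B x, 0) A x - along (A x, 0) B x) F x := by
  rw [along_antihol_along_antihol hF hA, along_antihol_along_antihol hF hB,
    fderiv_fderiv_comm hF (A x) (B x),
    fderiv_fderiv_comm hF (Complex.I • A x) (Complex.I • B x),
    fderiv_fderiv_comm hF (Complex.I • A x) (B x), fderiv_fderiv_comm hF (A x) (Complex.I • B x),
    sub_eq_add_neg (along (B x, 0) A x), along_antihol_add,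
    ← neg_one_smul ℂ (along (A x, 0) B x), along_antihol_smul]
  simp only [map_neg, map_one]
  module

end SecondOrder

namespace AdaptedFrame

variable {ρ : C4 → ℝ} {p : C4}

lemma along_antihol_e_section (φ : AdaptedFrame ρ p) (h : IsHypersurface ρ p) {V : C4 → C4}
    (hV : IsSection ρ p V) :
    ∀ᶠ x in 𝓝 p, ρ x = 0 → along (0, φ.e x) V x ∈ holTangent ρ x := by
  filter_upwards [φ.along_section h hV, φ.eventually_adaptedAt h] with x along_V adapted hρ
  have hx := adapted hρ
  rw [along_V hρ 0 (zero_mem _) _ hx.tangent_e]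
  exact add_mem (Submodule.sum_mem _ fun l _ => add_mem (Submodule.smul_mem _ _ (hx.levi_fe l))
    (Submodule.smul_mem _ _ (hx.tangent_f l))) (add_mem (Submodule.smul_mem _ _ hx.levi_ee)
    (Submodule.smul_mem _ _ hx.tangent_e))

lemma isSection_along_f_e (φ : AdaptedFrame ρ p) (h : IsHypersurface ρ p) (b : Fin 2) :
    IsSection ρ p (fun y => along (0, φ.f b y) φ.e y) :=
  ⟨contDiffAt_along φ.smooth_e contDiffAt_const (φ.smooth_f b),
    (φ.eventually_adaptedAt h).mono fun _ hx hρ => (hx hρ).levi_ef b⟩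

lemma isSection_along_e_e (φ : AdaptedFrame ρ p) (h : IsHypersurface ρ p) :
    IsSection ρ p (fun y => along (0, φ.e y) φ.e y) :=
  ⟨contDiffAt_along φ.smooth_e contDiffAt_const φ.smooth_e,
    (φ.eventually_adaptedAt h).mono fun _ hx hρ => (hx hρ).levi_ee⟩

lemma AdaptedAt.bracket_f_e_mem {φ : AdaptedFrame ρ p} {x : C4} (hx : φ.AdaptedAt x)
    (b : Fin 2) :
    along (φ.f b x, 0) φ.e x - along (φ.e x, 0) (φ.f b) x ∈ holTangent ρ x := by
  have bracket_mem := add_mem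
    ((Submodule.span_singleton_le_iff_mem _ _).2 hx.tangent_e (hx.om_spec b))
    (Submodule.sum_mem _ fun l (_ : l ∈ Finset.univ) =>
      Submodule.smul_mem _ (φ.om x l b) (hx.tangent_f l))
  rw [sub_add_cancel] at bracket_mem
  rw [← neg_sub]
  exact neg_mem bracket_mem

lemma coframe_along_e_e (φ : AdaptedFrame ρ p) (h : IsHypersurface ρ p) :
    ∀ᶠ x in 𝓝 p, ρ x = 0 → (φ.coframe x (along (0, φ.e x) φ.e x)).2.1 = 0 := by
  filter_upwards [φ.coframe_along_section h (φ.isSection_along_e_e h), φ.eventually_adaptedAt h,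
    Filter.eventually_all.2 fun b => φ.along_antihol_e_section h (φ.isSection_along_f_e h b),
    eventually_contDiffAt φ.smooth_e 2,
    Filter.eventually_all.2 fun b => eventually_differentiableAt (φ.smooth_f b)]
    with x levi_ee adapted along_e_mem smooth_e df hρ
  have hx := adapted hρ
  refine hx.eq_zero_of_levi fun b => ?_
  have along_f_mem :
      along (0, φ.f b x) (fun y => along (0, φ.e y) φ.e y) x ∈ holTangent ρ x := by
    rw [eq_add_of_sub_eq (along_antihol_comm smooth_e (smooth_e.differentiableAt (by simp)) (df b))]
    exact add_mem (hx.along_antihol_e_mem (hx.bracket_f_e_mem b)) (along_e_mem b hρ)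
  have levi_eq := levi_ee hρ b
  rw [(hx.mem_holTangent_iff _).1 along_f_mem] at levi_eq
  exact neg_eq_zero.1 levi_eq.symm

/-! ### The action of an infinitesimal symmetry on the frame -/

/-- The matrix `B` of the action `-[X, ·]` of an infinitesimal symmetry on `f₁, f₂` modulo `e`. -/
def symB (φ : AdaptedFrame ρ p) (X : C4 → C4) (x : C4) : M2 :=
  Matrix.of fun l k => -(φ.coframe x (lieX X (φ.f k) x)).2.1 l

/-- The coefficient `c` of the action `-[X, ·]` of an infinitesimal symmetry on `e`. -/
def symC (φ : AdaptedFrame ρ p) (X : C4 → C4) (x : C4) : ℂ :=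
  -(φ.coframe x (lieX X φ.e x)).2.2

/-- The coefficient `a` of the action `-[X, ·]` of an infinitesimal symmetry on `g` modulo `ℋ`. -/
def symA (φ : AdaptedFrame ρ p) (X : C4 → C4) (x : C4) : ℂ :=
  -(φ.coframe x (lieX X φ.g x)).1

variable {X : C4 → C4}

lemma contDiffAt_symB (φ : AdaptedFrame ρ p) (h : IsHypersurface ρ p)
    (hX : IsInfSymmetry ρ p X) (l k : Fin 2) :
    ContDiffAt ℝ ∞ (fun x => φ.symB X x l k) p :=
  (φ.contDiffAt_coframe_f h (contDiffAt_lieX hX.1 (φ.smooth_f k)) l).neg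

lemma contDiffAt_symC (φ : AdaptedFrame ρ p) (h : IsHypersurface ρ p)
    (hX : IsInfSymmetry ρ p X) : ContDiffAt ℝ ∞ (φ.symC X) p :=
  (φ.contDiffAt_coframe_e h (contDiffAt_lieX hX.1 φ.smooth_e)).neg

lemma contDiffAt_symA (φ : AdaptedFrame ρ p) (h : IsHypersurface ρ p)
    (hX : IsInfSymmetry ρ p X) : ContDiffAt ℝ ∞ (φ.symA X) p :=
  (φ.contDiffAt_coframe_g h (contDiffAt_lieX hX.1 φ.smooth_g)).neg

lemma lieX_f_eq (φ : AdaptedFrame ρ p) (h : IsHypersurface ρ p) (hX : IsInfSymmetry ρ p X)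
    (k : Fin 2) :
    ∀ᶠ x in 𝓝 p, ρ x = 0 → lieX X (φ.f k) x =
      ∑ l, (-φ.symB X x l k) • φ.f l x + (φ.coframe x (lieX X (φ.f k) x)).2.2 • φ.e x := by
  filter_upwards [φ.eventually_adaptedAt h, (hX.lieX_section h (φ.isSection_f k)).2]
    with x adapted lie_mem hρ
  simpa [symB] using (adapted hρ).expand (lie_mem hρ)

lemma lieX_e_eq (φ : AdaptedFrame ρ p) (h : IsHypersurface ρ p) (hX : IsInfSymmetry ρ p X) :
    ∀ᶠ x in 𝓝 p, ρ x = 0 → lieX X φ.e x = (-φ.symC X x) • φ.e x := by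
  have lie_section := hX.lieX_section h φ.isSection_e
  filter_upwards [φ.eventually_adaptedAt h, lie_section.2, φ.coframe_along_section h lie_section,
    Filter.eventually_all.2 fun b => (hX.lieX_section h (φ.isSection_along_f_e h b)).2,
    Filter.eventually_all.2 fun b => (hX.lieX_section h (φ.isSection_f b)).2,
    hX.1.eventually_analyticAt, eventually_contDiffAt φ.smooth_e 2,
    Filter.eventually_all.2 fun b => eventually_differentiableAt (φ.smooth_f b)]
    with x adapted lie_e_mem levi_lie_e lie_fe_mem lie_f_mem aX smooth_e df hρ
  have hx := adapted hρ
  have f_components_eq_zero : (φ.coframe x (lieX X φ.e x)).2.1 = 0 := by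
    refine hx.eq_zero_of_levi fun b => ?_
    have along_mem := lie_fe_mem b hρ
    rw [lieX_along_antihol aX smooth_e (df b),
      Submodule.add_mem_iff_left _ (hx.along_antihol_e_mem (lie_f_mem b hρ))] at along_mem
    have levi_eq := levi_lie_e hρ b
    rw [(hx.mem_holTangent_iff _).1 along_mem] at levi_eq
    exact neg_eq_zero.1 levi_eq.symm
  have expansion := hx.expand (lie_e_mem hρ)
  rw [f_components_eq_zero] at expansion
  simpa [symC] using expansion

lemma isSection_along_f_f_add (φ : AdaptedFrame ρ p) (h : IsHypersurface ρ p) (a b : Fin 2) :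
    IsSection ρ p
      (fun y => along (0, φ.f b y) (φ.f a) y + (2 * Complex.I * φ.levi y a b) • φ.g y) :=
  ⟨(contDiffAt_along (φ.smooth_f a) contDiffAt_const (φ.smooth_f b)).add
    ((contDiffAt_const.mul (φ.smooth_levi a b)).smul φ.smooth_g),
    (φ.eventually_adaptedAt h).mono fun _ hx hρ => (hx hρ).levi_ff a b⟩

lemma fderiv_levi (φ : AdaptedFrame ρ p) (h : IsHypersurface ρ p) (hX : IsInfSymmetry ρ p X) :
    ∀ᶠ x in 𝓝 p, ρ x = 0 → ∀ a b, fderiv ℝ (fun y => φ.levi y a b) x (X x) =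
      φ.symA X x * φ.levi x a b - ∑ l, φ.symB X x l a * φ.levi x l b
        - ∑ l, φ.levi x a l * (starRingEnd ℂ) (φ.symB X x l b) := by
  filter_upwards [φ.eventually_adaptedAt h,
    Filter.eventually_all.2 fun a => Filter.eventually_all.2 fun b =>
      (hX.lieX_section h (φ.isSection_along_f_f_add h a b)).2,
    Filter.eventually_all.2 fun a =>
      φ.coframe_along_section h (hX.lieX_section h (φ.isSection_f a)),
    Filter.eventually_all.2 fun b => φ.lieX_f_eq h hX b,
    hX.1.eventually_analyticAt,
    Filter.eventually_all.2 fun b => eventually_contDiffAt (φ.smooth_f b) 2,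
    Filter.eventually_all.2 fun a => Filter.eventually_all.2 fun b =>
      eventually_differentiableAt (φ.smooth_levi a b),
    eventually_differentiableAt φ.smooth_g,
    Filter.eventually_all.2 fun a => Filter.eventually_all.2 fun b =>
      eventually_differentiableAt
        (contDiffAt_along (φ.smooth_f a) contDiffAt_const (φ.smooth_f b) (a := fun _ => 0))]
    with x adapted lie_mem levi_lie_f lie_f aX smooth_f dlevi dg dff hρ a b
  have hx := adapted hρ
  have dlevi' : DifferentiableAt ℝ (fun y => 2 * Complex.I * φ.levi y a b) x :=
    (dlevi a b).const_mul _
  have fderiv_levi' : fderiv ℝ (fun y => 2 * Complex.I * φ.levi y a b) x (X x)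
      = 2 * Complex.I * fderiv ℝ (fun y => φ.levi y a b) x (X x) := by
    rw [fderiv_const_mul (dlevi a b), smul_apply, smul_eq_mul]
  have lie_g : (φ.coframe x (lieX X φ.g x)).1 = -φ.symA X x := by simp [symA]
  have lie_f_comp (l : Fin 2) : (φ.coframe x (lieX X (φ.f a) x)).2.1 l = -φ.symB X x l a := by
    simp [symB]
  have lie_eq := (hx.mem_holTangent_iff _).1 (lie_mem a b hρ)
  rw [lieX_add (dff a b) (dlevi'.fun_smul dg),
    lieX_along_antihol aX (smooth_f a) ((smooth_f b).differentiableAt (by simp)),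
    lieX_smul dlevi' dg, lie_f b hρ, along_antihol_combination, fderiv_levi'] at lie_eq
  simp only [map_add, map_smul, Prod.fst_add, Prod.smul_fst,
    levi_lie_f a hρ b, hx.coframe_levi, (hx.mem_holTangent_iff _).1 (hx.levi_fe a),
    coframe_g hx.unit, smul_eq_mul, mul_zero, add_zero, mul_one, lie_g, lie_f_comp, map_neg,
    Fin.sum_univ_two] at lie_eq ⊢
  apply mul_left_cancel₀ (show 2 * Complex.I ≠ 0 by simp)
  linear_combination lie_eq

lemma along_f_e_eq (φ : AdaptedFrame ρ p) (h : IsHypersurface ρ p) (k : Fin 2) :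
    ∀ᶠ x in 𝓝 p, ρ x = 0 → along (0, φ.f k x) φ.e x =
      ∑ l, (-φ.xi x l k) • φ.f l x +
        (φ.coframe x (along (0, φ.f k x) φ.e x)).2.2 • φ.e x := by
  filter_upwards [φ.eventually_adaptedAt h] with x adapted hρ
  simpa only [(adapted hρ).coframe_xi] using (adapted hρ).expand ((adapted hρ).levi_ef k)

lemma coframe_lieX_along_f_e_eq_sub (φ : AdaptedFrame ρ p) (h : IsHypersurface ρ p)
    (hX : IsInfSymmetry ρ p X) (k : Fin 2) :
    ∀ᶠ x in 𝓝 p, ρ x = 0 → ∀ m,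
      (φ.coframe x (lieX X (fun y => along (0, φ.f k y) φ.e y) x)).2.1 m =
        ∑ l, φ.symB X x m l * φ.xi x l k - fderiv ℝ (fun y => φ.xi y m k) x (X x) := by
  set μ : C4 → ℂ := fun y => (φ.coframe y (along (0, φ.f k y) φ.e y)).2.2
  have smooth_μ : ContDiffAt ℝ ∞ μ p := φ.contDiffAt_coframe_e h (φ.isSection_along_f_e h k).1
  filter_upwards [φ.eventually_adaptedAt h,
    hX.lieX_congr h (φ.isSection_along_f_e h k).1
      (V' := fun y => ∑ l, (-φ.xi y l k) • φ.f l y + μ y • φ.e y)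
      ((ContDiffAt.sum fun l _ => (φ.smooth_xi l k).neg.smul (φ.smooth_f l)).add
        (smooth_μ.smul φ.smooth_e)) (φ.along_f_e_eq h k),
    φ.lieX_e_eq h hX, eventually_differentiableAt φ.smooth_e,
    Filter.eventually_all.2 fun b => eventually_differentiableAt (φ.smooth_f b),
    Filter.eventually_all.2 fun a => eventually_differentiableAt (φ.smooth_xi a k),
    eventually_differentiableAt smooth_μ]
    with x adapted lie_expansion lie_e de df dxi dμ hρ m
  have hx := adapted hρ
  have dterm (l : Fin 2) : DifferentiableAt ℝ (fun y => (-φ.xi y l k) • φ.f l y) x :=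
    (dxi l).fun_neg.fun_smul (df l)
  have lie_term (l : Fin 2) : lieX X (fun y => (-φ.xi y l k) • φ.f l y) x =
      (-φ.xi x l k) • lieX X (φ.f l) x - fderiv ℝ (fun y => φ.xi y l k) x (X x) • φ.f l x := by
    rw [lieX_smul (dxi l).fun_neg (df l), fderiv_fun_neg, neg_apply, neg_smul _ (φ.f l x),
      sub_eq_add_neg]
  have lie_f_comp (l : Fin 2) : (φ.coframe x (lieX X (φ.f l) x)).2.1 m = -φ.symB X x m l := by
    simp [symB]
  rw [lie_expansion hρ, lieX_add (DifferentiableAt.fun_sum fun l _ => dterm l) (dμ.fun_smul de),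
    lieX_sum _ fun l _ => dterm l, lieX_smul dμ de, lie_e hρ]
  simp only [lie_term, map_add, map_sub, map_sum, map_smul, Prod.fst_add, Prod.snd_add,
    Prod.fst_sub, Prod.snd_sub, Prod.fst_sum, Prod.snd_sum, Prod.smul_fst, Prod.smul_snd,
    Pi.add_apply, Pi.sub_apply, Pi.smul_apply, Finset.sum_apply, coframe_e hx.unit, Pi.zero_apply,
    lie_f_comp, coframe_f hx.unit, Pi.single_apply, smul_eq_mul, mul_ite, mul_one, mul_zero,
    add_zero, neg_mul_neg, Finset.sum_sub_distrib, Finset.sum_ite_eq, Finset.mem_univ, if_true,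
    mul_comm (φ.xi x _ k)]

lemma coframe_lieX_along_f_e_eq_add (φ : AdaptedFrame ρ p) (h : IsHypersurface ρ p)
    (hX : IsInfSymmetry ρ p X) (k : Fin 2) :
    ∀ᶠ x in 𝓝 p, ρ x = 0 → ∀ m,
      (φ.coframe x (lieX X (fun y => along (0, φ.f k y) φ.e y) x)).2.1 m =
        φ.symC X x * φ.xi x m k + ∑ l, φ.xi x m l * (starRingEnd ℂ) (φ.symB X x l k) := by
  have smooth_neg_symC : ContDiffAt ℝ ∞ (fun y => -φ.symC X y) p := (φ.contDiffAt_symC h hX).neg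
  filter_upwards [φ.eventually_adaptedAt h,
    h.along_eq (G := fun y => (-φ.symC X y) • φ.e y) (contDiffAt_lieX hX.1 φ.smooth_e)
      (smooth_neg_symC.smul φ.smooth_e) (φ.lieX_e_eq h hX),
    φ.coframe_along_e_e h, φ.lieX_f_eq h hX k, hX.1.eventually_analyticAt,
    eventually_contDiffAt φ.smooth_e 2, eventually_differentiableAt (φ.smooth_f k),
    eventually_differentiableAt smooth_neg_symC]
    with x adapted along_lie_e coframe_ee lie_f aX smooth_e df dC hρ m
  have hx := adapted hρ
  rw [lieX_along_antihol aX smooth_e df, along_lie_e hρ 0 (zero_mem _) _ (hx.tangent_f k),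
    along_smul dC (smooth_e.differentiableAt (by simp)), lie_f hρ, along_antihol_combination]
  simp only [map_add, map_smul, Prod.fst_add, Prod.snd_add, Prod.smul_fst, Prod.smul_snd,
    Pi.add_apply, Pi.smul_apply, coframe_e hx.unit, hx.coframe_xi, coframe_ee hρ, Pi.zero_apply,
    smul_eq_mul, mul_zero, add_zero, map_neg, Fin.sum_univ_two]
  ring

lemma fderiv_xi (φ : AdaptedFrame ρ p) (h : IsHypersurface ρ p) (hX : IsInfSymmetry ρ p X) :
    ∀ᶠ x in 𝓝 p, ρ x = 0 → ∀ m k, fderiv ℝ (fun y => φ.xi y m k) x (X x) =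
      ∑ l, φ.symB X x m l * φ.xi x l k - φ.symC X x * φ.xi x m k
        - ∑ l, φ.xi x m l * (starRingEnd ℂ) (φ.symB X x l k) := by
  filter_upwards [Filter.eventually_all.2 fun k => φ.coframe_lieX_along_f_e_eq_sub h hX k,
    Filter.eventually_all.2 fun k => φ.coframe_lieX_along_f_e_eq_add h hX k]
    with x lie_expansion lie_invariance hρ m k
  linear_combination lie_expansion k hρ m - lie_invariance k hρ m

end AdaptedFrame

/-! ### Derivatives of matrix-valued functions -/

/-- The entrywise derivative of a matrix-valued function in a complex direction. -/
def alongM (Z : C4 × C4) (F : C4 → M2) (x : C4) : M2 :=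
  Matrix.of fun i j => along Z (fun y => F y i j) x

/-- The infinitesimal action `A · S = A S + S Aᵀ` of `𝔤𝔩₂` on bilinear forms. -/
def symAct (A S : M2) : M2 := A * S + S * Aᵀ

lemma alongM_congr {F G : C4 → M2} {x : C4} (h : F =ᶠ[𝓝 x] G) (Z : C4 × C4) :
    alongM Z F x = alongM Z G x := by
  ext i j
  exact along_congr (h.mono fun y hy => by rw [hy]) Z

section AlongM

variable {F G : C4 → M2} {x : C4}

lemma differentiableAt_mul_entries (hF : ∀ i j, DifferentiableAt ℝ (fun y => F y i j) x)
    (hG : ∀ i j, DifferentiableAt ℝ (fun y => G y i j) x) (i j : Fin 2) :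
    DifferentiableAt ℝ (fun y => (F y * G y) i j) x := by
  simp only [Matrix.mul_apply]
  exact DifferentiableAt.fun_sum fun k _ => (hF i k).fun_mul (hG k j)

lemma alongM_mul (hF : ∀ i j, DifferentiableAt ℝ (fun y => F y i j) x)
    (hG : ∀ i j, DifferentiableAt ℝ (fun y => G y i j) x) (Z : C4 × C4) :
    alongM Z (fun y => F y * G y) x = alongM Z F x * G x + F x * alongM Z G x := by
  ext i j
  simp only [alongM, Matrix.mul_apply, Matrix.of_apply, Matrix.add_apply]
  rw [along_sum _ fun k _ => (hF i k).fun_mul (hG k j), ← Finset.sum_add_distrib]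
  exact Finset.sum_congr rfl fun k _ => along_mul (hF i k) (hG k j) Z

lemma differentiableAt_symAct_entries (hF : ∀ i j, DifferentiableAt ℝ (fun y => F y i j) x)
    (hG : ∀ i j, DifferentiableAt ℝ (fun y => G y i j) x) (i j : Fin 2) :
    DifferentiableAt ℝ (fun y => symAct (F y) (G y) i j) x :=
  (differentiableAt_mul_entries hF hG i j).fun_add
    (differentiableAt_mul_entries hG (fun i j => hF j i) i j)

lemma alongM_symAct (hF : ∀ i j, DifferentiableAt ℝ (fun y => F y i j) x)
    (hG : ∀ i j, DifferentiableAt ℝ (fun y => G y i j) x) (Z : C4 × C4) :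
    alongM Z (fun y => symAct (F y) (G y)) x =
      symAct (alongM Z F x) (G x) + symAct (F x) (alongM Z G x) := by
  have alongM_transpose : alongM Z (fun y => (F y)ᵀ) x = (alongM Z F x)ᵀ := rfl
  have alongM_add :
      alongM Z (fun y => symAct (F y) (G y)) x =
        alongM Z (fun y => F y * G y) x + alongM Z (fun y => G y * (F y)ᵀ) x := by
    ext i j
    exact along_add (differentiableAt_mul_entries hF hG i j)
      (differentiableAt_mul_entries hG (fun i j => hF j i) i j) Z
  rw [alongM_add, alongM_mul hF hG, alongM_mul (G := fun y => (F y)ᵀ) hG fun i j => hF j i,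
    alongM_transpose, symAct, symAct]
  abel

lemma alongM_symAct_sub_smul {H : C4 → M2} {r : C4 → ℂ}
    (hF : ∀ i j, DifferentiableAt ℝ (fun y => F y i j) x)
    (hG : ∀ i j, DifferentiableAt ℝ (fun y => G y i j) x) (hr : DifferentiableAt ℝ r x)
    (hH : ∀ i j, DifferentiableAt ℝ (fun y => H y i j) x) (Z : C4 × C4) :
    alongM Z (fun y => symAct (F y) (G y) - r y • H y) x =
      symAct (alongM Z F x) (G x) + symAct (F x) (alongM Z G x)
        - (along Z r x • H x + r x • alongM Z H x) := by
  rw [← alongM_symAct hF hG]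
  ext i j
  exact (along_sub (differentiableAt_symAct_entries hF hG i j) (hr.fun_mul (hH i j)) Z).trans
    (congrArg _ (along_mul hr (hH i j) Z))

end AlongM

section Entries

variable {F G : C4 → M2} {x : C4} {n : WithTop ℕ∞}

lemma contDiffAt_mul_entries (hF : ∀ i j, ContDiffAt ℝ n (fun y => F y i j) x)
    (hG : ∀ i j, ContDiffAt ℝ n (fun y => G y i j) x) (i j : Fin 2) :
    ContDiffAt ℝ n (fun y => (F y * G y) i j) x := by
  simp only [Matrix.mul_apply]
  exact ContDiffAt.sum fun k _ => (hF i k).mul (hG k j)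

lemma contDiffAt_det_entries (hF : ∀ i j, ContDiffAt ℝ n (fun y => F y i j) x) :
    ContDiffAt ℝ n (fun y => (F y).det) x := by
  simp only [Matrix.det_fin_two]
  exact ((hF 0 0).mul (hF 1 1)).sub ((hF 0 1).mul (hF 1 0))

lemma contDiffAt_inv_entries (hF : ∀ i j, ContDiffAt ℝ n (fun y => F y i j) x)
    (h : (F x).det ≠ 0) (i j : Fin 2) : ContDiffAt ℝ n (fun y => (F y)⁻¹ i j) x := by
  have contDiffAt_det_inv := (contDiffAt_det_entries hF).inv h
  simp only [Matrix.inv_def, Ring.inverse_eq_inv', Matrix.adjugate_fin_two, Matrix.smul_apply,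
    smul_eq_mul]
  fin_cases i <;> fin_cases j
  · exact contDiffAt_det_inv.mul (hF 1 1)
  · exact contDiffAt_det_inv.mul (hF 0 1).neg
  · exact contDiffAt_det_inv.mul (hF 1 0).neg
  · exact contDiffAt_det_inv.mul (hF 0 0)

lemma contDiffAt_conj {f : C4 → ℂ} (hf : ContDiffAt ℝ n f x) :
    ContDiffAt ℝ n (fun y => (starRingEnd ℂ) (f y)) x :=
  Complex.conjCLE.contDiff.contDiffAt.comp x hf

end Entries

lemma along_fderiv_apply_of_eq_zero {X : C4 → C4} {p : C4} (hX : AnalyticAt ℂ X p)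
    (h0 : X p = 0) {F : C4 → ℂ} (hF : ContDiffAt ℝ 2 F p) (a b : C4) :
    along (a, b) (fun x => fderiv ℝ F x (X x)) p
      = along (fderiv ℂ X p a, fderiv ℂ X p b) F p := by
  have fderiv_eq (v : C4) :
      fderiv ℝ (fun x => fderiv ℝ F x (X x)) p v = fderiv ℝ F p (fderiv ℂ X p v) := by
    rw [fderiv_fderiv_apply hF (hX.differentiableAt.restrictScalars ℝ), h0, map_zero, zero_add,
      fderiv_real_eq hX]
  simp only [along, fderiv_eq, map_smul]

namespace AdaptedFrame

variable {ρ : C4 → ℝ} {p : C4} {X : C4 → C4}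

lemma contDiffAt_s02 (φ : AdaptedFrame ρ p) (h : IsHypersurface ρ p) (i j : Fin 2) :
    ContDiffAt ℝ ∞ (fun x => φ.s02 x i j) p :=
  contDiffAt_mul_entries φ.smooth_xi (contDiffAt_inv_entries φ.smooth_levi
    ((φ.eventually_adaptedAt h).self_of_nhds h.zero).levi_nondeg.ne_zero) i j

lemma eventually_s02_mul_levi (φ : AdaptedFrame ρ p) (h : IsHypersurface ρ p) :
    ∀ᶠ x in 𝓝 p, φ.s02 x * φ.levi x = φ.xi x := by
  have continuousAt_det : ContinuousAt (fun x => (φ.levi x).det) p :=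
    (contDiffAt_det_entries φ.smooth_levi).continuousAt
  filter_upwards [continuousAt_det.eventually_ne
    ((φ.eventually_adaptedAt h).self_of_nhds h.zero).levi_nondeg.ne_zero] with x det_ne_zero
  rw [s02, mul_assoc, Matrix.nonsing_inv_mul _ (isUnit_iff_ne_zero.2 det_ne_zero), mul_one]

lemma alongM_levi (φ : AdaptedFrame ρ p) (h : IsHypersurface ρ p) (hX : IsInfSymmetry ρ p X) :
    ∀ᶠ x in 𝓝 p, ρ x = 0 → alongM (X x, X x) φ.levi x =
      φ.symA X x • φ.levi x - (φ.symB X x)ᵀ * φ.levi x - φ.levi x * conjM (φ.symB X x) := by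
  filter_upwards [φ.fderiv_levi h hX] with x fderiv_levi hρ
  ext i j
  simp only [alongM, Matrix.of_apply, along_real, fderiv_levi hρ i j, Matrix.sub_apply,
    Matrix.smul_apply, Matrix.mul_apply, Matrix.transpose_apply, conjM, Matrix.map_apply,
    smul_eq_mul]

lemma alongM_xi (φ : AdaptedFrame ρ p) (h : IsHypersurface ρ p) (hX : IsInfSymmetry ρ p X) :
    ∀ᶠ x in 𝓝 p, ρ x = 0 → alongM (X x, X x) φ.xi x =
      φ.symB X x * φ.xi x - φ.symC X x • φ.xi x - φ.xi x * conjM (φ.symB X x) := by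
  filter_upwards [φ.fderiv_xi h hX] with x fderiv_xi hρ
  ext i j
  simp only [alongM, Matrix.of_apply, along_real, fderiv_xi hρ i j, Matrix.sub_apply,
    Matrix.smul_apply, Matrix.mul_apply, conjM, Matrix.map_apply, smul_eq_mul]

lemma alongM_s02 (φ : AdaptedFrame ρ p) (h : IsHypersurface ρ p) (hX : IsInfSymmetry ρ p X) :
    ∀ᶠ x in 𝓝 p, ρ x = 0 → alongM (X x, X x) φ.s02 x =
      symAct (φ.symB X x) (φ.s02 x) - (φ.symA X x + φ.symC X x) • φ.s02 x := by
  filter_upwards [φ.alongM_levi h hX, φ.alongM_xi h hX, φ.eventually_adaptedAt h,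
    (φ.eventually_s02_mul_levi h).eventually_nhds,
    Filter.eventually_all.2 fun i => Filter.eventually_all.2 fun j =>
      eventually_differentiableAt (φ.contDiffAt_s02 h i j),
    Filter.eventually_all.2 fun i => Filter.eventually_all.2 fun j =>
      eventually_differentiableAt (φ.smooth_levi i j)]
    with x alongM_levi alongM_xi adapted s02_mul_levi ds02 dlevi hρ
  have levi_unit := (adapted hρ).levi_nondeg
  have product_rule := alongM_congr s02_mul_levi (X x, X x)
  rw [alongM_mul ds02 dlevi, alongM_levi hρ, alongM_xi hρ, ← s02_mul_levi.self_of_nhds,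
    ← sub_eq_zero] at product_rule
  refine ((Matrix.isUnit_iff_isUnit_det _).2 levi_unit).mul_right_cancel ?_
  rw [symAct, ← sub_eq_zero, ← product_rule]
  simp only [mul_sub, sub_mul, add_mul, add_smul, Matrix.mul_smul, Matrix.smul_mul, mul_assoc]
  abel

/-! ### The constraints on the linear isotropy -/

section Isotropy

variable (φ : AdaptedFrame ρ p)

lemma symB_apply (h0 : X p = 0) (l k : Fin 2) :
    φ.symB X p l k = (φ.coframe p (fderiv ℂ X p (φ.f k p))).2.1 l := by
  simp [symB, lieX_of_eq_zero h0]

lemma isotropy_e (h : IsHypersurface ρ p) (hX : IsInfSymmetry ρ p X) (h0 : X p = 0) :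
    fderiv ℂ X p (φ.e p) = φ.symC X p • φ.e p := by
  have lie_e := (φ.lieX_e_eq h hX).self_of_nhds h.zero
  rw [lieX_of_eq_zero h0, neg_smul] at lie_e
  exact neg_injective lie_e

lemma isotropy_f (h : IsHypersurface ρ p) (hX : IsInfSymmetry ρ p X) (h0 : X p = 0)
    (k : Fin 2) : ∃ r : ℂ,
    fderiv ℂ X p (φ.f k p) = ∑ l, φ.symB X p l k • φ.f l p + r • φ.e p := by
  have lie_f := (φ.lieX_f_eq h hX k).self_of_nhds h.zero
  rw [lieX_of_eq_zero h0] at lie_f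
  refine ⟨-(φ.coframe p (-(fderiv ℂ X p) (φ.f k p))).2.2, ?_⟩
  apply neg_injective
  rw [neg_add, neg_smul, neg_neg, ← Finset.sum_neg_distrib]
  simpa only [neg_smul] using lie_f

lemma isotropy_g (h : IsHypersurface ρ p) (hX : IsInfSymmetry ρ p X) (h0 : X p = 0) :
    (φ.symA X p).im = 0 ∧
      fderiv ℂ X p (φ.g p) - φ.symA X p • φ.g p ∈ holTangent ρ p := by
  have hp := (φ.eventually_adaptedAt h).self_of_nhds h.zero
  have lie_tangent := (hX.lieX_tangent h φ.smooth_g φ.tangent_g).self_of_nhds h.zero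
  have sub_mem : fderiv ℂ X p (φ.g p) - φ.symA X p • φ.g p ∈ holTangent ρ p := by
    rw [hp.mem_holTangent_iff, map_sub, map_smul, coframe_g hp.unit]
    simp [symA, lieX_of_eq_zero h0]
  refine ⟨?_, sub_mem⟩
  have tangent_sub := sub_mem.1
  rw [lieX_of_eq_zero h0, map_neg, neg_eq_zero] at lie_tangent
  rw [map_sub, lie_tangent, zero_sub, neg_eq_zero, complex_smul_eq, map_add, map_smul, map_smul,
    hp.tangent_g, smul_zero, zero_add, smul_eq_mul, mul_eq_zero] at tangent_sub
  exact tangent_sub.resolve_right fun tangent_I_g =>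
    hp.transversal ⟨hp.tangent_g, tangent_I_g⟩

lemma alongM_eq_zero_of_eq_zero (h0 : X p = 0) (F : C4 → M2) : alongM (X p, X p) F p = 0 := by
  ext i j
  simp only [alongM, Matrix.of_apply, along_real, h0, map_zero, Matrix.zero_apply]

lemma isotropy_levi (h : IsHypersurface ρ p) (hX : IsInfSymmetry ρ p X) (h0 : X p = 0) :
    (φ.symB X p)ᵀ * φ.levi p + φ.levi p * conjM (φ.symB X p) = φ.symA X p • φ.levi p := by
  have invariance := (φ.alongM_levi h hX).self_of_nhds h.zero
  rw [alongM_eq_zero_of_eq_zero h0, sub_sub] at invariance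
  exact (sub_eq_zero.1 invariance.symm).symm

lemma isotropy_s02 (h : IsHypersurface ρ p) (hX : IsInfSymmetry ρ p X) (h0 : X p = 0) :
    symAct (φ.symB X p) (φ.s02 p) = (φ.symA X p + φ.symC X p) • φ.s02 p := by
  have invariance := (φ.alongM_s02 h hX).self_of_nhds h.zero
  rw [alongM_eq_zero_of_eq_zero h0] at invariance
  exact sub_eq_zero.1 invariance.symm

variable {φ} in
lemma AdaptedAt.bracket_e_f_expand {x : C4} (hx : φ.AdaptedAt x) (k : Fin 2) : ∃ r : ℂ,
    along (φ.e x, 0) (φ.f k) x - along (φ.f k x, 0) φ.e x =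
      ∑ l, φ.om x l k • φ.f l x + r • φ.e x := by
  have bracket_mem := neg_mem (hx.bracket_f_e_mem k)
  rw [neg_sub] at bracket_mem
  have expansion := hx.expand bracket_mem
  simp only [hx.coframe_om] at expansion
  exact ⟨_, expansion⟩

lemma along_f_lieX_e (h : IsHypersurface ρ p) (hX : IsInfSymmetry ρ p X) (k : Fin 2) :
    along (φ.f k p, 0) (lieX X φ.e) p =
      (-φ.symC X p) • along (φ.f k p, 0) φ.e p
        + along (φ.f k p, 0) (fun y => -φ.symC X y) p • φ.e p := by
  have hp := (φ.eventually_adaptedAt h).self_of_nhds h.zero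
  have smooth_neg_symC : ContDiffAt ℝ ∞ (fun y => -φ.symC X y) p := (φ.contDiffAt_symC h hX).neg
  rw [(h.along_eq (G := fun y => (-φ.symC X y) • φ.e y) (contDiffAt_lieX hX.1 φ.smooth_e)
      (smooth_neg_symC.smul φ.smooth_e) (φ.lieX_e_eq h hX)).self_of_nhds h.zero
      _ (hp.tangent_f k) 0 (zero_mem _),
    along_smul (smooth_neg_symC.differentiableAt (by simp))
      (φ.smooth_e.differentiableAt (by simp))]

lemma along_e_lieX_f (h : IsHypersurface ρ p) (hX : IsInfSymmetry ρ p X) (k : Fin 2) :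
    ∃ ν : ℂ, along (φ.e p, 0) (lieX X (φ.f k)) p =
      ∑ l, ((-φ.symB X p l k) • along (φ.e p, 0) (φ.f l) p
        + (-alongM (φ.e p, 0) (φ.symB X) p l k) • φ.f l p)
      + ((φ.coframe p (lieX X (φ.f k) p)).2.2 • along (φ.e p, 0) φ.e p + ν • φ.e p) := by
  have hp := (φ.eventually_adaptedAt h).self_of_nhds h.zero
  have smooth_e_comp := φ.contDiffAt_coframe_e h (contDiffAt_lieX hX.1 (φ.smooth_f k))
  have smooth_neg_symB (l : Fin 2) : ContDiffAt ℝ ∞ (fun y => -φ.symB X y l k) p :=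
    (φ.contDiffAt_symB h hX l k).neg
  have derivative_eq := (h.along_eq (G := fun y => ∑ l, (-φ.symB X y l k) • φ.f l y +
      (φ.coframe y (lieX X (φ.f k) y)).2.2 • φ.e y) (contDiffAt_lieX hX.1 (φ.smooth_f k))
    ((ContDiffAt.sum fun l _ => (smooth_neg_symB l).smul (φ.smooth_f l)).add
      (smooth_e_comp.smul φ.smooth_e)) (φ.lieX_f_eq h hX k)).self_of_nhds h.zero
      _ hp.tangent_e 0 (zero_mem _)
  rw [φ.along_combination_fun (fun l => (smooth_neg_symB l).differentiableAt (by simp))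
      (smooth_e_comp.differentiableAt (by simp))
      (fun l => (φ.smooth_f l).differentiableAt (by simp))
      (φ.smooth_e.differentiableAt (by simp))] at derivative_eq
  simp only [along_neg] at derivative_eq
  exact ⟨_, derivative_eq⟩

lemma isotropy_om (h : IsHypersurface ρ p) (hX : IsInfSymmetry ρ p X) (h0 : X p = 0) :
    alongM (φ.e p, 0) (φ.symB X) p = ⁅φ.symB X p, φ.om p⁆ - φ.symC X p • φ.om p := by
  have hp := (φ.eventually_adaptedAt h).self_of_nhds h.zero
  ext m k
  obtain ⟨r, bracket_eq⟩ := hp.bracket_e_f_expand k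
  obtain ⟨ν, along_e⟩ := φ.along_e_lieX_f h hX k
  -- `[X, [e, fₖ]] = [[X, e], fₖ] + [e, [X, fₖ]]`, whose `fₘ`-component is the claim.
  have jacobi := lieX_bracket_hol hX.1 (eventually_contDiffAt φ.smooth_e 2).self_of_nhds
    (eventually_contDiffAt (φ.smooth_f k) 2).self_of_nhds
  rw [lieX_of_eq_zero h0, bracket_eq, (φ.lieX_e_eq h hX).self_of_nhds h.zero, along_hol_smul,
    φ.along_f_lieX_e h hX, along_e, (φ.lieX_f_eq h hX k).self_of_nhds h.zero,
    along_hol_combination] at jacobi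
  have f_component := congrArg (fun v => (φ.coframe p v).2.1 m) jacobi
  have fderiv_comp (l : Fin 2) : (φ.coframe p (fderiv ℂ X p (φ.f l p))).2.1 m = φ.symB X p m l :=
    (φ.symB_apply h0 m l).symm
  have along_f_comp (l : Fin 2) : (φ.coframe p (along (φ.e p, 0) (φ.f l) p)).2.1 m
      = φ.om p m l + (φ.coframe p (along (φ.f l p, 0) φ.e p)).2.1 m := by
    rw [← hp.coframe_om m l, map_sub, Prod.snd_sub, Prod.fst_sub, Pi.sub_apply, sub_add_cancel]
  simp only [map_add, map_sub, map_neg, map_smul, φ.isotropy_e h hX h0, Prod.fst_add, Prod.snd_add,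
    Prod.fst_sub, Prod.snd_sub, Prod.fst_neg, Prod.snd_neg, Prod.smul_fst, Prod.smul_snd,
    Pi.add_apply, Pi.sub_apply, Pi.neg_apply, Pi.smul_apply, coframe_e hp.unit, Pi.zero_apply,
    fderiv_comp, along_f_comp, coframe_f hp.unit, smul_eq_mul, mul_zero, add_zero,
    map_sum, Prod.fst_sum, Prod.snd_sum, Finset.sum_apply, Pi.single_apply, mul_ite, mul_one,
    Finset.sum_add_distrib, Finset.sum_ite_eq, Finset.mem_univ, if_true] at f_component
  simp only [Ring.lie_def, Matrix.sub_apply, Matrix.mul_apply, Matrix.smul_apply, smul_eq_mul,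
    Fin.sum_univ_two] at f_component ⊢
  linear_combination f_component

lemma alongM_alongM_s02 (h : IsHypersurface ρ p) (hX : IsInfSymmetry ρ p X) (h0 : X p = 0) :
    alongM (φ.e p, 0) (fun x => alongM (X x, X x) φ.s02 x) p =
      φ.symC X p • φ.derivE φ.s02 := by
  ext i j
  simp only [alongM, Matrix.of_apply, along_real]
  rw [along_fderiv_apply_of_eq_zero hX.1 h0
      (eventually_contDiffAt (φ.contDiffAt_s02 h i j) 2).self_of_nhds,
    φ.isotropy_e h hX h0, map_zero, along_hol_smul]
  rfl

lemma alongM_alongM_s02_eq (h : IsHypersurface ρ p) (hX : IsInfSymmetry ρ p X) :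
    alongM (φ.e p, 0) (fun x => alongM (X x, X x) φ.s02 x) p =
      alongM (φ.e p, 0) (fun x =>
        symAct (φ.symB X x) (φ.s02 x) - (φ.symA X x + φ.symC X x) • φ.s02 x) p := by
  have hp := (φ.eventually_adaptedAt h).self_of_nhds h.zero
  have smooth_s02 := φ.contDiffAt_s02 h
  have smooth_symB := φ.contDiffAt_symB h hX
  ext i j
  refine (h.along_eq ?_ ?_ ?_).self_of_nhds h.zero _ hp.tangent_e 0 (zero_mem _)
  · simp only [alongM, Matrix.of_apply, along_real]
    exact ((smooth_s02 i j).fderiv_right (by simp)).clm_apply (contDiffAt_real hX.1)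
  · exact ((contDiffAt_mul_entries smooth_symB smooth_s02 i j).add
      (contDiffAt_mul_entries smooth_s02 (fun i j => smooth_symB j i) i j)).sub
        (((φ.contDiffAt_symA h hX).add (φ.contDiffAt_symC h hX)).mul (smooth_s02 i j))
  · exact (φ.alongM_s02 h hX).mono fun x alongM_s02 hρ => congrFun₂ (alongM_s02 hρ) i j

lemma isotropy_derivE (h : IsHypersurface ρ p) (hX : IsInfSymmetry ρ p X) (h0 : X p = 0) :
    ∃ κ : ℂ, symAct (alongM (φ.e p, 0) (φ.symB X) p) (φ.s02 p) =
      κ • φ.s02 p + (φ.symA X p + 2 * φ.symC X p) • φ.derivE φ.s02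
        - symAct (φ.symB X p) (φ.derivE φ.s02) := by
  have ds02 (i j : Fin 2) : DifferentiableAt ℝ (fun x => φ.s02 x i j) p :=
    (φ.contDiffAt_s02 h i j).differentiableAt (by simp)
  have dsymB (i j : Fin 2) : DifferentiableAt ℝ (fun x => φ.symB X x i j) p :=
    (φ.contDiffAt_symB h hX i j).differentiableAt (by simp)
  have dsum : DifferentiableAt ℝ (fun x => φ.symA X x + φ.symC X x) p :=
    ((φ.contDiffAt_symA h hX).add (φ.contDiffAt_symC h hX)).differentiableAt (by simp)
  have derivE_eq : alongM (φ.e p, 0) φ.s02 p = φ.derivE φ.s02 := rfl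
  have invariance := φ.alongM_alongM_s02 h hX h0
  rw [φ.alongM_alongM_s02_eq h hX, alongM_symAct_sub_smul dsymB ds02 dsum ds02,
    derivE_eq] at invariance
  refine ⟨along (φ.e p, 0) (fun x => φ.symA X x + φ.symC X x) p, ?_⟩
  rw [eq_sub_iff_add_eq, sub_eq_iff_eq_add.1 invariance]
  module

end Isotropy

end AdaptedFrame

/-! ### Conjugation and the action on bilinear forms -/

section MatrixAlgebra

lemma conjM_add (A B : M2) : conjM (A + B) = conjM A + conjM B :=
  map_add (starRingEnd ℂ).mapMatrix A B

lemma conjM_sub (A B : M2) : conjM (A - B) = conjM A - conjM B :=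
  map_sub (starRingEnd ℂ).mapMatrix A B

lemma conjM_mul (A B : M2) : conjM (A * B) = conjM A * conjM B :=
  map_mul (starRingEnd ℂ).mapMatrix A B

lemma conjM_zero : conjM (0 : M2) = 0 :=
  map_zero (starRingEnd ℂ).mapMatrix

lemma conjM_one : conjM (1 : M2) = 1 :=
  map_one (starRingEnd ℂ).mapMatrix

lemma conjM_conjM (A : M2) : conjM (conjM A) = A := by
  ext i j
  exact Complex.conj_conj _

lemma conjM_real_smul (r : ℝ) (A : M2) : conjM (r • A) = r • conjM A := by
  ext i j
  simp [conjM]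

lemma conjM_det (A : M2) : (conjM A).det = (starRingEnd ℂ) A.det :=
  ((starRingEnd ℂ).map_det A).symm

lemma conjM_inv (A : M2) : conjM A⁻¹ = (conjM A)⁻¹ := by
  have map_adjugate : conjM A.adjugate = (conjM A).adjugate := (starRingEnd ℂ).map_adjugate A
  rw [Matrix.inv_def, Matrix.inv_def, conjM_det, Ring.inverse_eq_inv',
    ← map_inv₀, ← map_adjugate]
  ext i j
  exact map_mul (starRingEnd ℂ) _ _

lemma symAct_add_left (A B S : M2) : symAct (A + B) S = symAct A S + symAct B S := by
  rw [symAct, Matrix.transpose_add, add_mul, mul_add, add_add_add_comm, symAct, symAct]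

lemma symAct_sub_left (A B S : M2) : symAct (A - B) S = symAct A S - symAct B S := by
  rw [symAct, Matrix.transpose_sub, sub_mul, mul_sub, sub_add_sub_comm, symAct, symAct]

lemma symAct_add_right (A S T : M2) : symAct A (S + T) = symAct A S + symAct A T := by
  rw [symAct, mul_add, add_mul, add_add_add_comm, symAct, symAct]

section Smul

variable {R : Type*} [Monoid R] [DistribMulAction R ℂ] [SMulCommClass R ℂ ℂ] [IsScalarTower R ℂ ℂ]

lemma symAct_smul_left (c : R) (A S : M2) : symAct (c • A) S = c • symAct A S := by
  rw [symAct, Matrix.transpose_smul, Matrix.smul_mul, Matrix.mul_smul, ← smul_add, symAct]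

lemma symAct_smul_right (c : R) (A S : M2) : symAct A (c • S) = c • symAct A S := by
  rw [symAct, Matrix.mul_smul, Matrix.smul_mul, ← smul_add, symAct]

end Smul

lemma symAct_lie (A B S : M2) :
    symAct ⁅A, B⁆ S = symAct A (symAct B S) - symAct B (symAct A S) := by
  simp only [symAct, Ring.lie_def, Matrix.transpose_sub, Matrix.transpose_mul]
  noncomm_ring

lemma symAct_lie_eq_zero {A B S : M2} {α β : ℂ} (hA : symAct A S = α • S)
    (hB : symAct B S = β • S) : symAct ⁅A, B⁆ S = 0 := by
  rw [symAct_lie, hA, hB, symAct_smul_right, symAct_smul_right, hA, hB, smul_comm, sub_self]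

end MatrixAlgebra

/-! ### The upper bound for the isotropy -/

/-- The matrices `B` for which, with suitable `a` and `c`, the weighted degree zero linear map
`(w, z, ζ) ↦ (a w, B z, c ζ)` preserves the data `H`, `S`, `Ω`. -/
def symbolAlgebra (H S Ω : M2) : Submodule ℝ M2 where
  carrier := {B | ∃ (a : ℝ) (c : ℂ), Bᵀ * H + H * conjM B = (a : ℂ) • H ∧
    symAct B S = (a + c) • S ∧ ⁅B, Ω⁆ = c • Ω}
  add_mem' := by
    rintro B B' ⟨a, c, levi, sym, om⟩ ⟨a', c', levi', sym', om'⟩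
    refine ⟨a + a', c + c', ?_, ?_, ?_⟩
    · rw [Complex.ofReal_add, add_smul, ← levi, ← levi', conjM_add, Matrix.transpose_add, add_mul,
        mul_add, add_add_add_comm]
    · rw [Complex.ofReal_add, add_add_add_comm, add_smul, ← sym, ← sym', symAct_add_left]
    · rw [add_smul, ← om, ← om', Ring.lie_def, Ring.lie_def, Ring.lie_def, add_mul, mul_add,
        add_sub_add_comm]
  zero_mem' := ⟨0, 0, by simp [conjM_zero], by simp [symAct], by simp [Ring.lie_def]⟩
  smul_mem' := by
    rintro r B ⟨a, c, levi, sym, om⟩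
    refine ⟨r * a, r * c, ?_, ?_, ?_⟩
    · rw [Complex.ofReal_mul, mul_smul, ← levi, conjM_real_smul, Matrix.transpose_smul,
        Matrix.smul_mul, Matrix.mul_smul, Complex.coe_smul, smul_add]
    · rw [Complex.ofReal_mul, ← mul_add, mul_smul, ← sym, symAct_smul_left, Complex.coe_smul]
    · rw [mul_smul, ← om, Ring.lie_def, Matrix.smul_mul, Matrix.mul_smul,
        ← smul_sub, ← Ring.lie_def, Complex.coe_smul]

/-- The symmetry, reality and nondegeneracy properties of the data of a model. -/
structure IsModelData (H S : M2) : Prop where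
  transpose_H : Hᵀ = H
  conj_H : conjM H = H
  det_H : H.det ≠ 0
  transpose_S : Sᵀ = S
  S_ne_zero : S ≠ 0

/-- A modified symbol `(H, S, Ω)` that is normalized by `N`. The last field is the uniqueness of
the normal form at the infinitesimal level: a matrix that preserves `H` and `S` up to scale, and
`Ω` up to scale modulo the normalization, preserves `Ω` up to scale. Its equation with `κ` is the
infinitesimal invariance of the condition `e(S^{0,2})(p) ∈ N + ℂ S`, where `n` is the component
in `N`. -/
structure IsNormalizedSymbol (H S Ω : M2) (N : Submodule ℂ M2) : Prop
    extends IsModelData H S where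
  symAct_transpose_mem : symAct Ωᵀ (H * conjM S * H) ∈ Submodule.span ℂ {H * conjM S * H}
  lie_eq : ∀ {B n : M2} {a : ℝ} {c κ : ℂ}, n ∈ N → Bᵀ * H + H * conjM B = (a : ℂ) • H →
    symAct B S = (a + c) • S →
    symAct (⁅B, Ω⁆ - c • Ω) S = κ • S + (a + 2 * c) • n - symAct B n → ⁅B, Ω⁆ = c • Ω

section Finrank

variable {K V W : Type*} [DivisionRing K] [AddCommGroup V] [Module K V] [AddCommGroup W]
  [Module K W] {I P : Submodule K V} {A : Submodule K W} (f : V →ₗ[K] W)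

lemma finrank_map_mkQ_le [FiniteDimensional K W] (map_le : I.map f ≤ A)
    (ker_le : I ⊓ LinearMap.ker f ≤ P) :
    Module.finrank K (I.map P.mkQ) ≤ Module.finrank K A := by
  have ker_domRestrict_le :
      LinearMap.ker (f.domRestrict I) ≤ LinearMap.ker (P.mkQ.domRestrict I) := fun v hv =>
    (Submodule.Quotient.mk_eq_zero P).2 (ker_le ⟨v.2, hv⟩)
  have range_liftQ : I.map P.mkQ =
      LinearMap.range ((LinearMap.ker (f.domRestrict I)).liftQ _ ker_domRestrict_le) := by
    rw [Submodule.range_liftQ, LinearMap.range_domRestrict]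
  have equiv_map := (f.domRestrict I).quotKerEquivRange
  rw [LinearMap.range_domRestrict] at equiv_map
  have : FiniteDimensional K (I ⧸ LinearMap.ker (f.domRestrict I)) :=
    Module.Finite.equiv equiv_map.symm
  calc Module.finrank K (I.map P.mkQ)
      ≤ Module.finrank K (I ⧸ LinearMap.ker (f.domRestrict I)) :=
        range_liftQ ▸ LinearMap.finrank_range_le _
    _ = Module.finrank K (I.map f) := equiv_map.finrank_eq
    _ ≤ Module.finrank K A := Submodule.finrank_mono map_le

lemma finrank_le_finrank_map_mkQ [FiniteDimensional K V] (le_ker : P ≤ LinearMap.ker f)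
    (le_map : A ≤ I.map f) : Module.finrank K A ≤ Module.finrank K (I.map P.mkQ) := by
  have map_eq : I.map f = (I.map P.mkQ).map (P.liftQ f le_ker) := by
    rw [← Submodule.map_comp, Submodule.liftQ_mkQ]
  exact (Submodule.finrank_mono (le_map.trans map_eq.le)).trans (Submodule.finrank_map_le _ _)

end Finrank

lemma IsTwoNondegenerate.isHypersurface {ρ : C4 → ℝ} {p : C4} (h : IsTwoNondegenerate ρ p) :
    IsHypersurface ρ p :=
  ⟨h.1.contDiffAt, h.2.1, h.2.2.1⟩

namespace AdaptedFrame

variable {ρ : C4 → ℝ} {p : C4} {X : C4 → C4}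

/-- The compression of an endomorphism of `ℂ⁴` to `ℋ / 𝒦` at `p`, as a matrix in the basis
`f₁, f₂`. -/
def isotropyMatrix (φ : AdaptedFrame ρ p) : (C4 →L[ℂ] C4) →ₗ[ℝ] M2 where
  toFun L := Matrix.of fun l k => (φ.coframe p (L (φ.f k p))).2.1 l
  map_add' L L' := by
    ext l k
    simp only [add_apply, map_add, Prod.snd_add, Prod.fst_add, Pi.add_apply, Matrix.of_apply,
      Matrix.add_apply]
  map_smul' r L := by
    ext l k
    simp only [RingHom.id_apply, Matrix.of_apply, Matrix.smul_apply, ← Complex.coe_smul,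
      smul_apply, map_smul, Prod.smul_snd, Prod.smul_fst, Pi.smul_apply]

section Isotropy

variable (φ : AdaptedFrame ρ p)

lemma isotropyMatrix_fderiv (h0 : X p = 0) : φ.isotropyMatrix (fderiv ℂ X p) = φ.symB X p := by
  ext l k
  exact (φ.symB_apply h0 l k).symm

lemma symB_mem_symbolAlgebra {H S Ω : M2} {N : Submodule ℂ M2}
    (hsymb : IsNormalizedSymbol H S Ω N) (h : IsHypersurface ρ p) (levi_eq : φ.levi p = H)
    (s02_eq : φ.s02 p = S) (derivE_mem : φ.derivE φ.s02 ∈ N ⊔ Submodule.span ℂ {φ.s02 p})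
    (om_sub_mem : φ.om p - Ω ∈ g00 H S) (hX : IsInfSymmetry ρ p X) (h0 : X p = 0) :
    φ.symB X p ∈ symbolAlgebra H S Ω := by
  have symA_real : φ.symA X p = ((φ.symA X p).re : ℂ) :=
    Complex.ext (by simp) (by simp [(φ.isotropy_g h hX h0).1])
  have levi_inv := φ.isotropy_levi h hX h0
  have s02_inv := φ.isotropy_s02 h hX h0
  obtain ⟨κ, derivE_inv⟩ := φ.isotropy_derivE h hX h0
  rw [φ.isotropy_om h hX h0, s02_eq, symA_real] at derivE_inv
  rw [levi_eq, symA_real] at levi_inv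
  rw [s02_eq, symA_real] at s02_inv
  rw [s02_eq] at derivE_mem
  set B := φ.symB X p
  set c := φ.symC X p
  set a := (φ.symA X p).re
  obtain ⟨n, hn, m, hm, derivE_eq⟩ := Submodule.mem_sup.1 derivE_mem
  obtain ⟨σ, rfl⟩ := Submodule.mem_span_singleton.1 hm
  obtain ⟨γ, hγ⟩ := Submodule.mem_span_singleton.1 om_sub_mem.1
  obtain ⟨G, om_eq⟩ : ∃ G, φ.om p = Ω + G := ⟨φ.om p - Ω, (add_sub_cancel _ _).symm⟩
  have symAct_G : symAct G S = γ • S := by rw [hγ, om_eq, add_sub_cancel_left, symAct]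
  refine ⟨a, c, levi_inv, s02_inv,
    hsymb.lie_eq (κ := κ + c * γ + (a + 2 * c) * σ - σ * (a + c)) hn levi_inv s02_inv ?_⟩
  have split_om : ⁅B, Ω⁆ - c • Ω = (⁅B, φ.om p⁆ - c • φ.om p) - ⁅B, G⁆ + c • G := by
    rw [om_eq, smul_add, Ring.lie_def, Ring.lie_def, Ring.lie_def, mul_add, add_mul]
    abel
  rw [split_om, symAct_add_left, symAct_sub_left, symAct_lie_eq_zero s02_inv symAct_G, derivE_inv,
    ← derivE_eq, symAct_smul_left, symAct_G, symAct_add_right, symAct_smul_right, s02_inv]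
  module

lemma symA_eq_zero_of_symB_eq_zero (h : IsHypersurface ρ p) (hX : IsInfSymmetry ρ p X)
    (h0 : X p = 0) (hB : φ.symB X p = 0) : φ.symA X p = 0 := by
  have hp := (φ.eventually_adaptedAt h).self_of_nhds h.zero
  have levi_inv := φ.isotropy_levi h hX h0
  rw [hB, conjM_zero, Matrix.transpose_zero, zero_mul, mul_zero, add_zero] at levi_inv
  refine (smul_eq_zero.1 levi_inv.symm).resolve_right fun levi_zero =>
    hp.levi_nondeg.ne_zero ?_
  rw [levi_zero, Matrix.det_zero]

lemma symC_eq_zero_of_symB_eq_zero (h : IsHypersurface ρ p) (hX : IsInfSymmetry ρ p X)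
    (h0 : X p = 0) (hS : φ.s02 p ≠ 0) (hB : φ.symB X p = 0) : φ.symC X p = 0 := by
  have s02_inv := φ.isotropy_s02 h hX h0
  rw [hB, φ.symA_eq_zero_of_symB_eq_zero h hX h0 hB, symAct, Matrix.transpose_zero, zero_mul,
    mul_zero, add_zero, zero_add] at s02_inv
  exact (smul_eq_zero.1 s02_inv.symm).resolve_right hS

lemma fderiv_mem_positiveWeight (h : IsHypersurface ρ p) (hX : IsInfSymmetry ρ p X)
    (h0 : X p = 0) (hS : φ.s02 p ≠ 0) (hB : φ.symB X p = 0) :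
    fderiv ℂ X p ∈ positiveWeight ρ p := by
  have hp := (φ.eventually_adaptedAt h).self_of_nhds h.zero
  have map_e : fderiv ℂ X p (φ.e p) = 0 := by
    rw [φ.isotropy_e h hX h0, φ.symC_eq_zero_of_symB_eq_zero h hX h0 hS hB, zero_smul]
  have map_f (k : Fin 2) : fderiv ℂ X p (φ.f k p) ∈ Submodule.span ℂ {φ.e p} := by
    obtain ⟨r, hr⟩ := φ.isotropy_f h hX h0 k
    rw [hr, hB]
    simpa using Submodule.smul_mem _ r (Submodule.mem_span_singleton_self _)
  have map_g : fderiv ℂ X p (φ.g p) ∈ holTangent ρ p := by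
    simpa only [φ.symA_eq_zero_of_symB_eq_zero h hX h0 hB, zero_smul, sub_zero]
      using (φ.isotropy_g h hX h0).2
  have span_le : Submodule.span ℂ {φ.e p} ≤ holTangent ρ p :=
    (Submodule.span_singleton_le_iff_mem _ _).2 hp.tangent_e
  refine ⟨fun v => ?_, fun v hv => ?_, fun v hv => ?_⟩
  · rw [coframe_expand hp.unit v]
    simp only [map_add, map_sum, map_smul, map_e, smul_zero, add_zero]
    exact add_mem (Submodule.smul_mem _ _ map_g)
      (Submodule.sum_mem _ fun l _ => Submodule.smul_mem _ _ (span_le (map_f l)))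
  · rw [φ.leviKernel_eq h, hp.expand hv]
    simp only [map_add, map_sum, map_smul, map_e, smul_zero, add_zero]
    exact Submodule.sum_mem _ fun l _ => Submodule.smul_mem _ _ (map_f l)
  · rw [φ.leviKernel_eq h, Submodule.mem_span_singleton] at hv
    obtain ⟨r, rfl⟩ := hv
    rw [map_smul, map_e, smul_zero]

lemma positiveWeight_le_ker (h : IsHypersurface ρ p) :
    positiveWeight ρ p ≤ LinearMap.ker φ.isotropyMatrix := by
  rintro L ⟨-, map_holTangent, -⟩
  have hp := (φ.eventually_adaptedAt h).self_of_nhds h.zero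
  ext l k
  have map_f := map_holTangent _ (hp.tangent_f k)
  rw [φ.leviKernel_eq h] at map_f
  exact congrFun ((hp.mem_span_e_iff _).1 map_f).2 l

end Isotropy

end AdaptedFrame

lemma IsNormalizedSymbol.degreeZeroIsotropyDim_le {ρ : C4 → ℝ} {p : C4} {H S Ω : M2}
    {N : Submodule ℂ M2} (hsymb : IsNormalizedSymbol H S Ω N) (h : IsHypersurface ρ p)
    (hρ : HasModifiedSymbol ρ p H S Ω N) :
    degreeZeroIsotropyDim ρ p ≤ Module.finrank ℝ (symbolAlgebra H S Ω) := by
  obtain ⟨φ, levi_eq, s02_eq, -, derivE_mem, om_sub_mem⟩ := hρ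
  refine finrank_map_mkQ_le φ.isotropyMatrix ?_ ?_
  · rintro _ ⟨_, ⟨X, hX, h0, rfl⟩, rfl⟩
    rw [φ.isotropyMatrix_fderiv h0]
    exact φ.symB_mem_symbolAlgebra hsymb h levi_eq s02_eq derivE_mem om_sub_mem hX h0
  · rintro _ ⟨⟨X, hX, h0, rfl⟩, hB⟩
    rw [SetLike.mem_coe, LinearMap.mem_ker, φ.isotropyMatrix_fderiv h0] at hB
    exact φ.fderiv_mem_positiveWeight h hX h0 (s02_eq ▸ hsymb.S_ne_zero) hB

/-! ### The matrix `𝐒(ζ)` -/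

section MatrixExp

lemma fromBlocks_one_sub_one {m n R : Type*} [DecidableEq m] [DecidableEq n] [Ring R]
    (B : Matrix m n R) :
    Matrix.fromBlocks (1 : Matrix m m R) B 0 (1 : Matrix n n R) - 1 =
      Matrix.fromBlocks 0 B 0 0 := by
  rw [sub_eq_iff_eq_add, ← Matrix.fromBlocks_one, Matrix.fromBlocks_add]
  simp

section BlockTriangular

variable {m n R : Type*} [Fintype m] [DecidableEq m] [Fintype n] [DecidableEq n]

lemma fromBlocks_zero₂₁_pow [Ring R] (A : Matrix m m R) (B : Matrix m n R) (D : Matrix n n R)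
    (k : ℕ) :
    ∃ B', Matrix.fromBlocks A B 0 D ^ k = Matrix.fromBlocks (A ^ k) B' 0 (D ^ k) := by
  induction k with
  | zero => exact ⟨0, by simp [Matrix.fromBlocks_one]⟩
  | succ k ih =>
    obtain ⟨B', pow_eq⟩ := ih
    refine ⟨A ^ k * B + B' * D, ?_⟩
    simp [pow_succ, pow_eq, Matrix.fromBlocks_multiply]

lemma hasSum_exp_apply (A : Matrix m m ℂ) (i j : m) :
    HasSum (fun k : ℕ => (k.factorial : ℂ)⁻¹ * (A ^ k) i j) (NormedSpace.exp A i j) := by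
  open scoped Matrix.Norms.Operator in
  exact (NormedSpace.exp_series_hasSum_exp' (𝕂 := ℂ) A).mapL
    (LinearMap.toContinuousLinearMap (Matrix.entryLinearMap ℂ ℂ i j))

lemma exp_fromBlocks_zero₂₁ (A : Matrix m m ℂ) (B : Matrix m n ℂ) (D : Matrix n n ℂ) :
    ∃ B', NormedSpace.exp (Matrix.fromBlocks A B 0 D) =
      Matrix.fromBlocks (NormedSpace.exp A) B' 0 (NormedSpace.exp D) := by
  refine ⟨(NormedSpace.exp (Matrix.fromBlocks A B 0 D)).toBlocks₁₂, ?_⟩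
  choose B' pow_eq using fromBlocks_zero₂₁_pow A B D
  ext (i | i) (j | j)
  · refine (hasSum_exp_apply _ _ _).unique ?_
    simpa [pow_eq] using hasSum_exp_apply A i j
  · rfl
  · refine (hasSum_exp_apply _ _ _).unique ?_
    simp [pow_eq]
  · refine (hasSum_exp_apply _ _ _).unique ?_
    simpa [pow_eq] using hasSum_exp_apply D i j

end BlockTriangular

section OneParameter

variable {m : Type*} [Fintype m] [DecidableEq m] (A : Matrix m m ℂ) (t : ℂ)

lemma exp_mul_exp_neg : NormedSpace.exp A * NormedSpace.exp (-A) = 1 := by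
  rw [← Matrix.exp_add_of_commute _ _ (Commute.refl A).neg_right, add_neg_cancel,
    NormedSpace.exp_zero]

lemma hasDerivAt_exp_smul_apply (i j : m) :
    HasDerivAt (fun s : ℂ => NormedSpace.exp (s • A) i j)
      ((NormedSpace.exp (t • A) * A) i j) t := by
  open scoped Matrix.Norms.Operator in
  exact (LinearMap.toContinuousLinearMap
    (Matrix.entryLinearMap ℂ ℂ i j)).hasFDerivAt.comp_hasDerivAt t (hasDerivAt_exp_smul_const A t)

lemma exp_smul_mul_comm : NormedSpace.exp (t • A) * A = A * NormedSpace.exp (t • A) := by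
  open scoped Matrix.Norms.Operator in
  exact (((Commute.refl A).smul_left t).exp_left).eq

end OneParameter

lemma matLog_of_sub_one_sq_eq_zero {A : Matrix (Fin 2 ⊕ Fin 2) (Fin 2 ⊕ Fin 2) ℂ}
    (hA : (A - 1) ^ 2 = 0) : matLog A = A - 1 := by
  rw [matLog, tsum_eq_single 0]
  · simp
  · intro k hk
    obtain ⟨k, rfl⟩ := Nat.exists_eq_succ_of_ne_zero hk
    rw [show k.succ + 1 = 2 + k by omega, pow_add, hA, zero_mul, smul_zero]

section BigS

variable (S Ω : M2) (ζ : ℂ)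

lemma csp_smul : csp (ζ • S) (ζ • Ω) = ζ • csp S Ω := by
  simp [csp, Matrix.fromBlocks_smul, Matrix.transpose_smul]

lemma csp_zero_neg_smul : csp 0 (-(ζ • Ω)) = ζ • csp 0 (-Ω) := by
  rw [← csp_smul, smul_zero, smul_neg]

lemma csp_add_csp_zero_neg : csp S Ω + csp 0 (-Ω) = Matrix.fromBlocks 0 S 0 0 := by
  simp [csp, Matrix.fromBlocks_add]

lemma exp_csp : ∃ B, NormedSpace.exp (csp S Ω) =
    Matrix.fromBlocks (NormedSpace.exp Ω) B 0 (NormedSpace.exp (-Ω))ᵀ := by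
  obtain ⟨B, exp_eq⟩ := exp_fromBlocks_zero₂₁ Ω S (-Ωᵀ)
  exact ⟨B, by rw [csp, exp_eq, ← Matrix.transpose_neg, Matrix.exp_transpose]⟩

lemma exp_csp_mul_exp_csp :
    NormedSpace.exp (csp (ζ • S) (ζ • Ω)) * NormedSpace.exp (csp 0 (-(ζ • Ω))) =
      Matrix.fromBlocks 1 (bigS S Ω ζ) 0 1 := by
  obtain ⟨B₁, exp_eq₁⟩ := exp_csp (ζ • S) (ζ • Ω)
  obtain ⟨B₂, exp_eq₂⟩ := exp_csp 0 (-(ζ • Ω))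
  obtain ⟨B, unipotent⟩ : ∃ B, NormedSpace.exp (csp (ζ • S) (ζ • Ω)) *
      NormedSpace.exp (csp 0 (-(ζ • Ω))) = Matrix.fromBlocks 1 B 0 1 := by
    refine ⟨NormedSpace.exp (ζ • Ω) * B₂ + B₁ * (NormedSpace.exp (ζ • Ω))ᵀ, ?_⟩
    rw [exp_eq₁, exp_eq₂, Matrix.fromBlocks_multiply, neg_neg, ← Matrix.transpose_mul,
      exp_mul_exp_neg]
    simp
  have bigS_eq : bigS S Ω ζ = B := by
    rw [bigS, unipotent, matLog_of_sub_one_sq_eq_zero, fromBlocks_one_sub_one,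
      Matrix.toBlocks_fromBlocks₁₂]
    rw [fromBlocks_one_sub_one, sq, Matrix.fromBlocks_multiply]
    simp
  rw [unipotent, bigS_eq]

lemma bigS_zero : bigS S Ω 0 = 0 := by
  have exp_eq := exp_csp_mul_exp_csp S Ω 0
  rw [csp_smul, csp_zero_neg_smul, zero_smul, zero_smul, NormedSpace.exp_zero, mul_one,
    ← Matrix.fromBlocks_one] at exp_eq
  exact (Matrix.fromBlocks_inj.1 exp_eq).2.1.symm

lemma hasDerivAt_bigS (i j : Fin 2) :
    HasDerivAt (fun s => bigS S Ω s i j)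
      ((NormedSpace.exp (ζ • Ω) * S * (NormedSpace.exp (ζ • Ω))ᵀ) i j) ζ := by
  have bigS_eq : (fun s => bigS S Ω s i j) = fun s => ∑ k,
      NormedSpace.exp (s • csp S Ω) (Sum.inl i) k *
        NormedSpace.exp (s • csp 0 (-Ω)) k (Sum.inr j) := by
    funext s
    rw [← Matrix.mul_apply, ← csp_smul, ← csp_zero_neg_smul, exp_csp_mul_exp_csp,
      Matrix.fromBlocks_apply₁₂]
  rw [bigS_eq]
  refine (HasDerivAt.fun_sum fun k _ => (hasDerivAt_exp_smul_apply (csp S Ω) ζ _ k).mul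
    (hasDerivAt_exp_smul_apply (csp 0 (-Ω)) ζ k _)).congr_deriv ?_
  obtain ⟨B₁, exp_eq₁⟩ := exp_csp (ζ • S) (ζ • Ω)
  obtain ⟨B₂, exp_eq₂⟩ := exp_csp 0 (-(ζ • Ω))
  rw [Finset.sum_add_distrib, ← Matrix.mul_apply, ← Matrix.mul_apply,
    exp_smul_mul_comm (csp 0 (-Ω)), ← Matrix.add_apply, mul_assoc, ← mul_add, ← add_mul,
    csp_add_csp_zero_neg, ← csp_smul, ← csp_zero_neg_smul, exp_eq₁, exp_eq₂, neg_neg,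
    Matrix.fromBlocks_multiply, Matrix.fromBlocks_multiply, Matrix.fromBlocks_apply₁₂]
  simp [mul_assoc]

end BigS

end MatrixExp

/-! ### Equivariance of `𝐒(ζ)` -/

/-- A matrix-valued function of one complex variable has the given derivative. The notion is
entrywise, so that no norm on matrices has to be chosen. -/
def HasDerivM (F : ℂ → M2) (F' : M2) (ζ : ℂ) : Prop :=
  ∀ i j, HasDerivAt (fun s => F s i j) (F' i j) ζ

namespace HasDerivM

variable {F G : ℂ → M2} {F' G' : M2} {ζ : ℂ}

lemma const (A : M2) : HasDerivM (fun _ => A) 0 ζ :=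
  fun _ _ => hasDerivAt_const _ _

lemma congr_deriv (hF : HasDerivM F F' ζ) (h : F' = G') : HasDerivM F G' ζ := h ▸ hF

lemma add (hF : HasDerivM F F' ζ) (hG : HasDerivM G G' ζ) :
    HasDerivM (fun s => F s + G s) (F' + G') ζ :=
  fun i j => (hF i j).add (hG i j)

lemma sub (hF : HasDerivM F F' ζ) (hG : HasDerivM G G' ζ) :
    HasDerivM (fun s => F s - G s) (F' - G') ζ :=
  fun i j => (hF i j).sub (hG i j)

lemma mul (hF : HasDerivM F F' ζ) (hG : HasDerivM G G' ζ) :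
    HasDerivM (fun s => F s * G s) (F' * G ζ + F ζ * G') ζ := by
  intro i j
  simp only [Matrix.mul_apply, Matrix.add_apply, ← Finset.sum_add_distrib]
  exact HasDerivAt.fun_sum fun k _ => (hF i k).mul (hG k j)

lemma const_mul (A : M2) (hF : HasDerivM F F' ζ) : HasDerivM (fun s => A * F s) (A * F') ζ :=
  ((const A).mul hF).congr_deriv (by rw [zero_mul, zero_add])

lemma mul_const (hF : HasDerivM F F' ζ) (A : M2) : HasDerivM (fun s => F s * A) (F' * A) ζ :=
  (hF.mul (const A)).congr_deriv (by rw [mul_zero, add_zero])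

lemma smul {u : ℂ → ℂ} {u' : ℂ} (hu : HasDerivAt u u' ζ) (hF : HasDerivM F F' ζ) :
    HasDerivM (fun s => u s • F s) (u' • F ζ + u ζ • F') ζ :=
  fun i j => hu.mul (hF i j)

lemma const_smul (c : ℂ) (hF : HasDerivM F F' ζ) : HasDerivM (fun s => c • F s) (c • F') ζ :=
  fun i j => (hF i j).const_mul c

lemma transpose (hF : HasDerivM F F' ζ) : HasDerivM (fun s => (F s)ᵀ) F'ᵀ ζ :=
  fun i j => hF j i

lemma eq_of_deriv_eq_zero (hF : ∀ ζ, HasDerivM F 0 ζ) (ζ : ℂ) : F ζ = F 0 := by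
  ext i j
  exact is_const_of_deriv_eq_zero (f := fun s => F s i j) (fun s => (hF s i j).differentiableAt)
    (fun s => (hF s i j).deriv) ζ 0

end HasDerivM

/-- The one-parameter group generated by `Ω`. -/
def expU (Ω : M2) (ζ : ℂ) : M2 := NormedSpace.exp (ζ • Ω)

/-- The derivative of `bigS`. -/
def bigS' (S Ω : M2) (ζ : ℂ) : M2 := expU Ω ζ * S * (expU Ω ζ)ᵀ

section BigS

variable {B S : M2} {a c : ℂ} (Ω : M2) (ζ : ℂ)

lemma expU_zero : expU Ω 0 = 1 := by
  rw [expU, zero_smul, NormedSpace.exp_zero]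

lemma expU_mul_expU_neg : expU Ω ζ * expU (-Ω) ζ = 1 := by
  rw [expU, expU, smul_neg, exp_mul_exp_neg]

lemma expU_neg_mul_expU : expU (-Ω) ζ * expU Ω ζ = 1 := by
  simpa only [neg_neg] using expU_mul_expU_neg (-Ω) ζ

lemma expU_mul_comm : expU Ω ζ * Ω = Ω * expU Ω ζ := exp_smul_mul_comm Ω ζ

lemma det_expU_ne_zero : (expU Ω ζ).det ≠ 0 :=
  left_ne_zero_of_mul_eq_one (b := (expU (-Ω) ζ).det)
    (by rw [← Matrix.det_mul, expU_mul_expU_neg, Matrix.det_one])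

lemma hasDerivM_expU : HasDerivM (expU Ω) (expU Ω ζ * Ω) ζ :=
  hasDerivAt_exp_smul_apply Ω ζ

lemma hasDerivM_bigS (S : M2) : HasDerivM (bigS S Ω) (bigS' S Ω ζ) ζ :=
  hasDerivAt_bigS S Ω ζ

lemma hasDerivM_bigS' (S : M2) :
    HasDerivM (bigS' S Ω) (expU Ω ζ * symAct Ω S * (expU Ω ζ)ᵀ) ζ := by
  refine (((hasDerivM_expU Ω ζ).mul_const S).mul (hasDerivM_expU Ω ζ).transpose).congr_deriv ?_
  rw [symAct, Matrix.transpose_mul]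
  noncomm_ring

lemma bigS'_transpose (hS : Sᵀ = S) : (bigS' S Ω ζ)ᵀ = bigS' S Ω ζ := by
  rw [bigS', Matrix.transpose_mul, Matrix.transpose_mul, Matrix.transpose_transpose, hS, mul_assoc]

lemma bigS_transpose (hS : Sᵀ = S) : (bigS S Ω ζ)ᵀ = bigS S Ω ζ := by
  have eq_at_zero := HasDerivM.eq_of_deriv_eq_zero (F := fun s => (bigS S Ω s)ᵀ - bigS S Ω s)
    (fun ζ => ((hasDerivM_bigS Ω ζ S).transpose.sub (hasDerivM_bigS Ω ζ S)).congr_deriv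
      (by rw [bigS'_transpose Ω ζ hS, sub_self])) ζ
  rw [bigS_zero, Matrix.transpose_zero, sub_self] at eq_at_zero
  exact sub_eq_zero.1 eq_at_zero

variable {Ω}

lemma mul_expU (hΩ : ⁅B, Ω⁆ = c • Ω) : B * expU Ω ζ = expU Ω ζ * (B + (c * ζ) • Ω) := by
  have conj_lie (ζ : ℂ) : expU (-Ω) ζ * -Ω * B * expU Ω ζ + expU (-Ω) ζ * B * (expU Ω ζ * Ω) =
      c • Ω :=
    calc expU (-Ω) ζ * -Ω * B * expU Ω ζ + expU (-Ω) ζ * B * (expU Ω ζ * Ω)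
        = expU (-Ω) ζ * ⁅B, Ω⁆ * expU Ω ζ := by
          rw [expU_mul_comm Ω ζ, Ring.lie_def]
          noncomm_ring
      _ = c • (expU (-Ω) ζ * expU Ω ζ * Ω) := by
          rw [hΩ, Matrix.mul_smul, Matrix.smul_mul, mul_assoc, ← expU_mul_comm, ← mul_assoc]
      _ = c • Ω := by rw [expU_neg_mul_expU, one_mul]
  have eq_at_zero := HasDerivM.eq_of_deriv_eq_zero
    (F := fun s => expU (-Ω) s * B * expU Ω s - (c * s) • Ω) (fun ζ =>
      ((((hasDerivM_expU (-Ω) ζ).mul_const B).mul (hasDerivM_expU Ω ζ)).sub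
        (HasDerivM.smul ((hasDerivAt_id ζ).const_mul c) (.const Ω))).congr_deriv
        (by rw [conj_lie, mul_one, smul_zero, add_zero, sub_self])) ζ
  rw [expU_zero, expU_zero, mul_zero, zero_smul, sub_zero, one_mul, mul_one,
    sub_eq_iff_eq_add] at eq_at_zero
  rw [← eq_at_zero, mul_assoc, ← mul_assoc, expU_mul_expU_neg, one_mul]

lemma symAct_bigS' (hS : symAct B S = (a + c) • S) (hΩ : ⁅B, Ω⁆ = c • Ω) :
    symAct B (bigS' S Ω ζ) =
      (a + c) • bigS' S Ω ζ + (c * ζ) • (expU Ω ζ * symAct Ω S * (expU Ω ζ)ᵀ) := by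
  have expU_transpose_mul : (expU Ω ζ)ᵀ * Bᵀ = (Bᵀ + (c * ζ) • Ωᵀ) * (expU Ω ζ)ᵀ := by
    rw [← Matrix.transpose_mul, mul_expU ζ hΩ, Matrix.transpose_mul, Matrix.transpose_add,
      Matrix.transpose_smul]
  calc symAct B (bigS' S Ω ζ)
      = B * expU Ω ζ * S * (expU Ω ζ)ᵀ + expU Ω ζ * S * ((expU Ω ζ)ᵀ * Bᵀ) := by
        simp only [symAct, bigS', mul_assoc]
    _ = expU Ω ζ * (symAct B S + (c * ζ) • symAct Ω S) * (expU Ω ζ)ᵀ := by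
        rw [mul_expU ζ hΩ, expU_transpose_mul, symAct, symAct, smul_add, ← Matrix.smul_mul,
          ← Matrix.mul_smul, ← Matrix.transpose_smul]
        noncomm_ring
    _ = _ := by
        rw [hS, mul_add, add_mul, Matrix.mul_smul, Matrix.smul_mul, Matrix.mul_smul,
          Matrix.smul_mul, bigS']

lemma smul_bigS'_eq (hS : symAct B S = (a + c) • S) (hΩ : ⁅B, Ω⁆ = c • Ω) :
    (c * ζ) • bigS' S Ω ζ = symAct B (bigS S Ω ζ) - a • bigS S Ω ζ := by
  have eq_at_zero := HasDerivM.eq_of_deriv_eq_zero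
    (F := fun s => (c * s) • bigS' S Ω s - (symAct B (bigS S Ω s) - a • bigS S Ω s)) (fun ζ => by
      have deriv_bigS := hasDerivM_bigS Ω ζ S
      refine ((HasDerivM.smul ((hasDerivAt_id ζ).const_mul c) (hasDerivM_bigS' Ω ζ S)).sub
        (((deriv_bigS.const_mul B).add (deriv_bigS.mul_const Bᵀ)).sub
          (deriv_bigS.const_smul a))).congr_deriv ?_
      rw [← symAct, symAct_bigS' ζ hS hΩ, mul_one, id]
      module) ζ
  rw [mul_zero, zero_smul, bigS_zero, show symAct B 0 = 0 by simp [symAct], smul_zero, sub_zero,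
    sub_zero] at eq_at_zero
  exact sub_eq_zero.1 eq_at_zero

end BigS

/-! ### Conjugate linear equations -/

section ConjugateEquations

lemma mul_inv_one_sub_mul {m n R : Type*} [Fintype m] [DecidableEq m] [Fintype n] [DecidableEq n]
    [CommRing R] (X : Matrix m n R) (Y : Matrix n m R) :
    X * (1 - Y * X)⁻¹ = (1 - X * Y)⁻¹ * X := by
  by_cases hXY : IsUnit (1 - X * Y).det
  · have hYX : IsUnit (1 - Y * X).det := by rwa [Matrix.det_one_sub_mul_comm]
    have swap : (1 - X * Y) * X = X * (1 - Y * X) := by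
      rw [Matrix.sub_mul, Matrix.mul_sub, Matrix.one_mul, Matrix.mul_one, Matrix.mul_assoc]
    calc X * (1 - Y * X)⁻¹ = (1 - X * Y)⁻¹ * ((1 - X * Y) * X) * (1 - Y * X)⁻¹ := by
          rw [← Matrix.mul_assoc, Matrix.nonsing_inv_mul _ hXY, Matrix.one_mul]
      _ = (1 - X * Y)⁻¹ * X := by
          rw [swap, Matrix.mul_assoc, Matrix.mul_assoc, Matrix.mul_nonsing_inv _ hYX,
            Matrix.mul_one]
  · have hYX : ¬ IsUnit (1 - Y * X).det := by rwa [Matrix.det_one_sub_mul_comm]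
    rw [Matrix.nonsing_inv_apply_not_isUnit _ hXY, Matrix.nonsing_inv_apply_not_isUnit _ hYX,
      Matrix.mul_zero, Matrix.zero_mul]

lemma star_mulVec_eq_conjM_mulVec (A : M2) (v : Fin 2 → ℂ) :
    star (A *ᵥ v) = conjM A *ᵥ star v := by
  rw [Matrix.star_mulVec, ← Matrix.mulVec_transpose, Matrix.conjTranspose,
    Matrix.transpose_map, Matrix.transpose_transpose]
  rfl

lemma star_dotProduct_eq (v w : Fin 2 → ℂ) : star (v ⬝ᵥ w) = star v ⬝ᵥ star w := by
  rw [Matrix.star_dotProduct_star, dotProduct_comm]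

lemma dotProduct_mulVec_of_transpose_eq {n R : Type*} [Fintype n] [CommSemiring R]
    {A : Matrix n n R} (hA : Aᵀ = A) (v w : n → R) : v ⬝ᵥ (A *ᵥ w) = (A *ᵥ v) ⬝ᵥ w := by
  rw [Matrix.dotProduct_mulVec, ← Matrix.mulVec_transpose, hA]

variable {A : M2}

lemma eq_inv_mulVec_of_eq_add_mulVec_star (hA : (1 - A * conjM A).det ≠ 0)
    {q q' v v' : Fin 2 → ℂ} (hv : v = q + A *ᵥ star v') (hv' : v' = q' + A *ᵥ star v) :
    v = (1 - A * conjM A)⁻¹ *ᵥ (q + A *ᵥ star q') := by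
  have mulVec_star_v' : A *ᵥ star v' = A *ᵥ star q' + (A * conjM A) *ᵥ v := by
    rw [hv', star_add, star_mulVec_eq_conjM_mulVec, star_star, Matrix.mulVec_add,
      Matrix.mulVec_mulVec]
  have eliminate : (1 - A * conjM A) *ᵥ v = q + A *ᵥ star q' := by
    rw [Matrix.sub_mulVec, Matrix.one_mulVec, sub_eq_iff_eq_add, add_assoc, ← mulVec_star_v']
    exact hv
  rw [← eliminate, Matrix.mulVec_mulVec, Matrix.nonsing_inv_mul _ (isUnit_iff_ne_zero.2 hA),
    Matrix.one_mulVec]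

lemma inv_mulVec_eq_add_mulVec_star (hA : (1 - A * conjM A).det ≠ 0) (q : Fin 2 → ℂ) :
    (1 - A * conjM A)⁻¹ *ᵥ (q + A *ᵥ star q) =
      q + A *ᵥ star ((1 - A * conjM A)⁻¹ *ᵥ (q + A *ᵥ star q)) := by
  set W := (1 - A * conjM A)⁻¹
  have inv_mulVec : W *ᵥ ((1 - A * conjM A) *ᵥ q) = q := by
    rw [Matrix.mulVec_mulVec, Matrix.nonsing_inv_mul _ (isUnit_iff_ne_zero.2 hA),
      Matrix.one_mulVec]
  have mulVec_star : A *ᵥ star (W *ᵥ (q + A *ᵥ star q)) =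
      W *ᵥ (A *ᵥ (star q + conjM A *ᵥ q)) := by
    rw [star_mulVec_eq_conjM_mulVec, conjM_inv, conjM_sub, conjM_one, conjM_mul, conjM_conjM,
      star_add, star_mulVec_eq_conjM_mulVec, star_star, Matrix.mulVec_mulVec,
      mul_inv_one_sub_mul, ← Matrix.mulVec_mulVec]
  calc W *ᵥ (q + A *ᵥ star q)
      = W *ᵥ ((1 - A * conjM A) *ᵥ q) + W *ᵥ (A *ᵥ (star q + conjM A *ᵥ q)) := by
        rw [← Matrix.mulVec_add, Matrix.sub_mulVec, Matrix.one_mulVec, Matrix.mulVec_add A,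
          Matrix.mulVec_mulVec]
        congr 1
        abel
    _ = q + A *ᵥ star (W *ᵥ (q + A *ᵥ star q)) := by rw [inv_mulVec, mulVec_star]

end ConjugateEquations

/-! ### Directional derivatives of vectors and matrices -/

/-- The entrywise derivative of a vector-valued function. -/
def alongV (Z : C4 × C4) (F : C4 → Fin 2 → ℂ) (x : C4) : Fin 2 → ℂ :=
  fun i => along Z (fun y => F y i) x

section VectorsAndMatrices

variable {x : C4}

lemma alongV_congr {F G : C4 → Fin 2 → ℂ} (h : F =ᶠ[𝓝 x] G) (Z : C4 × C4) :
    alongV Z F x = alongV Z G x :=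
  funext fun i => along_congr (h.mono fun y hy => by rw [hy]) Z

section Vectors

variable {F G : C4 → Fin 2 → ℂ} (hF : ∀ i, DifferentiableAt ℝ (fun y => F y i) x)
  (hG : ∀ i, DifferentiableAt ℝ (fun y => G y i) x) (Z : C4 × C4)
include hF

lemma along_pi : along Z F x = alongV Z F x := by
  ext i
  simp only [along, alongV, fderiv_pi hF, ContinuousLinearMap.pi_apply, Pi.add_apply,
    Pi.sub_apply, Pi.smul_apply]

include hG

lemma alongV_add : alongV Z (fun y => F y + G y) x = alongV Z F x + alongV Z G x :=
  funext fun i => along_add (hF i) (hG i) Z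

lemma along_dotProduct :
    along Z (fun y => F y ⬝ᵥ G y) x = alongV Z F x ⬝ᵥ G x + F x ⬝ᵥ alongV Z G x := by
  simp only [dotProduct, alongV]
  rw [along_sum _ fun k _ => (hF k).fun_mul (hG k), ← Finset.sum_add_distrib]
  exact Finset.sum_congr rfl fun k _ => along_mul (hF k) (hG k) Z

end Vectors

lemma alongV_mulVec {M : C4 → M2} {G : C4 → Fin 2 → ℂ}
    (hM : ∀ i j, DifferentiableAt ℝ (fun y => M y i j) x)
    (hG : ∀ i, DifferentiableAt ℝ (fun y => G y i) x) (Z : C4 × C4) :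
    alongV Z (fun y => M y *ᵥ G y) x = alongM Z M x *ᵥ G x + M x *ᵥ alongV Z G x :=
  funext fun i => along_dotProduct (F := fun y => M y i) (hM i) hG Z

lemma alongM_const (Z : C4 × C4) (A : M2) : alongM Z (fun _ => A) x = 0 := by
  ext i j
  exact along_const Z (A i j) x

lemma along_conj {F : C4 → ℂ} (hF : DifferentiableAt ℝ F x) (Z : C4 × C4) :
    along Z (fun y => star (F y)) x = star (along Z.swap F x) := by
  have fderiv_conj : fderiv ℝ (fun y => star (F y)) x =
      (Complex.conjCLE : ℂ →L[ℝ] ℂ).comp (fderiv ℝ F x) :=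
    (Complex.conjCLE.hasFDerivAt.comp x hF.hasFDerivAt).fderiv
  simp only [along, fderiv_conj]
  simp only [ContinuousLinearMap.comp_apply, ContinuousLinearEquiv.coe_coe,
    Complex.conjCLE_apply, Complex.star_def, Prod.fst_swap, Prod.snd_swap, smul_eq_mul, map_add,
    map_sub, map_mul, map_div₀, map_one, map_ofNat, Complex.conj_I]
  ring

lemma alongV_star {F : C4 → Fin 2 → ℂ} (hF : ∀ i, DifferentiableAt ℝ (fun y => F y i) x)
    (Z : C4 × C4) : alongV Z (fun y => star (F y)) x = star (alongV Z.swap F x) :=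
  funext fun i => along_conj (hF i) Z

lemma alongM_conjM {F : C4 → M2} (hF : ∀ i j, DifferentiableAt ℝ (fun y => F y i j) x)
    (Z : C4 × C4) : alongM Z (fun y => conjM (F y)) x = conjM (alongM Z.swap F x) := by
  ext i j
  exact along_conj (hF i j) Z

lemma along_prodMk {V W : Type*} [NormedAddCommGroup V] [NormedSpace ℂ V]
    [NormedAddCommGroup W] [NormedSpace ℂ W] {F : C4 → V} {G : C4 → W}
    (hF : DifferentiableAt ℝ F x) (hG : DifferentiableAt ℝ G x) (Z : C4 × C4) :
    along Z (fun y => (F y, G y)) x = (along Z F x, along Z G x) := by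
  simp only [along, (hF.hasFDerivAt.prodMk hG.hasFDerivAt).fderiv]
  rfl

lemma along_of_hasFDerivAt_complex {F : C4 → ℂ} {F' : C4 →L[ℂ] ℂ} (hF : HasFDerivAt F F' x)
    (Z : C4 × C4) : along Z F x = F' Z.1 := by
  rw [along_eq_of_hasFDerivAt (hF.restrictScalars ℝ) (fun v => F' v) (fun _ => 0)
    (fun _ => (add_zero _).symm) (map_smul F' _) (fun _ => (smul_zero _).symm), add_zero]

lemma along_comp_zeta {h : ℂ → ℂ} {h' : ℂ} (hh : HasDerivAt h h' x.2.2) (Z : C4 × C4) :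
    along Z (fun y => h y.2.2) x = Z.1.2.2 * h' := by
  have hasFDerivAt_zeta : HasFDerivAt (fun y : C4 => y.2.2) _ x :=
    ((ContinuousLinearMap.snd ℂ (Fin 2 → ℂ) ℂ).comp
      (ContinuousLinearMap.snd ℂ ℂ ((Fin 2 → ℂ) × ℂ))).hasFDerivAt
  exact (along_of_hasFDerivAt_complex (hh.comp_hasFDerivAt x hasFDerivAt_zeta) Z).trans
    (mul_comm _ _)

lemma alongM_comp_zeta {M : ℂ → M2} {M' : M2} (hM : HasDerivM M M' x.2.2) (Z : C4 × C4) :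
    alongM Z (fun y => M y.2.2) x = Z.1.2.2 • M' := by
  ext i j
  exact along_comp_zeta (hM i j) Z

lemma along_w (Z : C4 × C4) : along Z (fun y => y.1) x = Z.1.1 :=
  along_of_hasFDerivAt_complex (ContinuousLinearMap.fst ℂ ℂ ((Fin 2 → ℂ) × ℂ)).hasFDerivAt Z

lemma alongV_z (Z : C4 × C4) : alongV Z (fun y => y.2.1) x = Z.1.2.1 :=
  funext fun i => along_of_hasFDerivAt_complex
    ((ContinuousLinearMap.proj (R := ℂ) (φ := fun _ : Fin 2 => ℂ) i).comp
      ((ContinuousLinearMap.fst ℂ (Fin 2 → ℂ) ℂ).comp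
        (ContinuousLinearMap.snd ℂ ℂ ((Fin 2 → ℂ) × ℂ)))).hasFDerivAt Z

variable {n : WithTop ℕ∞}

lemma contDiffAt_comp_zeta {M M' : ℂ → M2} (hM : ∀ ζ, HasDerivM M (M' ζ) ζ) (i j : Fin 2) :
    ContDiffAt ℝ n (fun y : C4 => M y.2.2 i j) x := by
  have differentiable_M : Differentiable ℂ fun ζ => M ζ i j := fun ζ =>
    (hM ζ i j).differentiableAt
  have contDiff_M : ContDiff ℝ n fun ζ => M ζ i j :=
    (differentiable_M.contDiff (n := n)).restrict_scalars ℝ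
  exact (contDiff_M.comp (contDiff_snd.comp contDiff_snd)).contDiffAt

lemma contDiffAt_z (i : Fin 2) : ContDiffAt ℝ n (fun y : C4 => y.2.1 i) x :=
  (contDiff_pi.1 (contDiff_fst.comp contDiff_snd) i).contDiffAt

lemma contDiffAt_dotProduct {F G : C4 → Fin 2 → ℂ} (hF : ∀ i, ContDiffAt ℝ n (fun y => F y i) x)
    (hG : ∀ i, ContDiffAt ℝ n (fun y => G y i) x) : ContDiffAt ℝ n (fun y => F y ⬝ᵥ G y) x := by
  simp only [dotProduct]
  exact ContDiffAt.sum fun k _ => (hF k).mul (hG k)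

lemma contDiffAt_mulVec {M : C4 → M2} {G : C4 → Fin 2 → ℂ}
    (hM : ∀ i j, ContDiffAt ℝ n (fun y => M y i j) x)
    (hG : ∀ i, ContDiffAt ℝ n (fun y => G y i) x) (i : Fin 2) :
    ContDiffAt ℝ n (fun y => (M y *ᵥ G y) i) x :=
  contDiffAt_dotProduct (F := fun y => M y i) (hM i) hG

end VectorsAndMatrices

/-! ### The implicit form of the defining function -/

/-- The matrix `A = 𝐒(ζ) H`. -/
def matA (H S Ω : M2) (ζ : ℂ) : M2 := bigS S Ω ζ * H

/-- The matrix `P = (1 - A conj(A))⁻¹`. -/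
def matP (H S Ω : M2) (ζ : ℂ) : M2 := (1 - matA H S Ω ζ * conjM (matA H S Ω ζ))⁻¹

/-- The points where the coefficients of the model are defined. -/
def IsRegular (H S Ω : M2) (x : C4) : Prop :=
  (1 - matA H S Ω x.2.2 * conjM (matA H S Ω x.2.2)).det ≠ 0

/-- The solution `u` of the implicit equation `u = z + 𝐒(ζ) H conj(u)`. -/
def implicitU (H S Ω : M2) (x : C4) : Fin 2 → ℂ :=
  matP H S Ω x.2.2 *ᵥ (x.2.1 + matA H S Ω x.2.2 *ᵥ star x.2.1)

/-- The vector `y = H conj(u)`, in terms of which the model is `Re w = Re (zᵀ y)`. -/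
def implicitY (H S Ω : M2) (x : C4) : Fin 2 → ℂ := H *ᵥ star (implicitU H S Ω x)

/-- The coefficient of `conj(dz)` in the derivative of `y`. -/
def matK (H S Ω : M2) (ζ : ℂ) : M2 := H * conjM (matP H S Ω ζ)

/-- The coefficient of `dz` in the derivative of `y`. -/
def matL (H S Ω : M2) (ζ : ℂ) : M2 := matK H S Ω ζ * conjM (matA H S Ω ζ)

/-- The value on `v` of the form `q = dz + 𝐒'(ζ) y dζ`, through which the derivative of `u`
factors. -/
def implicitQ (H S Ω : M2) (x v : C4) : Fin 2 → ℂ :=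
  v.2.1 + v.2.2 • (bigS' S Ω x.2.2 *ᵥ implicitY H S Ω x)

/-- The complex linear form `2 yᵀ dz + yᵀ 𝐒'(ζ) y dζ - dw`, whose kernel is `ℋ`. -/
def crForm (H S Ω : M2) (x v : C4) : ℂ :=
  2 * (implicitY H S Ω x ⬝ᵥ v.2.1)
    + v.2.2 * (implicitY H S Ω x ⬝ᵥ (bigS' S Ω x.2.2 *ᵥ implicitY H S Ω x)) - v.1

section Implicit

variable {H S Ω : M2} {x : C4} {n : WithTop ℕ∞}

lemma matA_zero : matA H S Ω 0 = 0 := by rw [matA, bigS_zero, zero_mul]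

lemma matP_zero : matP H S Ω 0 = 1 := by
  rw [matP, matA_zero, zero_mul, sub_zero, inv_one]

lemma isRegular_of_zeta_eq_zero (hx : x.2.2 = 0) : IsRegular H S Ω x := by
  simp [IsRegular, hx, matA_zero]

lemma conjM_matP (ζ : ℂ) :
    conjM (matP H S Ω ζ) = (1 - conjM (matA H S Ω ζ) * matA H S Ω ζ)⁻¹ := by
  rw [matP, conjM_inv, conjM_sub, conjM_one, conjM_mul, conjM_conjM]

lemma hasDerivM_matA (ζ : ℂ) : HasDerivM (matA H S Ω) (bigS' S Ω ζ * H) ζ :=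
  (hasDerivM_bigS Ω ζ S).mul_const H

lemma contDiffAt_matA (i j : Fin 2) :
    ContDiffAt ℝ n (fun y : C4 => matA H S Ω y.2.2 i j) x :=
  contDiffAt_comp_zeta hasDerivM_matA i j

lemma contDiffAt_one_sub_matA_mul (i j : Fin 2) :
    ContDiffAt ℝ n (fun y : C4 => (1 - matA H S Ω y.2.2 * conjM (matA H S Ω y.2.2)) i j) x :=
  contDiffAt_const.sub
    (contDiffAt_mul_entries contDiffAt_matA (fun i j => contDiffAt_conj (contDiffAt_matA i j)) i j)

lemma IsRegular.eventually (hx : IsRegular H S Ω x) : ∀ᶠ y in 𝓝 x, IsRegular H S Ω y :=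
  (contDiffAt_det_entries (n := 0) contDiffAt_one_sub_matA_mul).continuousAt.eventually_ne hx

lemma contDiffAt_matP (hx : IsRegular H S Ω x) (i j : Fin 2) :
    ContDiffAt ℝ n (fun y : C4 => matP H S Ω y.2.2 i j) x :=
  contDiffAt_inv_entries contDiffAt_one_sub_matA_mul hx i j

lemma contDiffAt_implicitU (hx : IsRegular H S Ω x) (i : Fin 2) :
    ContDiffAt ℝ n (fun y : C4 => implicitU H S Ω y i) x :=
  contDiffAt_mulVec (contDiffAt_matP hx) (fun i => (contDiffAt_z i).add
    (contDiffAt_mulVec contDiffAt_matA (fun i => contDiffAt_conj (contDiffAt_z i)) i)) i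

lemma contDiffAt_implicitY (hx : IsRegular H S Ω x) (i : Fin 2) :
    ContDiffAt ℝ n (fun y : C4 => implicitY H S Ω y i) x :=
  contDiffAt_mulVec (M := fun _ => H) (fun _ _ => contDiffAt_const)
    (fun i => contDiffAt_conj (contDiffAt_implicitU hx i)) i

lemma implicitU_eq (hx : IsRegular H S Ω x) :
    implicitU H S Ω x = x.2.1 + matA H S Ω x.2.2 *ᵥ star (implicitU H S Ω x) :=
  inv_mulVec_eq_add_mulVec_star hx x.2.1

lemma z_eq_implicitU_sub (hx : IsRegular H S Ω x) :
    x.2.1 = implicitU H S Ω x - bigS S Ω x.2.2 *ᵥ implicitY H S Ω x := by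
  rw [implicitY, Matrix.mulVec_mulVec, eq_sub_iff_add_eq]
  exact (implicitU_eq hx).symm

lemma star_implicitU (x : C4) : star (implicitU H S Ω x) =
    conjM (matP H S Ω x.2.2) *ᵥ (star x.2.1 + conjM (matA H S Ω x.2.2) *ᵥ x.2.1) := by
  rw [implicitU, star_mulVec_eq_conjM_mulVec, star_add, star_mulVec_eq_conjM_mulVec, star_star]

lemma implicitY_eq (x : C4) : implicitY H S Ω x =
    matK H S Ω x.2.2 *ᵥ star x.2.1 + matL H S Ω x.2.2 *ᵥ x.2.1 := by
  rw [implicitY, star_implicitU, Matrix.mulVec_mulVec, Matrix.mulVec_add, Matrix.mulVec_mulVec]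
  rfl

lemma implicitY_zero : implicitY H S Ω 0 = 0 := by
  simp [implicitY_eq]

namespace IsModelData

lemma conjM_matA (h : IsModelData H S) (ζ : ℂ) :
    conjM (matA H S Ω ζ) = conjM (bigS S Ω ζ) * H := by
  rw [matA, conjM_mul, h.conj_H]

lemma coeffH_eq (h : IsModelData H S) (ζ : ℂ) : coeffH H (bigS S Ω ζ) = matK H S Ω ζ := by
  have conjM_matA_mul_matA : conjM (bigS S Ω ζ) * H * bigS S Ω ζ * H =
      conjM (matA H S Ω ζ) * matA H S Ω ζ := by
    rw [h.conjM_matA, matA, mul_assoc _ (bigS S Ω ζ)]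
  have push_through : (1 - H * conjM (bigS S Ω ζ) * H * bigS S Ω ζ)⁻¹ * H =
      H * (1 - conjM (matA H S Ω ζ) * matA H S Ω ζ)⁻¹ := by
    rw [← conjM_matA_mul_matA, mul_inv_one_sub_mul]
    simp only [mul_assoc]
  rw [coeffH, h.transpose_H, conjM_matA_mul_matA, push_through, matK, conjM_matP]
  module

lemma coeffS_eq (h : IsModelData H S) (ζ : ℂ) :
    coeffS H (bigS S Ω ζ) = H * matP H S Ω ζ * matA H S Ω ζ := by
  rw [coeffS, h.transpose_H, matP, h.conjM_matA, matA]
  simp only [mul_assoc]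

lemma model_eq (h : IsModelData H S) :
    model H S Ω = fun x => (x.2.1 ⬝ᵥ implicitY H S Ω x - x.1).re := by
  ext x
  have star_coeffS : star (star x.2.1 ⬝ᵥ (coeffS H (bigS S Ω x.2.2) *ᵥ star x.2.1)) =
      x.2.1 ⬝ᵥ (matL H S Ω x.2.2 *ᵥ x.2.1) := by
    rw [h.coeffS_eq, star_dotProduct_eq, star_mulVec_eq_conjM_mulVec, star_star, conjM_mul,
      conjM_mul, h.conj_H]
    rfl
  have re_coeffS : (star x.2.1 ⬝ᵥ (coeffS H (bigS S Ω x.2.2) *ᵥ star x.2.1)).re =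
      (x.2.1 ⬝ᵥ (matL H S Ω x.2.2 *ᵥ x.2.1)).re := by
    rw [← star_coeffS, Complex.star_def, Complex.conj_re]
  rw [model, re_coeffS, h.coeffH_eq, implicitY_eq, dotProduct_add, Complex.sub_re, Complex.add_re]

lemma analyticAt_model (h : IsModelData H S) (hx : IsRegular H S Ω x) :
    AnalyticAt ℝ (model H S Ω) x := by
  rw [h.model_eq, ← analyticWithinAt_univ, ← contDiffWithinAt_omega_iff_analyticWithinAt,
    contDiffWithinAt_univ]
  exact Complex.reCLM.contDiff.contDiffAt.comp x
    ((contDiffAt_dotProduct contDiffAt_z (contDiffAt_implicitY hx)).sub contDiffAt_fst)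

end IsModelData

lemma differentiableAt_z (i : Fin 2) : DifferentiableAt ℝ (fun y : C4 => y.2.1 i) x :=
  (contDiffAt_z (n := 1) i).differentiableAt one_ne_zero

lemma differentiableAt_implicitU (hx : IsRegular H S Ω x) (i : Fin 2) :
    DifferentiableAt ℝ (fun y : C4 => implicitU H S Ω y i) x :=
  (contDiffAt_implicitU (n := 1) hx i).differentiableAt one_ne_zero

lemma differentiableAt_star_implicitU (hx : IsRegular H S Ω x) (i : Fin 2) :
    DifferentiableAt ℝ (fun y : C4 => star (implicitU H S Ω y) i) x :=
  (contDiffAt_conj (contDiffAt_implicitU (n := 1) hx i)).differentiableAt one_ne_zero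

lemma differentiableAt_implicitY (hx : IsRegular H S Ω x) (i : Fin 2) :
    DifferentiableAt ℝ (fun y : C4 => implicitY H S Ω y i) x :=
  (contDiffAt_implicitY (n := 1) hx i).differentiableAt one_ne_zero

lemma alongV_implicitU_eq (hx : IsRegular H S Ω x) (Z : C4 × C4) :
    alongV Z (implicitU H S Ω) x =
      implicitQ H S Ω x Z.1 + matA H S Ω x.2.2 *ᵥ star (alongV Z.swap (implicitU H S Ω) x) := by
  have differentiableAt_matA (i j : Fin 2) :
      DifferentiableAt ℝ (fun y : C4 => matA H S Ω y.2.2 i j) x :=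
    (contDiffAt_matA (n := 1) i j).differentiableAt one_ne_zero
  have differentiableAt_matA_mulVec (i : Fin 2) :
      DifferentiableAt ℝ (fun y : C4 => (matA H S Ω y.2.2 *ᵥ star (implicitU H S Ω y)) i) x :=
    (contDiffAt_mulVec (n := 1) contDiffAt_matA
      (fun i => contDiffAt_conj (contDiffAt_implicitU hx i)) i).differentiableAt one_ne_zero
  rw [alongV_congr (hx.eventually.mono fun y hy => implicitU_eq hy) Z,
    alongV_add differentiableAt_z differentiableAt_matA_mulVec, alongV_z,
    alongV_mulVec differentiableAt_matA (differentiableAt_star_implicitU hx),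
    alongV_star (differentiableAt_implicitU hx), alongM_comp_zeta (hasDerivM_matA x.2.2),
    Matrix.smul_mulVec, ← add_assoc, implicitQ, implicitY, Matrix.mulVec_mulVec]

lemma alongV_implicitU (hx : IsRegular H S Ω x) (Z : C4 × C4) :
    alongV Z (implicitU H S Ω) x = matP H S Ω x.2.2 *ᵥ (implicitQ H S Ω x Z.1
      + matA H S Ω x.2.2 *ᵥ star (implicitQ H S Ω x Z.2)) :=
  eq_inv_mulVec_of_eq_add_mulVec_star hx (alongV_implicitU_eq hx Z)
    (alongV_implicitU_eq hx Z.swap)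

lemma alongV_implicitY_eq (hx : IsRegular H S Ω x) (Z : C4 × C4) :
    alongV Z (implicitY H S Ω) x = H *ᵥ star (alongV Z.swap (implicitU H S Ω) x) := by
  have leibniz := alongV_mulVec (M := fun _ => H) (fun i j => differentiableAt_const _)
    (differentiableAt_star_implicitU hx) Z
  rwa [alongM_const, Matrix.zero_mulVec, zero_add,
    alongV_star (differentiableAt_implicitU hx)] at leibniz

lemma alongV_implicitY (hx : IsRegular H S Ω x) (Z : C4 × C4) :
    alongV Z (implicitY H S Ω) x = matL H S Ω x.2.2 *ᵥ implicitQ H S Ω x Z.1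
      + matK H S Ω x.2.2 *ᵥ star (implicitQ H S Ω x Z.2) := by
  rw [alongV_implicitY_eq hx, alongV_implicitU hx, star_mulVec_eq_conjM_mulVec, star_add,
    star_mulVec_eq_conjM_mulVec, star_star, Matrix.mulVec_mulVec, Matrix.mulVec_add,
    Matrix.mulVec_mulVec, add_comm]
  rfl

lemma crForm_smul (x v : C4) (c : ℂ) : crForm H S Ω x (c • v) = c * crForm H S Ω x v := by
  simp only [crForm, Prod.smul_fst, Prod.smul_snd, dotProduct_smul, smul_eq_mul]
  ring

namespace IsModelData

/-- Exchanges `u` and `y` in the derivative of `Re (zᵀ y)`, using that `𝐒(ζ)` is symmetric. -/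
lemma dotProduct_alongV_implicitY (h : IsModelData H S) (hx : IsRegular H S Ω x) (v : C4) :
    x.2.1 ⬝ᵥ alongV (v, v) (implicitY H S Ω) x =
      implicitU H S Ω x ⬝ᵥ alongV (v, v) (implicitY H S Ω) x
        - implicitY H S Ω x ⬝ᵥ alongV (v, v) (implicitU H S Ω) x
        + implicitY H S Ω x ⬝ᵥ implicitQ H S Ω x v := by
  have bigS_mulVec_dy : bigS S Ω x.2.2 *ᵥ alongV (v, v) (implicitY H S Ω) x =
      alongV (v, v) (implicitU H S Ω) x - implicitQ H S Ω x v := by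
    rw [eq_sub_iff_add_eq', alongV_implicitY_eq hx, Matrix.mulVec_mulVec]
    exact (alongV_implicitU_eq hx (v, v)).symm
  conv_lhs => rw [z_eq_implicitU_sub hx, sub_dotProduct,
    ← dotProduct_mulVec_of_transpose_eq (bigS_transpose Ω x.2.2 h.transpose_S), bigS_mulVec_dy]
  rw [dotProduct_sub, sub_sub_eq_add_sub, sub_add_eq_add_sub]

lemma re_dotProduct_alongV_implicitY (h : IsModelData H S) (hx : IsRegular H S Ω x) (v : C4) :
    (implicitU H S Ω x ⬝ᵥ alongV (v, v) (implicitY H S Ω) x).re =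
      (implicitY H S Ω x ⬝ᵥ alongV (v, v) (implicitU H S Ω) x).re := by
  rw [← Complex.conj_re, ← Complex.star_def, star_dotProduct_eq, alongV_implicitY_eq hx,
    star_mulVec_eq_conjM_mulVec, star_star, h.conj_H,
    dotProduct_mulVec_of_transpose_eq h.transpose_H]
  rfl

lemma fderiv_model (h : IsModelData H S) (hx : IsRegular H S Ω x) (v : C4) :
    fderiv ℝ (model H S Ω) x v = (crForm H S Ω x v).re := by
  have differentiableAt_zy : DifferentiableAt ℝ (fun y : C4 => y.2.1 ⬝ᵥ implicitY H S Ω y) x :=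
    (contDiffAt_dotProduct (n := 1) contDiffAt_z
      (contDiffAt_implicitY hx)).differentiableAt one_ne_zero
  have fderiv_re : fderiv ℝ (model H S Ω) x v =
      (along (v, v) (fun y : C4 => y.2.1 ⬝ᵥ implicitY H S Ω y - y.1) x).re := by
    rw [along_real, h.model_eq]
    exact congrArg (· v) (Complex.reCLM.hasFDerivAt.comp x
      (differentiableAt_zy.sub differentiableAt_fst).hasFDerivAt).fderiv
  rw [fderiv_re, along_sub differentiableAt_zy differentiableAt_fst, along_w,
    along_dotProduct differentiableAt_z (differentiableAt_implicitY hx), alongV_z,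
    h.dotProduct_alongV_implicitY hx, crForm, implicitQ]
  simp only [Complex.add_re, Complex.sub_re, h.re_dotProduct_alongV_implicitY hx, dotProduct_add,
    dotProduct_smul, smul_eq_mul, dotProduct_comm v.2.1, Complex.mul_re, Complex.re_ofNat,
    Complex.im_ofNat]
  ring

lemma mem_holTangent_iff (h : IsModelData H S) (hx : IsRegular H S Ω x) (v : C4) :
    v ∈ holTangent (model H S Ω) x ↔ crForm H S Ω x v = 0 := by
  change fderiv ℝ (model H S Ω) x v = 0 ∧ fderiv ℝ (model H S Ω) x (Complex.I • v) = 0 ↔ _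
  rw [h.fderiv_model hx, h.fderiv_model hx, crForm_smul, Complex.I_mul_re, neg_eq_zero,
    Complex.ext_iff, Complex.zero_re, Complex.zero_im]

end IsModelData

end Implicit

/-! ### An adapted frame of the model -/

/-- The sections `2 (yᵀ exp(ζ Ω) b) ∂/∂w + (exp(ζ Ω) b)ᵀ ∂/∂z` of `ℋ`, spanning a complement of
the Levi kernel. -/
def frameF (H S Ω : M2) (b : Fin 2 → ℂ) (x : C4) : C4 :=
  (2 * (implicitY H S Ω x ⬝ᵥ (expU Ω x.2.2 *ᵥ b)), expU Ω x.2.2 *ᵥ b, 0)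

/-- The section of the Levi kernel with `∂/∂ζ`-component `1`. -/
def frameE (H S Ω : M2) (x : C4) : C4 :=
  (-(implicitY H S Ω x ⬝ᵥ (bigS' S Ω x.2.2 *ᵥ implicitY H S Ω x)),
    -(bigS' S Ω x.2.2 *ᵥ implicitY H S Ω x), 1)

/-- The matrix of the Levi form of the model in the frame given by `frameF`. -/
def frameLevi (H S Ω : M2) (x : C4) : M2 :=
  (expU Ω x.2.2)ᵀ * matK H S Ω x.2.2 * conjM (expU Ω x.2.2)

/-- The matrix of the brackets `[e, f]` of the frame given by `frameE` and `frameF`. -/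
def frameOm (H S Ω : M2) (x : C4) : M2 :=
  Ω + S * ((expU Ω x.2.2)ᵀ * matL H S Ω x.2.2 * expU Ω x.2.2)

section Frame

variable {H S Ω : M2} {x : C4} {n : WithTop ℕ∞}

section Regularity

lemma contDiffAt_expU (i j : Fin 2) : ContDiffAt ℝ n (fun y : C4 => expU Ω y.2.2 i j) x :=
  contDiffAt_comp_zeta (hasDerivM_expU Ω) i j

lemma contDiffAt_bigS' (i j : Fin 2) : ContDiffAt ℝ n (fun y : C4 => bigS' S Ω y.2.2 i j) x :=
  contDiffAt_comp_zeta (fun ζ => hasDerivM_bigS' Ω ζ S) i j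

lemma contDiffAt_expU_mulVec (b : Fin 2 → ℂ) (i : Fin 2) :
    ContDiffAt ℝ n (fun y : C4 => (expU Ω y.2.2 *ᵥ b) i) x :=
  contDiffAt_mulVec (G := fun _ => b) contDiffAt_expU (fun _ => contDiffAt_const) i

variable (hx : IsRegular H S Ω x)
include hx

lemma contDiffAt_bigS'_mulVec (i : Fin 2) :
    ContDiffAt ℝ n (fun y : C4 => (bigS' S Ω y.2.2 *ᵥ implicitY H S Ω y) i) x :=
  contDiffAt_mulVec contDiffAt_bigS' (contDiffAt_implicitY hx) i

lemma contDiffAt_frameF (b : Fin 2 → ℂ) : ContDiffAt ℝ n (frameF H S Ω b) x :=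
  (contDiffAt_const.mul (contDiffAt_dotProduct (contDiffAt_implicitY hx)
    (contDiffAt_expU_mulVec b))).prodMk
    ((contDiffAt_pi.2 (contDiffAt_expU_mulVec b)).prodMk contDiffAt_const)

lemma contDiffAt_frameE : ContDiffAt ℝ n (frameE H S Ω) x :=
  (contDiffAt_dotProduct (contDiffAt_implicitY hx) (contDiffAt_bigS'_mulVec hx)).neg.prodMk
    ((contDiffAt_pi.2 (contDiffAt_bigS'_mulVec hx)).neg.prodMk contDiffAt_const)

lemma contDiffAt_matK (i j : Fin 2) : ContDiffAt ℝ n (fun y : C4 => matK H S Ω y.2.2 i j) x :=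
  contDiffAt_mul_entries (F := fun _ => H) (fun _ _ => contDiffAt_const)
    (fun i j => contDiffAt_conj (contDiffAt_matP hx i j)) i j

lemma contDiffAt_matL (i j : Fin 2) : ContDiffAt ℝ n (fun y : C4 => matL H S Ω y.2.2 i j) x :=
  contDiffAt_mul_entries (contDiffAt_matK hx) (fun i j => contDiffAt_conj (contDiffAt_matA i j)) i j

lemma contDiffAt_frameLevi (i j : Fin 2) :
    ContDiffAt ℝ n (fun y : C4 => frameLevi H S Ω y i j) x :=
  contDiffAt_mul_entries
    (contDiffAt_mul_entries (F := fun y : C4 => (expU Ω y.2.2)ᵀ) (fun i j => contDiffAt_expU j i)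
      (contDiffAt_matK hx))
    (fun i j => contDiffAt_conj (contDiffAt_expU i j)) i j

lemma contDiffAt_frameOm (i j : Fin 2) : ContDiffAt ℝ n (fun y : C4 => frameOm H S Ω y i j) x :=
  contDiffAt_const.add (contDiffAt_mul_entries (F := fun _ => S) (fun _ _ => contDiffAt_const)
    (contDiffAt_mul_entries
      (contDiffAt_mul_entries (F := fun y : C4 => (expU Ω y.2.2)ᵀ)
        (fun i j => contDiffAt_expU j i) (contDiffAt_matL hx))
      contDiffAt_expU) i j)

end Regularity

lemma alongV_expU_mulVec (b : Fin 2 → ℂ) (Z : C4 × C4) :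
    alongV Z (fun y => expU Ω y.2.2 *ᵥ b) x = Z.1.2.2 • ((expU Ω x.2.2 * Ω) *ᵥ b) := by
  have alongV_const : alongV Z (fun _ => b) x = 0 := funext fun i => along_const Z (b i) x
  rw [alongV_mulVec (M := fun y : C4 => expU Ω y.2.2) (G := fun _ => b)
    (fun i j => (contDiffAt_expU (n := 1) i j).differentiableAt one_ne_zero)
    (fun i => differentiableAt_const _), alongV_const, Matrix.mulVec_zero,
    add_zero, alongM_comp_zeta (hasDerivM_expU Ω x.2.2), Matrix.smul_mulVec]

lemma along_frameF (hx : IsRegular H S Ω x) (b : Fin 2 → ℂ) (Z : C4 × C4) :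
    along Z (frameF H S Ω b) x =
      (2 * (alongV Z (implicitY H S Ω) x ⬝ᵥ (expU Ω x.2.2 *ᵥ b)
          + Z.1.2.2 * (implicitY H S Ω x ⬝ᵥ ((expU Ω x.2.2 * Ω) *ᵥ b))),
        Z.1.2.2 • ((expU Ω x.2.2 * Ω) *ᵥ b), 0) := by
  have differentiableAt_expU_mulVec (i : Fin 2) :
      DifferentiableAt ℝ (fun y : C4 => (expU Ω y.2.2 *ᵥ b) i) x :=
    (contDiffAt_expU_mulVec (n := 1) b i).differentiableAt one_ne_zero
  have differentiableAt_z_part := differentiableAt_pi.2 differentiableAt_expU_mulVec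
  have differentiableAt_w_part :
      DifferentiableAt ℝ (fun y : C4 => implicitY H S Ω y ⬝ᵥ (expU Ω y.2.2 *ᵥ b)) x :=
    (contDiffAt_dotProduct (n := 1) (contDiffAt_implicitY hx)
      (contDiffAt_expU_mulVec b)).differentiableAt one_ne_zero
  unfold frameF
  rw [along_prodMk ((differentiableAt_const _).fun_mul differentiableAt_w_part)
      (differentiableAt_z_part.prodMk (differentiableAt_const _)),
    along_prodMk differentiableAt_z_part (differentiableAt_const _),
    along_mul (differentiableAt_const _) differentiableAt_w_part, along_const, along_const,
    along_pi differentiableAt_expU_mulVec,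
    along_dotProduct (differentiableAt_implicitY hx) differentiableAt_expU_mulVec,
    alongV_expU_mulVec, dotProduct_smul, zero_mul, zero_add, smul_eq_mul]

lemma along_frameE (hS : Sᵀ = S) (hx : IsRegular H S Ω x) {Z : C4 × C4} (hZ : Z.1.2.2 = 0) :
    along Z (frameE H S Ω) x =
      (-(2 * (implicitY H S Ω x ⬝ᵥ (bigS' S Ω x.2.2 *ᵥ alongV Z (implicitY H S Ω) x))),
        -(bigS' S Ω x.2.2 *ᵥ alongV Z (implicitY H S Ω) x), 0) := by
  have differentiableAt_bigS'_mulVec (i : Fin 2) :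
      DifferentiableAt ℝ (fun y : C4 => (bigS' S Ω y.2.2 *ᵥ implicitY H S Ω y) i) x :=
    (contDiffAt_bigS'_mulVec (n := 1) hx i).differentiableAt one_ne_zero
  have differentiableAt_z_part := differentiableAt_pi.2 differentiableAt_bigS'_mulVec
  have differentiableAt_w_part : DifferentiableAt ℝ
      (fun y : C4 => implicitY H S Ω y ⬝ᵥ (bigS' S Ω y.2.2 *ᵥ implicitY H S Ω y)) x :=
    (contDiffAt_dotProduct (n := 1) (contDiffAt_implicitY hx)
      (contDiffAt_bigS'_mulVec hx)).differentiableAt one_ne_zero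
  have alongV_bigS'_mulVec : alongV Z (fun y => bigS' S Ω y.2.2 *ᵥ implicitY H S Ω y) x =
      bigS' S Ω x.2.2 *ᵥ alongV Z (implicitY H S Ω) x := by
    rw [alongV_mulVec
        (fun i j => (contDiffAt_bigS' (n := 1) i j).differentiableAt one_ne_zero)
        (differentiableAt_implicitY hx),
      alongM_comp_zeta (hasDerivM_bigS' Ω x.2.2 S), hZ, zero_smul, Matrix.zero_mulVec, zero_add]
  unfold frameE
  rw [along_prodMk differentiableAt_w_part.fun_neg
      (differentiableAt_z_part.fun_neg.prodMk (differentiableAt_const _)),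
    along_prodMk differentiableAt_z_part.fun_neg (differentiableAt_const _), along_const,
    along_neg, along_neg, along_pi differentiableAt_bigS'_mulVec,
    along_dotProduct (differentiableAt_implicitY hx) differentiableAt_bigS'_mulVec,
    alongV_bigS'_mulVec, dotProduct_mulVec_of_transpose_eq (bigS'_transpose Ω x.2.2 hS)
      (alongV Z (implicitY H S Ω) x),
    dotProduct_comm _ (implicitY H S Ω x), two_mul]

section Linearity

lemma frameF_add (b b' : Fin 2 → ℂ) (x : C4) :
    frameF H S Ω (b + b') x = frameF H S Ω b x + frameF H S Ω b' x := by
  simp only [frameF, Matrix.mulVec_add, dotProduct_add, mul_add, Prod.mk_add_mk, add_zero]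

lemma frameF_smul (c : ℂ) (b : Fin 2 → ℂ) (x : C4) :
    frameF H S Ω (c • b) x = c • frameF H S Ω b x := by
  simp only [frameF, Matrix.mulVec_smul, dotProduct_smul, Prod.smul_mk, smul_eq_mul, mul_zero,
    mul_left_comm]

lemma sum_smul_frameF (c : Fin 2 → ℂ) (x : C4) :
    ∑ l, c l • frameF H S Ω (Pi.single l 1) x = frameF H S Ω c x := by
  simp only [Fin.sum_univ_two, ← frameF_smul, ← frameF_add]
  congr 1
  ext i
  fin_cases i <;> simp

lemma sum_col_smul_frameF (M : M2) (k : Fin 2) (x : C4) :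
    ∑ l, M l k • frameF H S Ω (Pi.single l 1) x = frameF H S Ω (M *ᵥ Pi.single k 1) x := by
  rw [← sum_smul_frameF, Matrix.mulVec_single_one]
  rfl

lemma linearIndependent_frame (x : C4) : LinearIndependent ℂ
    ![frameF H S Ω (Pi.single 0 1) x, frameF H S Ω (Pi.single 1 1) x, frameE H S Ω x] := by
  rw [Fintype.linearIndependent_iff]
  intro c hc
  have combination_eq_zero : frameF H S Ω ![c 0, c 1] x + c 2 • frameE H S Ω x = 0 := by
    rw [← sum_smul_frameF, Fin.sum_univ_two]
    rwa [Fin.sum_univ_three] at hc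
  have c_two : c 2 = 0 := by simpa [frameF, frameE] using congrArg (·.2.2) combination_eq_zero
  have mulVec_eq_zero : expU Ω x.2.2 *ᵥ ![c 0, c 1] = 0 := by
    simpa [frameF, c_two] using congrArg (·.2.1) combination_eq_zero
  have c_zero_one := Matrix.eq_zero_of_mulVec_eq_zero (det_expU_ne_zero Ω x.2.2) mulVec_eq_zero
  exact Fin.forall_fin_succ.2 ⟨congrFun c_zero_one 0,
    Fin.forall_fin_two.2 ⟨congrFun c_zero_one 1, c_two⟩⟩

end Linearity

section CRForms

lemma implicitQ_zero : implicitQ H S Ω x 0 = 0 := by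
  simp [implicitQ]

lemma implicitQ_frameE : implicitQ H S Ω x (frameE H S Ω x) = 0 := by
  simp [implicitQ, frameE]

lemma implicitQ_frameF (b : Fin 2 → ℂ) :
    implicitQ H S Ω x (frameF H S Ω b x) = expU Ω x.2.2 *ᵥ b := by
  simp [implicitQ, frameF]

lemma crForm_frameE : crForm H S Ω x (frameE H S Ω x) = 0 := by
  simp only [crForm, frameE, dotProduct_neg]
  ring

lemma crForm_frameF (b : Fin 2 → ℂ) : crForm H S Ω x (frameF H S Ω b x) = 0 := by
  simp [crForm, frameF]

lemma crForm_vertical (c : ℂ) : crForm H S Ω x (c, 0, 0) = -c := by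
  simp [crForm]

end CRForms

section Brackets

variable (hx : IsRegular H S Ω x)
include hx

lemma along_antihol_frameE_frameF (b : Fin 2 → ℂ) :
    along (0, frameE H S Ω x) (frameF H S Ω b) x = 0 := by
  rw [along_frameF hx, alongV_implicitY hx, implicitQ_frameE, implicitQ_zero]
  simp

lemma along_antihol_frameE_frameE (hS : Sᵀ = S) :
    along (0, frameE H S Ω x) (frameE H S Ω) x = 0 := by
  rw [along_frameE hS hx rfl, alongV_implicitY hx, implicitQ_frameE, implicitQ_zero]
  simp

lemma alongV_antihol_frameF_implicitY (b : Fin 2 → ℂ) :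
    alongV (0, frameF H S Ω b x) (implicitY H S Ω) x =
      (matK H S Ω x.2.2 * conjM (expU Ω x.2.2)) *ᵥ star b := by
  rw [alongV_implicitY hx, implicitQ_frameF, implicitQ_zero, star_mulVec_eq_conjM_mulVec,
    Matrix.mulVec_mulVec, Matrix.mulVec_zero, zero_add]

lemma along_antihol_frameF_frameF (a b : Fin 2 → ℂ) :
    along (0, frameF H S Ω b x) (frameF H S Ω a) x =
      (2 * (a ⬝ᵥ (frameLevi H S Ω x *ᵥ star b)), 0, 0) := by
  have levi_pairing : ((matK H S Ω x.2.2 * conjM (expU Ω x.2.2)) *ᵥ star b) ⬝ᵥ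
      (expU Ω x.2.2 *ᵥ a) = a ⬝ᵥ (frameLevi H S Ω x *ᵥ star b) := by
    rw [dotProduct_comm, ← Matrix.vecMul_transpose, ← Matrix.dotProduct_mulVec,
      Matrix.mulVec_mulVec, frameLevi, mul_assoc]
  rw [along_frameF hx, alongV_antihol_frameF_implicitY hx, levi_pairing]
  simp

lemma along_frameE_eq_neg_frameF (hS : Sᵀ = S) {Z : C4 × C4} (hZ : Z.1.2.2 = 0) :
    along Z (frameE H S Ω) x =
      -frameF H S Ω ((S * (expU Ω x.2.2)ᵀ) *ᵥ alongV Z (implicitY H S Ω) x) x := by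
  rw [along_frameE hS hx hZ, frameF, Matrix.mulVec_mulVec, bigS', mul_assoc, Prod.neg_mk,
    Prod.neg_mk, neg_zero]

lemma along_antihol_frameF_frameE (hS : Sᵀ = S) (b : Fin 2 → ℂ) :
    along (0, frameF H S Ω b x) (frameE H S Ω) x =
      -frameF H S Ω ((S * frameLevi H S Ω x) *ᵥ star b) x := by
  rw [along_frameE_eq_neg_frameF hx hS rfl, alongV_antihol_frameF_implicitY hx,
    Matrix.mulVec_mulVec, frameLevi]
  simp only [mul_assoc]

lemma along_hol_frameE_frameF_sub (hS : Sᵀ = S) (b : Fin 2 → ℂ) :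
    along (frameE H S Ω x, 0) (frameF H S Ω b) x - along (frameF H S Ω b x, 0) (frameE H S Ω) x =
      frameF H S Ω (frameOm H S Ω x *ᵥ b) x := by
  rw [along_frameE_eq_neg_frameF hx hS rfl, along_frameF hx, alongV_implicitY hx,
    alongV_implicitY hx, implicitQ_frameF, implicitQ_frameE, frameOm, Matrix.add_mulVec,
    frameF_add, sub_neg_eq_add, implicitQ_zero, star_zero, Matrix.mulVec_zero,
    Matrix.mulVec_zero, add_zero, add_zero, zero_dotProduct]
  simp only [frameF, frameE, one_mul, one_smul, zero_add, Matrix.mulVec_mulVec, mul_assoc]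

lemma bracket_frameE_frameF (hS : Sᵀ = S) (k : Fin 2) :
    bracket (hol (frameE H S Ω)) (antihol (frameF H S Ω (Pi.single k 1))) x =
      (∑ l, (S * frameLevi H S Ω x) l k • frameF H S Ω (Pi.single l 1) x, 0) := by
  ext1
  · rw [bracket_hol_antihol_fst, along_antihol_frameF_frameE hx hS, neg_neg, Pi.star_single,
      star_one, sum_col_smul_frameF]
  · rw [bracket_hol_antihol_snd, along_antihol_frameE_frameF hx]

lemma bracket_frameE_frameE (hS : Sᵀ = S) :
    bracket (hol (frameE H S Ω)) (antihol (frameE H S Ω)) x = 0 := by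
  ext1
  · rw [bracket_hol_antihol_fst, along_antihol_frameE_frameE hx hS, neg_zero, Prod.fst_zero]
  · rw [bracket_hol_antihol_snd, along_antihol_frameE_frameE hx hS, Prod.snd_zero]

lemma bracket_hol_frameE_frameF (hS : Sᵀ = S) (k : Fin 2) :
    bracket (hol (frameE H S Ω)) (hol (frameF H S Ω (Pi.single k 1))) x =
      (∑ l, frameOm H S Ω x l k • frameF H S Ω (Pi.single l 1) x, 0) := by
  ext1
  · rw [bracket_hol_hol_fst, along_hol_frameE_frameF_sub hx hS, sum_col_smul_frameF]
  · rw [bracket_hol_hol_snd]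

end Brackets

namespace IsModelData

variable (h : IsModelData H S)
include h

lemma matK_transpose (ζ : ℂ) : (matK H S Ω ζ)ᵀ = conjM (matK H S Ω ζ) := by
  have bigS_transpose := bigS_transpose Ω ζ h.transpose_S
  have conjM_bigS_transpose : (conjM (bigS S Ω ζ))ᵀ = conjM (bigS S Ω ζ) :=
    congrArg conjM bigS_transpose
  rw [matK, conjM_mul, conjM_conjM, h.conj_H, conjM_matP, Matrix.transpose_mul,
    Matrix.transpose_nonsing_inv, h.transpose_H, matP, Matrix.transpose_sub, Matrix.transpose_one,
    Matrix.transpose_mul, h.conjM_matA, matA, Matrix.transpose_mul, Matrix.transpose_mul,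
    h.transpose_H, bigS_transpose, conjM_bigS_transpose, mul_assoc, mul_assoc,
    ← mul_inv_one_sub_mul]
  simp only [mul_assoc]

lemma frameLevi_transpose (x : C4) : (frameLevi H S Ω x)ᵀ = conjM (frameLevi H S Ω x) := by
  have conjM_transpose : conjM (expU Ω x.2.2)ᵀ = (conjM (expU Ω x.2.2))ᵀ := rfl
  rw [frameLevi, Matrix.transpose_mul, Matrix.transpose_mul, Matrix.transpose_transpose,
    h.matK_transpose, conjM_mul, conjM_mul, conjM_conjM, conjM_transpose, mul_assoc]

lemma det_frameLevi_ne_zero (hx : IsRegular H S Ω x) : (frameLevi H S Ω x).det ≠ 0 := by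
  have det_expU := det_expU_ne_zero Ω x.2.2
  have det_matP : (matP H S Ω x.2.2).det ≠ 0 := by
    rw [matP, Matrix.det_nonsing_inv, Ring.inverse_eq_inv']
    exact inv_ne_zero hx
  rw [frameLevi, matK, Matrix.det_mul, Matrix.det_mul, Matrix.det_mul, Matrix.det_transpose,
    conjM_det, conjM_det]
  exact mul_ne_zero (mul_ne_zero det_expU (mul_ne_zero h.det_H
    (star_ne_zero.2 det_matP))) (star_ne_zero.2 det_expU)

variable (hx : IsRegular H S Ω x)
include hx

lemma frameF_mem_holTangent (b : Fin 2 → ℂ) :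
    frameF H S Ω b x ∈ holTangent (model H S Ω) x :=
  (h.mem_holTangent_iff hx _).2 (crForm_frameF b)

lemma frameE_mem_holTangent : frameE H S Ω x ∈ holTangent (model H S Ω) x :=
  (h.mem_holTangent_iff hx _).2 crForm_frameE

lemma bracket_frameF_frameF (a b : Fin 2) :
    bracket (hol (frameF H S Ω (Pi.single a 1))) (antihol (frameF H S Ω (Pi.single b 1))) x =
      ((2 * Complex.I * frameLevi H S Ω x a b) • (Complex.I, 0, 0),
        (starRingEnd ℂ) (2 * Complex.I * frameLevi H S Ω x a b) • (Complex.I, 0, 0)) := by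
  have levi_hermitian : (starRingEnd ℂ) (frameLevi H S Ω x a b) = frameLevi H S Ω x b a :=
    (congrFun (congrFun (h.frameLevi_transpose x) a) b).symm
  ext1
  · rw [bracket_hol_antihol_fst, along_antihol_frameF_frameF hx, Pi.star_single, star_one,
      Matrix.mulVec_single_one, single_one_dotProduct, Matrix.col_apply]
    simp only [Prod.neg_mk, Prod.smul_mk, smul_eq_mul, smul_zero, neg_zero, mul_zero]
    congr 1
    linear_combination (-2 * frameLevi H S Ω x a b) * Complex.I_mul_I
  · rw [bracket_hol_antihol_snd, along_antihol_frameF_frameF hx, Pi.star_single, star_one,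
      Matrix.mulVec_single_one, single_one_dotProduct, Matrix.col_apply]
    simp only [Prod.smul_mk, smul_eq_mul, smul_zero, mul_zero, map_mul, map_ofNat,
      Complex.conj_I, levi_hermitian]
    congr 1
    linear_combination (2 * frameLevi H S Ω x b a) * Complex.I_mul_I

end IsModelData

lemma eventually_isRegular : ∀ᶠ x in 𝓝 (0 : C4), IsRegular H S Ω x :=
  (isRegular_of_zeta_eq_zero rfl).eventually

/-- The adapted frame of the model, with `g = i ∂/∂w`. -/
def IsModelData.frame (h : IsModelData H S) (Ω : M2) : AdaptedFrame (model H S Ω) 0 where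
  g _ := (Complex.I, 0, 0)
  f k := frameF H S Ω (Pi.single k 1)
  e := frameE H S Ω
  levi := frameLevi H S Ω
  xi x := S * frameLevi H S Ω x
  om := frameOm H S Ω
  smooth_g := contDiffAt_const
  smooth_f _ := contDiffAt_frameF (isRegular_of_zeta_eq_zero rfl) _
  smooth_e := contDiffAt_frameE (isRegular_of_zeta_eq_zero rfl)
  smooth_levi := contDiffAt_frameLevi (isRegular_of_zeta_eq_zero rfl)
  smooth_xi := contDiffAt_mul_entries (F := fun _ => S) (fun _ _ => contDiffAt_const)
    (contDiffAt_frameLevi (isRegular_of_zeta_eq_zero rfl))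
  smooth_om := contDiffAt_frameOm (isRegular_of_zeta_eq_zero rfl)
  tangent_g := eventually_isRegular.mono fun x hx _ => by
    rw [h.fderiv_model hx, crForm_vertical, Complex.neg_re, Complex.I_re, neg_zero]
  tangent_f _ := eventually_isRegular.mono fun x hx _ => h.frameF_mem_holTangent hx _
  tangent_e := eventually_isRegular.mono fun x hx _ => h.frameE_mem_holTangent hx
  isFrame := eventually_isRegular.mono fun x hx _ => by
    refine ⟨?_, linearIndependent_frame x⟩
    rw [h.mem_holTangent_iff hx, crForm_vertical]
    exact neg_ne_zero.2 Complex.I_ne_zero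
  levi_ff := eventually_isRegular.mono fun x hx _ a b => by
    rw [h.bracket_frameF_frameF hx, sub_self, sub_self]
    exact ⟨zero_mem _, zero_mem _⟩
  levi_ef := eventually_isRegular.mono fun x hx _ b => by
    rw [bracket_frameE_frameF hx h.transpose_S]
    refine ⟨?_, zero_mem _⟩
    dsimp only
    exact sum_mem fun l _ => Submodule.smul_mem _ _ (h.frameF_mem_holTangent hx _)
  levi_ee := eventually_isRegular.mono fun x hx _ => by
    rw [bracket_frameE_frameE hx h.transpose_S]
    exact ⟨zero_mem _, zero_mem _⟩
  levi_nondeg := eventually_isRegular.mono fun x hx _ =>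
    isUnit_iff_ne_zero.2 (h.det_frameLevi_ne_zero hx)
  xi_spec := eventually_isRegular.mono fun x hx _ k => by
    rw [bracket_frameE_frameF hx h.transpose_S, sub_self]
    exact ⟨zero_mem _, zero_mem _⟩
  om_spec := eventually_isRegular.mono fun x hx _ k => by
    rw [bracket_hol_frameE_frameF hx h.transpose_S, sub_self]
    exact ⟨zero_mem _, zero_mem _⟩

end Frame

/-! ### The modified symbol of the model -/

lemma alongM_const_add {F : C4 → M2} {x : C4} (A : M2)
    (hF : ∀ i j, DifferentiableAt ℝ (fun y => F y i j) x) (Z : C4 × C4) :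
    alongM Z (fun y => A + F y) x = alongM Z F x := by
  ext i j
  simp only [alongM, Matrix.of_apply, Matrix.add_apply]
  rw [along_add (differentiableAt_const _) (hF i j), along_const, zero_add]

section ModelSymbol

variable {H S Ω : M2}

lemma frameLevi_zero : frameLevi H S Ω 0 = H := by
  simp [frameLevi, matK, matP_zero, expU_zero, conjM_one]

lemma frameOm_zero : frameOm H S Ω 0 = Ω := by
  simp [frameOm, matL, matA_zero, conjM_zero]

lemma frameE_zero : frameE H S Ω 0 = (0, 0, 1) := by
  simp [frameE, implicitY_zero]

lemma frameF_zero (b : Fin 2 → ℂ) : frameF H S Ω b 0 = (0, b, 0) := by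
  simp [frameF, implicitY_zero, expU_zero]

lemma IsRegular.conjM_matP_eq {x : C4} (hx : IsRegular H S Ω x) : conjM (matP H S Ω x.2.2) =
    1 + conjM (matA H S Ω x.2.2) * (matA H S Ω x.2.2 * conjM (matP H S Ω x.2.2)) := by
  have isUnit_det : IsUnit (1 - conjM (matA H S Ω x.2.2) * matA H S Ω x.2.2).det := by
    rw [Matrix.det_one_sub_mul_comm]
    exact isUnit_iff_ne_zero.2 hx
  have mul_inv := Matrix.mul_nonsing_inv _ isUnit_det
  rwa [sub_mul, one_mul, ← conjM_matP, sub_eq_iff_eq_add, mul_assoc] at mul_inv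

lemma alongM_conjM_matP_zero (Z : C4 × C4) :
    alongM Z (fun x : C4 => conjM (matP H S Ω x.2.2)) 0 = 0 := by
  have differentiableAt_conjM_matA (i j : Fin 2) :
      DifferentiableAt ℝ (fun y : C4 => conjM (matA H S Ω y.2.2) i j) 0 :=
    (contDiffAt_conj (contDiffAt_matA (n := 1) i j)).differentiableAt one_ne_zero
  have differentiableAt_matA_mul (i j : Fin 2) : DifferentiableAt ℝ
      (fun y : C4 => (matA H S Ω y.2.2 * conjM (matP H S Ω y.2.2)) i j) 0 :=
    (contDiffAt_mul_entries (n := 1) contDiffAt_matA (fun i j => contDiffAt_conj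
      (contDiffAt_matP (isRegular_of_zeta_eq_zero rfl) i j)) i j).differentiableAt one_ne_zero
  rw [alongM_congr (eventually_isRegular.mono fun x hx => hx.conjM_matP_eq),
    alongM_const_add 1
      (differentiableAt_mul_entries differentiableAt_conjM_matA differentiableAt_matA_mul),
    alongM_mul differentiableAt_conjM_matA differentiableAt_matA_mul]
  simp [matA_zero, conjM_zero]

lemma alongM_matK_zero (Z : C4 × C4) : alongM Z (fun x : C4 => matK H S Ω x.2.2) 0 = 0 := by
  have differentiableAt_conjM_matP (i j : Fin 2) :
      DifferentiableAt ℝ (fun y : C4 => conjM (matP H S Ω y.2.2) i j) 0 :=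
    (contDiffAt_conj (contDiffAt_matP (n := 1) (isRegular_of_zeta_eq_zero rfl)
      i j)).differentiableAt one_ne_zero
  have leibniz := alongM_mul (F := fun _ => H) (fun _ _ => differentiableAt_const _)
    differentiableAt_conjM_matP Z
  rwa [alongM_const, zero_mul, zero_add, alongM_conjM_matP_zero, mul_zero] at leibniz

lemma differentiableAt_frameLevi_zero (i j : Fin 2) :
    DifferentiableAt ℝ (fun y : C4 => frameLevi H S Ω y i j) 0 :=
  (contDiffAt_frameLevi (n := 1) (isRegular_of_zeta_eq_zero rfl) i j).differentiableAt one_ne_zero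

lemma alongM_frameLevi_zero : alongM ((0, 0, 1), 0) (frameLevi H S Ω) 0 = Ωᵀ * H := by
  have differentiableAt_expU (i j : Fin 2) :
      DifferentiableAt ℝ (fun y : C4 => expU Ω y.2.2 i j) 0 :=
    (contDiffAt_expU (n := 1) i j).differentiableAt one_ne_zero
  have differentiableAt_conjM_expU (i j : Fin 2) :
      DifferentiableAt ℝ (fun y : C4 => conjM (expU Ω y.2.2) i j) 0 :=
    (contDiffAt_conj (contDiffAt_expU (n := 1) i j)).differentiableAt one_ne_zero
  have differentiableAt_matK (i j : Fin 2) :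
      DifferentiableAt ℝ (fun y : C4 => matK H S Ω y.2.2 i j) 0 :=
    (contDiffAt_matK (n := 1) (isRegular_of_zeta_eq_zero rfl) i j).differentiableAt one_ne_zero
  have alongM_expU_zero : alongM ((0, 0, 1), 0) (fun y : C4 => expU Ω y.2.2) 0 = Ω := by
    simp [alongM_comp_zeta (hasDerivM_expU Ω _), expU_zero]
  have alongM_expU_transpose_zero :
      alongM ((0, 0, 1), 0) (fun y : C4 => (expU Ω y.2.2)ᵀ) 0 = Ωᵀ :=
    congrArg Matrix.transpose alongM_expU_zero
  have alongM_conjM_expU_zero :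
      alongM ((0, 0, 1), 0) (fun y : C4 => conjM (expU Ω y.2.2)) 0 = 0 := by
    simp [alongM_conjM differentiableAt_expU, alongM_comp_zeta (hasDerivM_expU Ω _), conjM_zero]
  have differentiableAt_expU_transpose (i j : Fin 2) :
      DifferentiableAt ℝ (fun y : C4 => (expU Ω y.2.2)ᵀ i j) 0 := differentiableAt_expU j i
  change alongM _ (fun y : C4 => (expU Ω y.2.2)ᵀ * matK H S Ω y.2.2 * conjM (expU Ω y.2.2)) 0 = _
  rw [alongM_mul (differentiableAt_mul_entries differentiableAt_expU_transpose
      differentiableAt_matK) differentiableAt_conjM_expU,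
    alongM_mul differentiableAt_expU_transpose differentiableAt_matK, alongM_matK_zero,
    alongM_conjM_expU_zero, alongM_expU_transpose_zero]
  simp [matK, matP_zero, expU_zero, conjM_one]

namespace IsModelData

variable (h : IsModelData H S) (Ω)
include h

lemma isTwoNondegenerate : IsTwoNondegenerate (model H S Ω) 0 := by
  have isRegular_zero : IsRegular H S Ω 0 := isRegular_of_zeta_eq_zero rfl
  refine ⟨h.analyticAt_model isRegular_zero, ?_, fun fderiv_eq_zero => ?_, h.frame Ω,
    fun xi_eq_zero => h.S_ne_zero ?_⟩
  · simp [h.model_eq]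
  · have fderiv_vertical := h.fderiv_model isRegular_zero (1, 0, 0)
    rw [fderiv_eq_zero, crForm_vertical] at fderiv_vertical
    simp at fderiv_vertical
  · change S * frameLevi H S Ω 0 = 0 at xi_eq_zero
    rw [frameLevi_zero] at xi_eq_zero
    rw [← Matrix.mul_nonsing_inv_cancel_right _ S (isUnit_iff_ne_zero.2 h.det_H), xi_eq_zero,
      zero_mul]

lemma s02_eq {x : C4} (hx : IsRegular H S Ω x) : (h.frame Ω).s02 x = S :=
  Matrix.mul_nonsing_inv_cancel_right _ _ (isUnit_iff_ne_zero.2 (h.det_frameLevi_ne_zero hx))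

lemma s0m2_eq (x : C4) :
    (h.frame Ω).s0m2 x = frameLevi H S Ω x * (conjM S * (frameLevi H S Ω x)ᵀ) := by
  rw [h.frameLevi_transpose, ← conjM_mul]
  rfl

lemma derivE_s02 : (h.frame Ω).derivE (h.frame Ω).s02 = 0 :=
  (alongM_congr (eventually_isRegular.mono fun _ hx => h.s02_eq Ω hx) _).trans (alongM_const _ _)

lemma derivE_s0m2 :
    (h.frame Ω).derivE (h.frame Ω).s0m2 = symAct Ωᵀ (H * conjM S * H) := by
  have differentiableAt_frameLevi_transpose (i j : Fin 2) :
      DifferentiableAt ℝ (fun y : C4 => (frameLevi H S Ω y)ᵀ i j) 0 :=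
    differentiableAt_frameLevi_zero j i
  have alongM_frameLevi_transpose :
      alongM ((0, 0, 1), 0) (fun y => (frameLevi H S Ω y)ᵀ) 0 = (Ωᵀ * H)ᵀ :=
    congrArg Matrix.transpose alongM_frameLevi_zero
  have derivE_eq : (h.frame Ω).derivE (h.frame Ω).s0m2 = alongM ((0, 0, 1), 0)
      (fun x => frameLevi H S Ω x * (conjM S * (frameLevi H S Ω x)ᵀ)) 0 := by
    rw [← funext (h.s0m2_eq Ω), ← frameE_zero (H := H) (S := S) (Ω := Ω)]
    rfl
  rw [derivE_eq, alongM_mul differentiableAt_frameLevi_zero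
      (differentiableAt_mul_entries (F := fun _ => conjM S) (fun _ _ => differentiableAt_const _)
        differentiableAt_frameLevi_transpose),
    alongM_mul (F := fun _ => conjM S) (fun _ _ => differentiableAt_const _)
      differentiableAt_frameLevi_transpose,
    alongM_frameLevi_transpose, alongM_const, alongM_frameLevi_zero, frameLevi_zero,
    h.transpose_H, Matrix.transpose_mul, h.transpose_H, zero_mul, zero_add, symAct]
  simp only [mul_assoc]

end IsModelData

lemma IsNormalizedSymbol.hasModifiedSymbol {N : Submodule ℂ M2}
    (h : IsNormalizedSymbol H S Ω N) : HasModifiedSymbol (model H S Ω) 0 H S Ω N := by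
  have om_zero : (h.frame Ω).om 0 = Ω := frameOm_zero
  refine ⟨h.frame Ω, frameLevi_zero, h.s02_eq Ω (isRegular_of_zeta_eq_zero rfl), ?_, ?_, ?_⟩
  · rw [h.derivE_s0m2, h.s0m2_eq, frameLevi_zero, h.transpose_H, ← mul_assoc]
    exact h.symAct_transpose_mem
  · rw [h.derivE_s02]
    exact zero_mem _
  · rw [om_zero, sub_self]
    exact zero_mem _

end ModelSymbol

/-! ### Weight-zero symmetries of the model -/

/-- The linear map `(w, z, ζ) ↦ (a w, B z, c ζ)`. -/
def diagMap (a : ℂ) (B : M2) (c : ℂ) : C4 →L[ℂ] C4 :=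
  LinearMap.toContinuousLinearMap
    { toFun x := (a * x.1, B *ᵥ x.2.1, c * x.2.2)
      map_add' x y := by simp [mul_add, Matrix.mulVec_add]
      map_smul' r x := by simp [Matrix.mulVec_smul, mul_left_comm] }

lemma diagMap_apply (a : ℂ) (B : M2) (c : ℂ) (x : C4) :
    diagMap a B c x = (a * x.1, B *ᵥ x.2.1, c * x.2.2) := rfl

lemma dotProduct_symAct_mulVec {A : M2} (hA : Aᵀ = A) (B : M2) (y : Fin 2 → ℂ) :
    y ⬝ᵥ (symAct B A *ᵥ y) = 2 * (y ⬝ᵥ (B *ᵥ (A *ᵥ y))) := by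
  have transpose_swap : y ⬝ᵥ ((A * Bᵀ) *ᵥ y) = y ⬝ᵥ ((B * A) *ᵥ y) := by
    rw [Matrix.dotProduct_mulVec, ← Matrix.mulVec_transpose, Matrix.transpose_mul,
      Matrix.transpose_transpose, hA, dotProduct_comm]
  rw [symAct, Matrix.add_mulVec, dotProduct_add, transpose_swap, Matrix.mulVec_mulVec, two_mul]

section Symmetries

variable {H S Ω B : M2} {a : ℝ} {c : ℂ}

lemma mul_dotProduct_bigS'_mulVec (hS : Sᵀ = S) (hBS : symAct B S = (a + c) • S)
    (hBΩ : ⁅B, Ω⁆ = c • Ω) (ζ : ℂ) (y : Fin 2 → ℂ) :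
    (c * ζ) * (y ⬝ᵥ (bigS' S Ω ζ *ᵥ y)) =
      2 * (y ⬝ᵥ (B *ᵥ (bigS S Ω ζ *ᵥ y))) - a * (y ⬝ᵥ (bigS S Ω ζ *ᵥ y)) := by
  rw [← smul_eq_mul, ← dotProduct_smul, ← Matrix.smul_mulVec, smul_bigS'_eq ζ hBS hBΩ,
    Matrix.sub_mulVec, dotProduct_sub, dotProduct_symAct_mulVec (bigS_transpose Ω ζ hS),
    Matrix.smul_mulVec, dotProduct_smul, smul_eq_mul]

namespace IsModelData

variable (h : IsModelData H S)
include h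

lemma re_dotProduct_mulVec_eq (hBH : Bᵀ * H + H * conjM B = (a : ℂ) • H) (u : Fin 2 → ℂ) :
    (2 * ((H *ᵥ star u) ⬝ᵥ (B *ᵥ u))).re = (a * ((H *ᵥ star u) ⬝ᵥ u)).re := by
  have conj_pairing :
      star ((H *ᵥ star u) ⬝ᵥ (B *ᵥ u)) = u ⬝ᵥ ((H * conjM B) *ᵥ star u) := by
    rw [star_dotProduct_eq, star_mulVec_eq_conjM_mulVec, star_mulVec_eq_conjM_mulVec, star_star,
      h.conj_H, ← Matrix.mulVec_mulVec, dotProduct_mulVec_of_transpose_eq h.transpose_H]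
  have pairing : (H *ᵥ star u) ⬝ᵥ (B *ᵥ u) = u ⬝ᵥ ((Bᵀ * H) *ᵥ star u) := by
    rw [dotProduct_comm, ← Matrix.vecMul_transpose, ← Matrix.dotProduct_mulVec,
      Matrix.mulVec_mulVec]
  have levi_invariance : (H *ᵥ star u) ⬝ᵥ (B *ᵥ u) + star ((H *ᵥ star u) ⬝ᵥ (B *ᵥ u)) =
      a * ((H *ᵥ star u) ⬝ᵥ u) := by
    rw [conj_pairing, pairing, ← dotProduct_add, ← Matrix.add_mulVec, hBH, Matrix.smul_mulVec,
      dotProduct_smul, smul_eq_mul, dotProduct_comm u]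
  rw [← levi_invariance, Complex.add_re, Complex.star_def, Complex.conj_re, two_mul,
    Complex.add_re]

lemma fderiv_model_diagMap (hBH : Bᵀ * H + H * conjM B = (a : ℂ) • H)
    (hBS : symAct B S = (a + c) • S) (hBΩ : ⁅B, Ω⁆ = c • Ω) {x : C4} (hx : IsRegular H S Ω x) :
    fderiv ℝ (model H S Ω) x (diagMap a B c x) = a * model H S Ω x := by
  have levi_pairing := h.re_dotProduct_mulVec_eq hBH (implicitU H S Ω x)
  have symbol_pairing :=
    mul_dotProduct_bigS'_mulVec h.transpose_S hBS hBΩ x.2.2 (implicitY H S Ω x)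
  change (2 * (implicitY H S Ω x ⬝ᵥ _)).re = (a * (implicitY H S Ω x ⬝ᵥ _)).re at levi_pairing
  rw [h.fderiv_model hx, h.model_eq, crForm, diagMap_apply, symbol_pairing,
    ← Complex.re_ofReal_mul, z_eq_implicitU_sub hx, Matrix.mulVec_sub,
    dotProduct_sub, mul_sub 2, sub_add_sub_cancel, dotProduct_comm _ (implicitY H S Ω x),
    dotProduct_sub]
  simp only [mul_sub, Complex.sub_re, levi_pairing]

lemma diagMap_mem_linearIsotropy (hBH : Bᵀ * H + H * conjM B = (a : ℂ) • H)
    (hBS : symAct B S = (a + c) • S) (hBΩ : ⁅B, Ω⁆ = c • Ω) :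
    diagMap a B c ∈ linearIsotropy (model H S Ω) 0 := by
  refine ⟨diagMap a B c, ⟨(diagMap a B c).analyticAt 0, ?_⟩, map_zero _, (diagMap a B c).fderiv⟩
  exact eventually_isRegular.mono fun x hx hx_mem => by
    rw [h.fderiv_model_diagMap hBH hBS hBΩ hx, hx_mem, mul_zero]

lemma isotropyMatrix_diagMap (Ω : M2) (a c : ℂ) (B : M2) :
    (h.frame Ω).isotropyMatrix (diagMap a B c) = B := by
  have isHypersurface := (h.isTwoNondegenerate Ω).isHypersurface
  have adaptedAt :=
    ((h.frame Ω).eventually_adaptedAt isHypersurface).self_of_nhds isHypersurface.zero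
  have diagMap_f (k : Fin 2) :
      diagMap a B c ((h.frame Ω).f k 0) = ∑ l, B l k • (h.frame Ω).f l 0 := by
    change diagMap a B c (frameF H S Ω (Pi.single k 1) 0) =
      ∑ l, B l k • frameF H S Ω (Pi.single l 1) 0
    rw [sum_col_smul_frameF, frameF_zero, frameF_zero, diagMap_apply, mul_zero, mul_zero]
  ext l k
  change ((h.frame Ω).coframe 0 (diagMap a B c ((h.frame Ω).f k 0))).2.1 l = B l k
  simp only [diagMap_f, map_sum, map_smul, AdaptedFrame.coframe_f adaptedAt.unit, Prod.snd_sum,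
    Prod.fst_sum, Finset.sum_apply, Prod.smul_snd, Prod.smul_fst, Pi.smul_apply, Pi.single_apply,
    smul_eq_mul, mul_ite, mul_one, mul_zero, Finset.sum_ite_eq, Finset.mem_univ, if_true]

lemma finrank_symbolAlgebra_le (Ω : M2) :
    Module.finrank ℝ (symbolAlgebra H S Ω) ≤ degreeZeroIsotropyDim (model H S Ω) 0 := by
  have finiteDimensional_complex : FiniteDimensional ℂ (C4 →L[ℂ] C4) :=
    LinearEquiv.finiteDimensional (LinearMap.toContinuousLinearMap (𝕜 := ℂ) (E := C4) (F' := C4))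
  have finiteDimensional_real : FiniteDimensional ℝ (C4 →L[ℂ] C4) :=
    FiniteDimensional.complexToReal _
  refine finrank_le_finrank_map_mkQ (h.frame Ω).isotropyMatrix
    ((h.frame Ω).positiveWeight_le_ker (h.isTwoNondegenerate Ω).isHypersurface) ?_
  rintro B ⟨a, c, hBH, hBS, hBΩ⟩
  exact ⟨diagMap a B c, h.diagMap_mem_linearIsotropy hBH hBS hBΩ,
    h.isotropyMatrix_diagMap Ω a c B⟩

end IsModelData

end Symmetries

/-! ### The rows of the table -/

section Table

lemma IsModelData.isNormalizedSymbol_zero {H S : M2} (h : IsModelData H S)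
    (N : Submodule ℂ M2) : IsNormalizedSymbol H S 0 N where
  toIsModelData := h
  symAct_transpose_mem := by simp [symAct]
  lie_eq _ _ _ _ := by simp [Ring.lie_def]

lemma isModelData_diagonal {ε : ℂ} (hε : ε = 1 ∨ ε = -1) {S : M2} (transpose_S : Sᵀ = S)
    (S_ne_zero : S ≠ 0) : IsModelData !![1, 0; 0, ε] S where
  transpose_H := by simp [← Matrix.ext_iff, Fin.forall_fin_two]
  conj_H := by rcases hε with rfl | rfl <;> simp [← Matrix.ext_iff, Fin.forall_fin_two, conjM]
  det_H := by rcases hε with rfl | rfl <;> simp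
  transpose_S := transpose_S
  S_ne_zero := S_ne_zero

lemma isModelData_antidiagonal {S : M2} (transpose_S : Sᵀ = S) (S_ne_zero : S ≠ 0) :
    IsModelData !![0, 1; 1, 0] S where
  transpose_H := by simp [← Matrix.ext_iff, Fin.forall_fin_two]
  conj_H := by simp [← Matrix.ext_iff, Fin.forall_fin_two, conjM]
  det_H := by simp
  transpose_S := transpose_S
  S_ne_zero := S_ne_zero

lemma exists_eq_fin_two (B : M2) : ∃ a b c d : ℂ, B = !![a, b; c, d] :=
  ⟨_, _, _, _, B.eta_fin_two⟩

lemma fin_two_ne_zero_of_left {b c d : ℂ} : !![1, b; c, d] ≠ 0 := fun h => by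
  simpa using congrFun (congrFun h 0) 0

lemma antidiagonal_ne_zero : (!![0, 1; 1, 0] : M2) ≠ 0 := fun h => by
  simpa using congrFun (congrFun h 0) 1

lemma fin_two_inj {a b c d a' b' c' d' : ℂ} :
    !![a, b; c, d] = !![a', b'; c', d'] ↔ a = a' ∧ b = b' ∧ c = c' ∧ d = d' := by
  simp [and_assoc]

lemma smul_fin_two (s a b c d : ℂ) : s • !![a, b; c, d] = !![s * a, s * b; s * c, s * d] := by
  simp

lemma add_fin_two (a b c d a' b' c' d' : ℂ) : !![a, b; c, d] + !![a', b'; c', d'] =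
    !![a + a', b + b'; c + c', d + d'] := by
  simp

lemma sub_fin_two (a b c d a' b' c' d' : ℂ) : !![a, b; c, d] - !![a', b'; c', d'] =
    !![a - a', b - b'; c - c', d - d'] := by
  simp

lemma transpose_fin_two (a b c d : ℂ) : !![a, b; c, d]ᵀ = !![a, c; b, d] := by
  simp [← Matrix.ext_iff, Fin.forall_fin_two]

lemma conjM_fin_two (a b c d : ℂ) : conjM !![a, b; c, d] =
    !![(starRingEnd ℂ) a, (starRingEnd ℂ) b; (starRingEnd ℂ) c, (starRingEnd ℂ) d] := by
  simp [← Matrix.ext_iff, Fin.forall_fin_two, conjM]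

lemma symAct_fin_two (a b c d x y z : ℂ) :
    symAct !![a, b; c, d] !![x, y; y, z] =
      !![2 * (a * x + b * y), a * y + b * z + c * x + d * y;
        a * y + b * z + c * x + d * y, 2 * (c * y + d * z)] := by
  simp only [symAct, transpose_fin_two, Matrix.mul_fin_two, add_fin_two]
  exact fin_two_inj.2 ⟨by ring, by ring, by ring, by ring⟩

lemma transpose_mul_add_mul_conjM_fin_two (a b c d x y z : ℂ) :
    !![a, b; c, d]ᵀ * !![x, y; y, z] + !![x, y; y, z] * conjM !![a, b; c, d] =
      !![a * x + c * y + x * (starRingEnd ℂ) a + y * (starRingEnd ℂ) c,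
        a * y + c * z + x * (starRingEnd ℂ) b + y * (starRingEnd ℂ) d;
        b * x + d * y + y * (starRingEnd ℂ) a + z * (starRingEnd ℂ) c,
        b * y + d * z + y * (starRingEnd ℂ) b + z * (starRingEnd ℂ) d] := by
  simp only [transpose_fin_two, conjM_fin_two, Matrix.mul_fin_two, add_fin_two]
  exact fin_two_inj.2 ⟨by ring, by ring, by ring, by ring⟩

lemma lie_smul_one (b : ℂ) (Ω : M2) : ⁅b • (1 : M2), Ω⁆ = 0 := by
  simp [Ring.lie_def]

lemma eq_smul_one_of_symAct_diagonal {B : M2} {q s : ℂ} (q_ne_zero : q ≠ 0)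
    (apply_eq_zero : B 0 1 = 0) (h : symAct B !![1, 0; 0, q] = s • !![1, 0; 0, q]) :
    B = B 0 0 • (1 : M2) := by
  obtain ⟨b00, b01, b10, b11, rfl⟩ := exists_eq_fin_two B
  simp only [Matrix.of_apply, Matrix.cons_val] at apply_eq_zero ⊢
  rw [symAct_fin_two, smul_fin_two, fin_two_inj] at h
  obtain ⟨h00, h01, -, h11⟩ := h
  rw [Matrix.one_fin_two, smul_fin_two, fin_two_inj]
  refine ⟨by ring, by rw [apply_eq_zero, mul_zero],
    by linear_combination h01 - q * apply_eq_zero, ?_⟩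
  exact mul_left_cancel₀ q_ne_zero (by linear_combination (h11 - q * h00) / 2)

lemma isNormalizedSymbol_diagonal {H : M2} {q τ : ℂ} (h : IsModelData H !![1, 0; 0, q])
    (q_ne_zero : q ≠ 0) (q_sq_ne_one : q ^ 2 ≠ 1) {x : ℂ}
    (mul_conjM_mul : H * conjM !![1, 0; 0, q] * H = !![x, 0; 0, q * x])
    (apply_eq_zero : ∀ {B : M2} {a : ℝ} {s : ℂ}, Bᵀ * H + H * conjM B = (a : ℂ) • H →
      symAct B !![1, 0; 0, q] = s • !![1, 0; 0, q] → B 0 1 = 0) :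
    IsNormalizedSymbol H !![1, 0; 0, q] !![0, -(τ * q); τ, 0]
      (Submodule.span ℂ {!![0, 0; 0, 1]}) where
  toIsModelData := h
  symAct_transpose_mem := by
    refine Submodule.mem_span_singleton.2 ⟨0, ?_⟩
    rw [mul_conjM_mul, transpose_fin_two, symAct_fin_two, smul_fin_two, fin_two_inj]
    exact ⟨by ring, by ring, by ring, by ring⟩
  lie_eq {B n a c κ} hn levi_eq sym_eq derivative_eq := by
    obtain ⟨ν, rfl⟩ := Submodule.mem_span_singleton.1 hn
    have B_eq := eq_smul_one_of_symAct_diagonal q_ne_zero (apply_eq_zero levi_eq sym_eq) sym_eq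
    generalize B 0 0 = b at B_eq
    subst B_eq
    rw [lie_smul_one, zero_sub, ← neg_smul, Matrix.one_fin_two] at derivative_eq
    simp only [smul_fin_two, symAct_fin_two, add_fin_two, sub_fin_two, fin_two_inj]
      at derivative_eq
    have c_mul_eq_zero : c * τ = 0 :=
      mul_left_cancel₀ (sub_ne_zero.2 q_sq_ne_one) (by linear_combination derivative_eq.2.1)
    rw [lie_smul_one, smul_fin_two, mul_neg, ← mul_assoc, c_mul_eq_zero]
    simpa using Matrix.eta_fin_two (0 : M2)

lemma isNormalizedSymbol_row1 {ε : ℂ} (hε : ε = 1 ∨ ε = -1) {l : ℝ} (hl : 1 < l) (τ : ℂ) :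
    IsNormalizedSymbol !![1, 0; 0, ε] !![1, 0; 0, (l : ℂ)] !![0, -(τ * l); τ, 0]
      (Submodule.span ℂ {!![0, 0; 0, 1]}) := by
  have l_ne_zero : (l : ℂ) ≠ 0 := Complex.ofReal_ne_zero.2 (by linarith)
  have l_sq_ne_one : (l : ℂ) ^ 2 ≠ 1 := by exact_mod_cast (one_lt_pow₀ hl two_ne_zero).ne'
  have ε_sq : ε * ε = 1 := by rcases hε with rfl | rfl <;> ring
  refine isNormalizedSymbol_diagonal (x := 1)
    (isModelData_diagonal hε (transpose_fin_two _ _ _ _) fin_two_ne_zero_of_left)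
    l_ne_zero l_sq_ne_one ?_ ?_
  · rw [conjM_fin_two, Complex.conj_ofReal]
    simp only [Matrix.mul_fin_two, fin_two_inj, map_zero, map_one]
    exact ⟨by ring, by ring, by ring, by linear_combination (l : ℂ) * ε_sq⟩
  · intro B a s levi_eq sym_eq
    obtain ⟨b00, b01, b10, b11, rfl⟩ := exists_eq_fin_two B
    rw [transpose_mul_add_mul_conjM_fin_two, smul_fin_two, fin_two_inj] at levi_eq
    rw [symAct_fin_two, smul_fin_two, fin_two_inj] at sym_eq
    have b10_eq : b10 = -(l * b01) := by linear_combination sym_eq.2.1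
    have conj_b01_eq : (starRingEnd ℂ) b01 = l * b01 * ε := by
      linear_combination levi_eq.2.1 - ε * b10_eq
    have norm_b01_eq : ‖b01‖ = l * ‖b01‖ := by
      have norm_ε : ‖ε‖ = 1 := by rcases hε with rfl | rfl <;> simp
      simpa [norm_ε, abs_of_pos (one_pos.trans hl)] using congrArg norm conj_b01_eq
    have norm_mul_eq_zero : (l - 1) * ‖b01‖ = 0 := by linarith
    simpa [(sub_pos.2 hl).ne'] using norm_mul_eq_zero

lemma isNormalizedSymbol_row2 {θ : ℝ} (hθ : 0 < θ) (hθ' : θ < Real.pi) (τ : ℂ) :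
    IsNormalizedSymbol !![0, 1; 1, 0] !![1, 0; 0, Complex.exp (Complex.I * θ)]
      !![0, -(τ * Complex.exp (Complex.I * θ)); τ, 0]
      (Submodule.span ℂ {!![0, 0; 0, 1]}) := by
  have q_ne_zero := Complex.exp_ne_zero (Complex.I * θ)
  have q_im : (Complex.exp (Complex.I * θ)).im ≠ 0 := by
    rw [mul_comm, Complex.exp_ofReal_mul_I_im]
    exact (Real.sin_pos_of_pos_of_lt_pi hθ hθ').ne'
  have q_mul_conj : Complex.exp (Complex.I * θ) *
      (starRingEnd ℂ) (Complex.exp (Complex.I * θ)) = 1 := by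
    rw [← Complex.exp_conj, ← Complex.exp_add]
    simp
  generalize Complex.exp (Complex.I * θ) = q at q_ne_zero q_im q_mul_conj ⊢
  refine isNormalizedSymbol_diagonal (x := (starRingEnd ℂ) q)
    (isModelData_antidiagonal (transpose_fin_two _ _ _ _) fin_two_ne_zero_of_left)
    q_ne_zero (fun q_sq => ?_) ?_ ?_
  · rcases sq_eq_one_iff.1 q_sq with rfl | rfl <;> simp at q_im
  · rw [conjM_fin_two, q_mul_conj]
    simp
  · intro B a s levi_eq sym_eq
    obtain ⟨b00, b01, b10, b11, rfl⟩ := exists_eq_fin_two B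
    rw [transpose_mul_add_mul_conjM_fin_two, smul_fin_two, fin_two_inj] at levi_eq
    rw [symAct_fin_two, smul_fin_two, fin_two_inj] at sym_eq
    have b10_eq : b10 = -(q * b01) := by linear_combination sym_eq.2.1
    have b10_re : b10.re = 0 := by simpa using congrArg Complex.re levi_eq.1
    have b01_re : b01.re = 0 := by simpa using congrArg Complex.re levi_eq.2.2.2
    have b01_im : b01.im = 0 := by
      simpa [b10_re, b01_re, q_im] using congrArg Complex.re b10_eq
    exact Complex.ext b01_re b01_im

lemma isNormalizedSymbol_row4 {ε : ℂ} (hε : ε = 1 ∨ ε = -1) (τ : ℂ) :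
    IsNormalizedSymbol !![1, 0; 0, ε] !![1, 0; 0, 0] !![0, 0; τ, 0]
      (Submodule.span ℂ {!![0, 0; 0, 1]}) where
  toIsModelData := isModelData_diagonal hε (transpose_fin_two _ _ _ _) fin_two_ne_zero_of_left
  symAct_transpose_mem := by
    refine Submodule.mem_span_singleton.2 ⟨0, ?_⟩
    simp only [conjM_fin_two, transpose_fin_two, Matrix.mul_fin_two, map_one, map_zero, mul_zero,
      zero_mul, add_zero, symAct_fin_two, smul_fin_two]
  lie_eq {B n a c κ} hn levi_eq sym_eq derivative_eq := by
    obtain ⟨ν, rfl⟩ := Submodule.mem_span_singleton.1 hn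
    obtain ⟨b00, b01, b10, b11, rfl⟩ := exists_eq_fin_two B
    rw [transpose_mul_add_mul_conjM_fin_two, smul_fin_two, fin_two_inj] at levi_eq
    rw [symAct_fin_two, smul_fin_two, fin_two_inj] at sym_eq
    have b10_eq_zero : b10 = 0 := by linear_combination sym_eq.2.1
    have b01_eq_zero : b01 = 0 := (map_eq_zero (starRingEnd ℂ)).1
      (by linear_combination levi_eq.2.1 - ε * b10_eq_zero)
    subst b10_eq_zero b01_eq_zero
    simp only [Ring.lie_def, Matrix.mul_fin_two, smul_fin_two, sub_fin_two, symAct_fin_two,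
      add_fin_two, fin_two_inj] at derivative_eq ⊢
    exact ⟨by ring, by ring, by linear_combination derivative_eq.2.1, by ring⟩

lemma isNormalizedSymbol_row6 (τ : ℂ) :
    IsNormalizedSymbol !![0, 1; 1, 0] !![1, 1; 1, 0] !![2 * τ, τ; 0, 0]
      (Submodule.span ℂ {!![0, 0; 0, 1]}) where
  toIsModelData := isModelData_antidiagonal (transpose_fin_two _ _ _ _) fin_two_ne_zero_of_left
  symAct_transpose_mem := by
    refine Submodule.mem_span_singleton.2 ⟨2 * τ, ?_⟩
    simp only [conjM_fin_two, transpose_fin_two, Matrix.mul_fin_two, map_one, map_zero, mul_zero,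
      mul_one, add_zero, zero_add, symAct_fin_two, smul_fin_two]
  lie_eq {B n a c κ} hn levi_eq sym_eq derivative_eq := by
    obtain ⟨ν, rfl⟩ := Submodule.mem_span_singleton.1 hn
    obtain ⟨b00, b01, b10, b11, rfl⟩ := exists_eq_fin_two B
    rw [transpose_mul_add_mul_conjM_fin_two, smul_fin_two, fin_two_inj] at levi_eq
    rw [symAct_fin_two, smul_fin_two, fin_two_inj] at sym_eq
    have b10_eq_zero : b10 = 0 := by linear_combination sym_eq.2.2.2 / 2
    have b11_eq : b11 = b00 + 2 * b01 := by
      linear_combination sym_eq.2.1 - sym_eq.1 - b10_eq_zero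
    have b01_eq_zero : b01 = 0 := by
      apply Complex.ext
      · simpa using congrArg Complex.re levi_eq.2.2.2
      · simpa [b11_eq, b10_eq_zero] using congrArg Complex.im levi_eq.2.1
    subst b11_eq b10_eq_zero b01_eq_zero
    simp only [Ring.lie_def, Matrix.mul_fin_two, smul_fin_two, sub_fin_two, symAct_fin_two,
      add_fin_two, fin_two_inj] at derivative_eq ⊢
    have c_mul_eq_zero : c * τ = 0 := by
      linear_combination (derivative_eq.2.1 - derivative_eq.1) / 4
    exact ⟨by linear_combination -2 * c_mul_eq_zero, by linear_combination -c_mul_eq_zero,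
      by ring, by ring⟩

theorem IsTableSymbol.isNormalizedSymbol {H S Ω : M2} {N : Submodule ℂ M2}
    (h : IsTableSymbol H S Ω N) : IsNormalizedSymbol H S Ω N := by
  cases h with
  | row1 ε hε l τ hl _ => exact isNormalizedSymbol_row1 hε hl τ
  | row2 θ τ hθ hθ' _ => exact isNormalizedSymbol_row2 hθ hθ' τ
  | row3 ε hε =>
    exact (isModelData_diagonal hε (transpose_fin_two _ _ _ _) antidiagonal_ne_zero
      ).isNormalizedSymbol_zero _
  | row4 ε hε τ _ => exact isNormalizedSymbol_row4 hε τ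
  | row5 =>
    exact (isModelData_antidiagonal (transpose_fin_two _ _ _ _) antidiagonal_ne_zero
      ).isNormalizedSymbol_zero _
  | row6 τ _ => exact isNormalizedSymbol_row6 τ
  | row7 =>
    exact (isModelData_antidiagonal (transpose_fin_two _ _ _ _) fin_two_ne_zero_of_left
      ).isNormalizedSymbol_zero _

end Table

theorem corollary2p5_general {H S Ω : M2} {N : Submodule ℂ M2}
    (h : IsNormalizedSymbol H S Ω N) :
    IsTwoNondegenerate (model H S Ω) 0 ∧
    HasModifiedSymbol (model H S Ω) 0 H S Ω N ∧
    ∀ (ρ : C4 → ℝ) (p : C4),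
      IsHypersurface ρ p → HasModifiedSymbol ρ p H S Ω N →
        degreeZeroIsotropyDim ρ p ≤ degreeZeroIsotropyDim (model H S Ω) 0 :=
  ⟨h.isTwoNondegenerate Ω, h.hasModifiedSymbol, fun _ _ hρ hsym =>
    (h.degreeZeroIsotropyDim_le hρ hsym).trans (h.finrank_symbolAlgebra_le Ω)⟩

end CR4

end

theorem corollary2p5 (H S Ω : CR4.M2) (N : Submodule ℂ CR4.M2)
    (hsymb : CR4.IsTableSymbol H S Ω N) :
    CR4.IsTwoNondegenerate (CR4.model H S Ω) 0 ∧
    CR4.HasModifiedSymbol (CR4.model H S Ω) 0 H S Ω N ∧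
    ∀ (ρ : CR4.C4 → ℝ) (p : CR4.C4),
      CR4.IsTwoNondegenerate ρ p → CR4.HasModifiedSymbol ρ p H S Ω N →
        CR4.degreeZeroIsotropyDim ρ p ≤ CR4.degreeZeroIsotropyDim (CR4.model H S Ω) 0 :=
  have ⟨htwo, hmodel, hle⟩ := CR4.corollary2p5_general hsymb.isNormalizedSymbol
  ⟨htwo, hmodel, fun ρ p hρ => hle ρ p hρ.isHypersurface⟩
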